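/- Let $\mathsf{RCA}_0^\omega$ be Kohlenbach's base theory of higher-order Reverse Mathematics: classical predicate logic in the language of all finite types with equality $=_0$ for numbers only (equality at higher types being defined extensionally), the constants $0$, successor, the combinators $\Pi,\Sigma$ in all types and the recursor $R_0$ for primitive recursion at type $0$, with the axioms: the successor axioms, the defining axioms of $\Pi,\Sigma,R_0$, extensionality in all types, induction for quantifier-free formulas, and quantifier-free choice $\mathsf{QF\text{-}AC}^{1,0}$: $(\forall f^1)(\exists n^0)A(f,n)\to(\exists Y^2)(\forall f^1)A(f,Y(f))$ for quantifier-free $A$. In this language real numbers are sequences $(q_n)$ of rationals with $|q_n-q_{n+i}|<2^{-n}$ for all $n,i$, and functions on $\mathbb R$ respect equality of reals. A subset $A$ of $\mathbb R$ (of $2^{\mathbb N}$) is given by a function $F_A$ from $\mathbb R$ (from $2^{\mathbb N}$) to $\mathbb R$, where $x\in A$ means $F_A(x)>0$. A set $A$ is countable if there is a function $Y$ from $\mathbb R$ (from $2^{\mathbb N}$) to $\mathbb N$ that is injective on $A$. Consider the following principles. * $\mathsf{cocode}_0$: for every non-empty countable set $A\subseteq[0,1]$ there is a sequence $(x_n)_{n\in\mathbb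 N}$ in $A$ such that for all $x\in\mathbb R$: $x\in A\leftrightarrow(\exists n\in\mathbb N)(x_n=x)$. * $\mathsf{BWC}_0$: every countable set $A\subseteq 2^{\mathbb N}$ has a supremum in $2^{\mathbb N}$ for the lexicographic ordering. * $\mathsf{BWC}_0^{\mathsf{pwo}}$: every countable set $A\subseteq 2^{\mathbb N}$ has a supremum for the pointwise ordering, i.e. there is $s\in 2^{\mathbb N}$ such that every $f\in A$ is pointwise below $s$, and for every $k$ with $s(k)=1$ there is $f\in A$ with $f(k)=1$. * $\mathsf{range}_0$: if $Y:2^{\mathbb N}\to\mathbb N$ is injective on $A\subseteq2^{\mathbb N}$, there is $X\subseteq\mathbb N$ such that for all $n$: $n\in X\leftrightarrow(\exists f\in A)(Y(f)=n)$. * $\mathsf{IND}_0$: if $Y$ is such that for every $n\in\mathbb N$ there is at most one $f\in2^{\mathbb N}$ with $Y(f,n)=0$, then for every $k\in\mathbb N$ there is a finite sequence $w$ of elements of $\mathbb N^{\mathbb N}$ such that for all $m\le k$: $(\exists i<|w|)(w(i)\in2^{\mathbb N}\wedge Y(w(i),m)=0)\leftrightarrow(\exists f\in2^{\mathbb N})(Y(f,m)=0)$.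 **Theorem.** $\mathsf{RCA}_0^\omega$ proves $$\mathsf{cocode}_0\leftrightarrow[\mathsf{BWC}_0+\mathsf{IND}_0]\leftrightarrow[\mathsf{range}_0+\mathsf{IND}_0]\leftrightarrow\mathsf{BWC}_0^{\mathsf{pwo}}.$$ -/

import Mathlib

/-!
The language of all finite types, classical many-sorted predicate logic with equality for
numbers only, the base theory `RCA₀^ω` of higher-order reverse mathematics, and third-order
principles about countable sets, written as sentences of that language.
-/

namespace HigherOrderRM

/-! ### Finite types, terms and formulas -/

/-- The finite types: the type `0` of natural numbers, and function types `σ → τ`. -/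
inductive Ty : Type
  | nat : Ty
  | arr : Ty → Ty → Ty
  deriving DecidableEq

/-- Type `1`: functions from numbers to numbers. -/
abbrev Ty.one : Ty := Ty.arr Ty.nat Ty.nat

/-- Type `2`: functionals from type `1` to numbers. -/
abbrev Ty.two : Ty := Ty.arr Ty.one Ty.nat

/-- The terms of each finite type. Each type `σ` has its own variables `var σ 0`, `var σ 1`, …
The constants are zero, successor, the combinators `Π` (`K`) and `Σ` (`S`) in all types, and the
recursor `R₀` for primitive recursion at type `0`. Terms have no binders. -/
inductive Tm : Ty → Type
  | var (σ : Ty) (n : ℕ) : Tm σ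
  | zero : Tm Ty.nat
  | succ : Tm Ty.one
  | K (σ τ : Ty) : Tm (Ty.arr σ (Ty.arr τ σ))
  | S (ρ σ τ : Ty) :
      Tm (Ty.arr (Ty.arr ρ (Ty.arr σ τ)) (Ty.arr (Ty.arr ρ σ) (Ty.arr ρ τ)))
  | R : Tm (Ty.arr Ty.nat (Ty.arr (Ty.arr Ty.nat (Ty.arr Ty.nat Ty.nat)) (Ty.arr Ty.nat Ty.nat)))
  | app {σ τ : Ty} : Tm (Ty.arr σ τ) → Tm σ → Tm τ

infixl:75 " ⬝ " => Tm.app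

/-- Formulas. The prime formulas are the equations between terms of type `0`.
`all σ φ` binds the variable `var σ 0` of `φ`; inside `φ` the variable `var σ (n + 1)` stands for
the variable `var σ n` outside (de Bruijn indices, counted separately for each type). -/
inductive Fm : Type
  | eq : Tm Ty.nat → Tm Ty.nat → Fm
  | bot : Fm
  | imp : Fm → Fm → Fm
  | all : Ty → Fm → Fm

/-- Simultaneous substitutions of terms for variables. -/
abbrev Sub : Type := (σ : Ty) → ℕ → Tm σ

/-- Apply a substitution to a term. -/
def Tm.subst (s : Sub) : {σ : Ty} → Tm σ → Tm σ
  | _, .var σ n => s σ n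
  | _, .zero => .zero
  | _, .succ => .succ
  | _, .K σ τ => .K σ τ
  | _, .S ρ σ τ => .S ρ σ τ
  | _, .R => .R
  | _, .app t u => .app (t.subst s) (u.subst s)

/-- The substitution that raises the indices of the variables of type `σ` by `k`. -/
def Sub.up (σ : Ty) (k : ℕ) : Sub :=
  fun τ n => Tm.var τ (if τ = σ then n + k else n)

/-- Weakening of a term under `k` binders of type `σ`. -/
def Tm.up (σ : Ty) (k : ℕ) {τ : Ty} (t : Tm τ) : Tm τ := t.subst (Sub.up σ k)

/-- Extend a substitution under one binder of type `σ`. -/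
def Sub.lift (σ : Ty) (s : Sub) : Sub := fun τ n =>
  if τ = σ then
    match n with
    | 0 => Tm.var τ 0
    | m + 1 => (s τ m).up σ 1
  else (s τ n).up σ 1

/-- The substitution of `t` for `var σ 0` that lowers the other variables of type `σ` by one. -/
def Sub.inst {σ : Ty} (t : Tm σ) : Sub := fun τ n =>
  if h : τ = σ then
    match n with
    | 0 => h ▸ t
    | m + 1 => Tm.var τ m
  else Tm.var τ n

/-- The substitution of the successor of `var nat 0` for `var nat 0`. -/
def Sub.next : Sub := fun τ n =>
  if h : τ = Ty.nat then
    match n with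
    | 0 => h ▸ (Tm.succ ⬝ Tm.var Ty.nat 0)
    | m + 1 => Tm.var τ (m + 1)
  else Tm.var τ n

/-- Apply a substitution to a formula (free variables are never captured). -/
def Fm.subst : Sub → Fm → Fm
  | s, .eq t u => .eq (t.subst s) (u.subst s)
  | _, .bot => .bot
  | s, .imp φ ψ => .imp (φ.subst s) (ψ.subst s)
  | s, .all σ φ => .all σ (φ.subst (s.lift σ))

/-- Weakening of a formula under one binder of type `σ`. -/
def Fm.up (σ : Ty) (φ : Fm) : Fm := φ.subst (Sub.up σ 1)

/-- `φ.inst t` is `φ` with `t` in place of the variable `var σ 0`. -/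
def Fm.inst {σ : Ty} (φ : Fm) (t : Tm σ) : Fm := φ.subst (Sub.inst t)

/-- Negation. -/
def Fm.neg (φ : Fm) : Fm := φ.imp .bot

/-- Conjunction (classically defined). -/
def Fm.conj (φ ψ : Fm) : Fm := (φ.imp ψ.neg).neg

/-- Disjunction (classically defined). -/
def Fm.disj (φ ψ : Fm) : Fm := φ.neg.imp ψ

/-- Equivalence. -/
def Fm.iff (φ ψ : Fm) : Fm := (φ.imp ψ).conj (ψ.imp φ)

/-- Existential quantifier (classically defined); it binds like `Fm.all`. -/
def Fm.ex (σ : Ty) (φ : Fm) : Fm := (Fm.all σ φ.neg).neg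

/-- `k` universal quantifiers over numbers. -/
def Fm.allNat : ℕ → Fm → Fm
  | 0, φ => φ
  | k + 1, φ => .all .nat (Fm.allNat k φ)

/-- Quantifier-free formulas; they may contain variables of all types. -/
def Fm.QF : Fm → Prop
  | .eq _ _ => True
  | .bot => True
  | .imp φ ψ => φ.QF ∧ ψ.QF
  | .all _ _ => False

/-- Equality of objects of type `σ`, defined extensionally from equality of numbers. -/
def eqAt : (σ : Ty) → Tm σ → Tm σ → Fm
  | .nat, s, t => .eq s t
  | .arr σ τ, s, t => .all σ (eqAt τ (s.up σ 1 ⬝ .var σ 0) (t.up σ 1 ⬝ .var σ 0))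

/-! ### Derivations -/

/-- Natural deduction for classical many-sorted predicate logic with equality at type `0`, over a
set `T` of non-logical axioms. The free variables of an axiom in `T` are read universally.
`Derives T Γ φ` says that `φ` has a derivation from the axioms `T` and the open
assumptions `Γ`. -/
inductive Derives (T : Set Fm) : List Fm → Fm → Prop
  | ax {Γ : List Fm} {φ : Fm} : φ ∈ T → Derives T Γ φ
  | hyp {Γ : List Fm} {φ : Fm} : φ ∈ Γ → Derives T Γ φ
  | impI {Γ : List Fm} {φ ψ : Fm} : Derives T (φ :: Γ) ψ → Derives T Γ (φ.imp ψ)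
  | impE {Γ : List Fm} {φ ψ : Fm} : Derives T Γ (φ.imp ψ) → Derives T Γ φ → Derives T Γ ψ
  | raa {Γ : List Fm} {φ : Fm} : Derives T (φ.neg :: Γ) .bot → Derives T Γ φ
  | allI {Γ : List Fm} {σ : Ty} {φ : Fm} :
      Derives T (Γ.map (Fm.up σ)) φ → Derives T Γ (.all σ φ)
  | allE {Γ : List Fm} {σ : Ty} {φ : Fm} (t : Tm σ) :
      Derives T Γ (.all σ φ) → Derives T Γ (φ.inst t)
  | eqRefl {Γ : List Fm} (t : Tm Ty.nat) : Derives T Γ (.eq t t)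
  | eqSubst {Γ : List Fm} {s t : Tm Ty.nat} (φ : Fm) :
      Derives T Γ (.eq s t) → Derives T Γ (φ.inst s) → Derives T Γ (φ.inst t)

/-- The theory `T` proves `φ`. -/
def Proves (T : Set Fm) (φ : Fm) : Prop := Derives T [] φ

/-! ### The base theory -/

/-- The axioms of `RCA₀^ω`: the successor axioms, the defining axioms of the combinators and of the
recursor `R₀`, extensionality in all types, induction for quantifier-free formulas, and
quantifier-free choice from type `1` to type `0`. -/
inductive RCA0ω : Set Fm
  | succ_ne_zero : RCA0ω (Fm.neg (.eq (.succ ⬝ .var .nat 0) .zero))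
  | succ_inj : RCA0ω
      (.imp (.eq (.succ ⬝ .var .nat 0) (.succ ⬝ .var .nat 1)) (.eq (.var .nat 0) (.var .nat 1)))
  | K_ax (σ τ : Ty) (x : Tm σ) (y : Tm τ) : RCA0ω (eqAt σ (.K σ τ ⬝ x ⬝ y) x)
  | S_ax (ρ σ τ : Ty) (x : Tm (.arr ρ (.arr σ τ))) (y : Tm (.arr ρ σ)) (z : Tm ρ) :
      RCA0ω (eqAt τ (.S ρ σ τ ⬝ x ⬝ y ⬝ z) (x ⬝ z ⬝ (y ⬝ z)))
  | R_zero (m : Tm .nat) (f : Tm (.arr .nat (.arr .nat .nat))) :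
      RCA0ω (.eq (.R ⬝ m ⬝ f ⬝ .zero) m)
  | R_succ (m : Tm .nat) (f : Tm (.arr .nat (.arr .nat .nat))) (n : Tm .nat) :
      RCA0ω (.eq (.R ⬝ m ⬝ f ⬝ (.succ ⬝ n)) (f ⬝ n ⬝ (.R ⬝ m ⬝ f ⬝ n)))
  | ext (σ τ : Ty) (x y : Tm σ) (z : Tm (.arr σ τ)) :
      RCA0ω (.imp (eqAt σ x y) (eqAt τ (z ⬝ x) (z ⬝ y)))
  /-- `A(0) → (∀ n, A(n) → A(n + 1)) → ∀ n, A(n)`, where `n` is `var nat 0`. -/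
  | qf_ind (A : Fm) : A.QF →
      RCA0ω (.imp (A.inst Tm.zero) (.imp (.all .nat (.imp A (A.subst Sub.next))) (.all .nat A)))
  /-- `(∀ f, ∃ n, A(f, n)) → ∃ Y, ∀ f, A(f, Y(f))`, where `f` is `var one 0` and `n` is
  `var nat 0`; the weakening makes room for the new variable `Y` of type `2`. -/
  | qf_ac (A : Fm) : A.QF →
      RCA0ω (.imp (.all .one (.ex .nat A))
        (.ex .two (.all .one ((A.up .two).inst (Tm.var .two 0 ⬝ Tm.var .one 0)))))

/-! ### Arithmetic -/

/-- The variable number `n` of type `0`. -/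
abbrev num (n : ℕ) : Tm .nat := .var .nat n

/-- The successor of a number. -/
def suc (s : Tm .nat) : Tm .nat := .succ ⬝ s

/-- `s + t`, by recursion on `t`. -/
def add (s t : Tm .nat) : Tm .nat := .R ⬝ s ⬝ (.K .one .nat ⬝ .succ) ⬝ t

/-- `s * t`, by recursion on `t`: each step is `x ↦ s + x`. -/
def mul (s t : Tm .nat) : Tm .nat :=
  .R ⬝ .zero ⬝ (.K .one .nat ⬝ (.R ⬝ s ⬝ (.K .one .nat ⬝ .succ))) ⬝ t

/-- `2 ^ t`, by recursion on `t`: each step is `x ↦ 2 * x`. -/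
def pow2 (t : Tm .nat) : Tm .nat :=
  .R ⬝ suc .zero ⬝
    (.K .one .nat ⬝
      (.R ⬝ .zero ⬝ (.K .one .nat ⬝ (.R ⬝ suc (suc .zero) ⬝ (.K .one .nat ⬝ .succ))))) ⬝ t

/-- Truncated subtraction `s ∸ t`, by recursion on `t`: each step is the predecessor function
`R₀(0, Π)`. -/
def monus (s t : Tm .nat) : Tm .nat :=
  .R ⬝ s ⬝ (.K .one .nat ⬝ (.R ⬝ .zero ⬝ .K .nat .nat)) ⬝ t

/-- `s ≤ t`. -/
def le (s t : Tm .nat) : Fm := .eq (monus s t) .zero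

/-- `s < t`. -/
def lt (s t : Tm .nat) : Fm := le (suc s) t

/-- The injective pairing `(s + t) ^ 2 + s`. -/
def pair (s t : Tm .nat) : Tm .nat := add (mul (add s t) (add s t)) s

/-! ### Real numbers -/

/-- The code of the rational number `(a - b) / (c + 1)`. -/
def rat (a b c : Tm .nat) : Tm .nat := pair a (pair b c)

/-- `(a - b) / (c + 1) ≤ (a' - b') / (c' + 1) + u / d` for `d > 0`, with cleared denominators. -/
def ratLe (a b c a' b' c' u d : Tm .nat) : Fm :=
  le (mul d (add (mul a (suc c')) (mul b' (suc c))))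
    (add (mul d (add (mul a' (suc c)) (mul b (suc c')))) (mul u (mul (suc c) (suc c'))))

/-- `(a - b) / (c + 1) < (a' - b') / (c' + 1) + u / d` for `d > 0`, with cleared denominators. -/
def ratLt (a b c a' b' c' u d : Tm .nat) : Fm :=
  lt (mul d (add (mul a (suc c')) (mul b' (suc c))))
    (add (mul d (add (mul a' (suc c)) (mul b (suc c')))) (mul u (mul (suc c) (suc c'))))

/-- `x` is a real number: a sequence `(q_n)` of (codes of) rational numbers such that
`|q_n - q_(n+i)| < 1 / 2 ^ n` for all `n` and `i`. In the second part the numbers are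
`n = num 7`, `i = num 6`, `q_n = (num 5 - num 4) / (num 3 + 1)` and
`q_(n+i) = (num 2 - num 1) / (num 0 + 1)`. -/
def isReal (x : Tm .one) : Fm :=
  .conj
    (.all .nat (.ex .nat (.ex .nat (.ex .nat
      (.eq (x.up .nat 4 ⬝ num 3) (rat (num 2) (num 1) (num 0)))))))
    (.allNat 8
      (.imp (.eq (x.up .nat 8 ⬝ num 7) (rat (num 5) (num 4) (num 3)))
        (.imp (.eq (x.up .nat 8 ⬝ add (num 7) (num 6)) (rat (num 2) (num 1) (num 0)))
          (.conj
            (ratLt (num 5) (num 4) (num 3) (num 2) (num 1) (num 0) (suc .zero) (pow2 (num 7)))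
            (ratLt (num 2) (num 1) (num 0) (num 5) (num 4) (num 3) (suc .zero)
              (pow2 (num 7)))))))

/-- `x ≤ y` for real numbers `x = (q_n)` and `y = (r_n)`: `q_n ≤ r_n + 2 / 2 ^ n` for all `n`. The
numbers are `n = num 6`, `q_n = (num 5 - num 4) / (num 3 + 1)` and
`r_n = (num 2 - num 1) / (num 0 + 1)`. -/
def leR (x y : Tm .one) : Fm :=
  .allNat 7
    (.imp (.eq (x.up .nat 7 ⬝ num 6) (rat (num 5) (num 4) (num 3)))
      (.imp (.eq (y.up .nat 7 ⬝ num 6) (rat (num 2) (num 1) (num 0)))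
        (ratLe (num 5) (num 4) (num 3) (num 2) (num 1) (num 0) (suc (suc .zero)) (pow2 (num 6)))))

/-- `x = y` for real numbers, that is `|q_n - r_n| ≤ 2 / 2 ^ n` for all `n`. -/
def eqR (x y : Tm .one) : Fm := .conj (leR x y) (leR y x)

/-- `x < y` for real numbers. -/
def ltR (x y : Tm .one) : Fm := .neg (leR y x)

/-- The real number zero. -/
def zeroR : Tm .one := .K .nat .nat ⬝ rat .zero .zero .zero

/-- The real number one. -/
def oneR : Tm .one := .K .nat .nat ⬝ rat (suc .zero) .zero .zero

/-- Quantification over all reals `x = var one 0`. -/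
def allReal (φ : Fm) : Fm := .all .one (.imp (isReal (.var .one 0)) φ)

/-- Existence of a real `x = var one 0`. -/
def exReal (φ : Fm) : Fm := .ex .one (.conj (isReal (.var .one 0)) φ)

/-- `F : ℝ → ℝ`, that is, `F` maps reals to reals, and equal reals to equal reals. -/
def isRealToReal (F : Tm (.arr .one .one)) : Fm :=
  .conj
    (allReal (isReal (F.up .one 1 ⬝ .var .one 0)))
    (allReal (allReal (.imp (eqR (.var .one 1) (.var .one 0))
      (eqR (F.up .one 2 ⬝ .var .one 1) (F.up .one 2 ⬝ .var .one 0)))))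

/-- `Y : ℝ → ℕ`, that is, `Y` maps equal reals to the same number. -/
def isRealToNat (Y : Tm .two) : Fm :=
  allReal (allReal (.imp (eqR (.var .one 1) (.var .one 0))
    (.eq (Y.up .one 2 ⬝ .var .one 1) (Y.up .one 2 ⬝ .var .one 0))))

/-- `x ∈ A`, where the set `A` is given by a real-valued function: `A(x) > 0`. -/
def mem (x : Tm .one) (A : Tm (.arr .one .one)) : Fm := ltR zeroR (A ⬝ x)

/-- `Y` is injective on the set `A` of reals. -/
def injOnReal (Y : Tm .two) (A : Tm (.arr .one .one)) : Fm :=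
  allReal (allReal (.imp (mem (.var .one 1) (A.up .one 2)) (.imp (mem (.var .one 0) (A.up .one 2))
    (.imp (.eq (Y.up .one 2 ⬝ .var .one 1) (Y.up .one 2 ⬝ .var .one 0))
      (eqR (.var .one 1) (.var .one 0))))))

/-! ### Cantor space -/

/-- `f ∈ 2^ℕ`. -/
def isBin (f : Tm .one) : Fm := .all .nat (le (f.up .nat 1 ⬝ num 0) (suc .zero))

/-- Quantification over all `f = var one 0` in Cantor space. -/
def allBin (φ : Fm) : Fm := .all .one (.imp (isBin (.var .one 0)) φ)

/-- Existence of some `f = var one 0` in Cantor space. -/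
def exBin (φ : Fm) : Fm := .ex .one (.conj (isBin (.var .one 0)) φ)

/-- `A : 2^ℕ → ℝ`, so that `A` represents the subset `{f ∈ 2^ℕ | A(f) > 0}` of Cantor space. -/
def isCantorSet (A : Tm (.arr .one .one)) : Fm := allBin (isReal (A.up .one 1 ⬝ .var .one 0))

/-- `Y` is injective on the subset `A` of Cantor space. -/
def injOnBin (Y : Tm .two) (A : Tm (.arr .one .one)) : Fm :=
  allBin (allBin (.imp (mem (.var .one 1) (A.up .one 2)) (.imp (mem (.var .one 0) (A.up .one 2))
    (.imp (.eq (Y.up .one 2 ⬝ .var .one 1) (Y.up .one 2 ⬝ .var .one 0))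
      (eqAt .one (.var .one 1) (.var .one 0))))))

/-- `f ≤ g` pointwise. -/
def lePw (f g : Tm .one) : Fm := .all .nat (le (f.up .nat 1 ⬝ num 0) (g.up .nat 1 ⬝ num 0))

/-- `f ≤ g` lexicographically: `f = g`, or there is `n` with `f(m) = g(m)` for all `m < n` and
`f(n) < g(n)`. -/
def leLex (f g : Tm .one) : Fm :=
  .disj (eqAt .one f g)
    (.ex .nat (.conj
      (.all .nat (.imp (lt (num 0) (num 1)) (.eq (f.up .nat 2 ⬝ num 0) (g.up .nat 2 ⬝ num 0))))
      (lt (f.up .nat 1 ⬝ num 0) (g.up .nat 1 ⬝ num 0))))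

/-- `s` is an upper bound of `A ⊆ 2^ℕ` in the lexicographic ordering. -/
def isUbLex (A : Tm (.arr .one .one)) (s : Tm .one) : Fm :=
  allBin (.imp (mem (.var .one 0) (A.up .one 1)) (leLex (.var .one 0) (s.up .one 1)))

/-- `s ∈ 2^ℕ` is the supremum of `A ⊆ 2^ℕ` in the lexicographic ordering. -/
def isSupLex (A : Tm (.arr .one .one)) (s : Tm .one) : Fm :=
  .conj (isBin s) (.conj (isUbLex A s)
    (allBin (.imp (isUbLex (A.up .one 1) (.var .one 0)) (leLex (s.up .one 1) (.var .one 0)))))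

/-- `s ∈ 2^ℕ` is the supremum of `A ⊆ 2^ℕ` in the pointwise ordering: every `f ∈ A` is pointwise
below `s`, and whenever `s(k) = 1` there is `f ∈ A` with `f(k) = 1`. -/
def isSupPw (A : Tm (.arr .one .one)) (s : Tm .one) : Fm :=
  .conj (isBin s) (.conj
    (allBin (.imp (mem (.var .one 0) (A.up .one 1)) (lePw (.var .one 0) (s.up .one 1))))
    (.all .nat (.imp (.eq (s.up .nat 1 ⬝ num 0) (suc .zero))
      (exBin (.conj (mem (.var .one 0) ((A.up .nat 1).up .one 1))
        (.eq (.var .one 0 ⬝ num 0) (suc .zero)))))))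

/-! ### The principles -/

/-- For all sets `A ⊆ 2^ℕ` and all `Y : 2^ℕ → ℕ` that are injective on `A`; in `φ`, the set is
`A = var (arr one one) 0` and the injection is `Y = var two 0`. -/
def allCountableBin (φ : Fm) : Fm :=
  .all (.arr .one .one) (.all .two
    (.imp (isCantorSet (.var (.arr .one .one) 0))
      (.imp (injOnBin (.var .two 0) (.var (.arr .one .one) 0)) φ)))

/-- `cocode₀`: for any non-empty countable set `A ⊆ [0,1]` there is a sequence `(x_n)` in `A` such
that each real `x` is in `A` if and only if `x = x_n` for some `n`. -/
def cocode0 : Fm :=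
  .all (.arr .one .one) (.all .two
    (.imp (isRealToReal (.var (.arr .one .one) 0))
    (.imp (isRealToNat (.var .two 0))
    (.imp (injOnReal (.var .two 0) (.var (.arr .one .one) 0))
    (.imp (allReal (.imp (mem (.var .one 0) (.var (.arr .one .one) 0))
      (.conj (leR zeroR (.var .one 0)) (leR (.var .one 0) oneR))))
    (.imp (exReal (mem (.var .one 0) (.var (.arr .one .one) 0)))
    (.ex (.arr .nat .one) (.conj
      (.all .nat (.conj
        (isReal (.var (.arr .nat .one) 0 ⬝ num 0))
        (mem (.var (.arr .nat .one) 0 ⬝ num 0) (.var (.arr .one .one) 0))))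
      (allReal (.iff
        (mem (.var .one 0) (.var (.arr .one .one) 0))
        (.ex .nat (eqR (.var (.arr .nat .one) 0 ⬝ num 0) (.var .one 0)))))))))))))

/-- `BWC₀`: every countable set `A ⊆ 2^ℕ` has a supremum in the lexicographic ordering. -/
def BWC0 : Fm :=
  allCountableBin (.ex .one (isSupLex (.var (.arr .one .one) 0) (.var .one 0)))

/-- `BWC₀^pwo`: every countable set `A ⊆ 2^ℕ` has a supremum in the pointwise ordering. -/
def BWC0pwo : Fm :=
  allCountableBin (.ex .one (isSupPw (.var (.arr .one .one) 0) (.var .one 0)))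

/-- `range₀`: if `Y : 2^ℕ → ℕ` is injective on `A ⊆ 2^ℕ`, there is a set `X ⊆ ℕ`, given by its
characteristic function, such that `n ∈ X` if and only if `Y(f) = n` for some `f ∈ A`. -/
def range0 : Fm :=
  allCountableBin (exBin (.all .nat (.iff
    (exBin (.conj (mem (.var .one 0) (.var (.arr .one .one) 0))
      (.eq (.var .two 0 ⬝ .var .one 0) (num 0))))
    (.eq (.var .one 0 ⬝ num 0) (suc .zero)))))

/-- `IND₀`: if for every `n` there is at most one `f ∈ 2^ℕ` with `Y(f, n) = 0`, then for every `k`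
there is a finite sequence `w` of objects of type `1` (given by a sequence `w(0), w(1), …` and a
length `|w|`) such that for all `m ≤ k`, some `i < |w|` has `w(i) ∈ 2^ℕ` and `Y(w(i), m) = 0` if and
only if some `f ∈ 2^ℕ` has `Y(f, m) = 0`. Under the quantifiers over `k`, `|w|`, `m` and `i`, these
are `num 3`, `num 2`, `num 1` and `num 0`. -/
def IND0 : Fm :=
  .all (.arr .one .one)
    (.imp
      (.all .nat (allBin (allBin
        (.imp (.eq (.var (.arr .one .one) 0 ⬝ .var .one 1 ⬝ num 0) .zero)
          (.imp (.eq (.var (.arr .one .one) 0 ⬝ .var .one 0 ⬝ num 0) .zero)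
            (eqAt .one (.var .one 1) (.var .one 0)))))))
      (.all .nat (.ex (.arr .nat .one) (.ex .nat (.all .nat
        (.imp (le (num 0) (num 2))
          (.iff
            (.ex .nat (.conj (lt (num 0) (num 2))
              (.conj (isBin (.var (.arr .nat .one) 0 ⬝ num 0))
                (.eq (.var (.arr .one .one) 0 ⬝ (.var (.arr .nat .one) 0 ⬝ num 0) ⬝ num 1)
                  .zero))))
            (exBin (.eq (.var (.arr .one .one) 0 ⬝ .var .one 0 ⬝ num 0) .zero)))))))))

end HigherOrderRM

/-! ### Syntax: substitution calculus, derivations, maximal consistent Henkin sets. -/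

namespace HigherOrderRM

/-! ### Substitution -/

/-! A sentence true in every extensional model of `RCA0ω` is derivable (`proves_of_forall_model`, a
Henkin completeness theorem), so the equivalences are proved inside an arbitrary model. The numbers
of the model may be nonstandard and its function domains need not be full. Induction, recursion,
minimisation and choice are therefore available only for functions and predicates represented by
elements of the model; the classes `Internal` and `Dec` carry this bookkeeping.

The principles about `2^ℕ` are easy when no instance is present (an empty set, or a predicate
without solutions). Otherwise let `Y` be injective on `A` and let `f ∈ A`. Fix a `k` such that the
`k`-th approximation of `A(f)` shows `A(f) > 0`. The condition "the `k`-th approximation shows `A(g)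
> 0`, and `Y(g) = Y(f)`" is quantifier-free, and in Cantor space it holds at `f` only. It is thus
discontinuous at `f`, and Grilliot's trick turns this into the functional `∃²`
(`hasE2_of_discontinuous`, `InjOnBin.hasE2`; for reals `InjOnReal.hasE2`). From then on arithmetical
comprehension is available, and membership in `A` is decidable.

The hub is `range₀`. It yields choice for uniquely determined functions (`Range.uniqueChoice`): if
`z` is determined by `n`, the range of `(n, i, z) ↦ (n, i, z(i))` is the graph of the choice
sequence. Hence a set on which `Y` is injective can be listed along the values of `Y`, and `IND₀`,
both suprema and the sequence of `cocode₀` become arithmetically definable from the list. In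
particular `range₀` alone implies `IND₀`.

Conversely, `BWC₀^pwo` gives `range₀` by attaching to each `f ∈ A` the characteristic function of
`{Y(f)}` (`BWCPw.range`). `cocode₀` gives it by embedding Cantor space in `[0,1]` through the digits
0 and 1 in base four, where expansions are unambiguous (`Cocode.range`). For `BWC₀` with `IND₀`
(`BWC.range`), consider the sequences that start with a finite, possibly incomplete part of the
range, followed by the unique witnesses for the numbers it claims. They form a countable set, and
their lexicographic supremum is the characteristic function of the full range, interleaved with
ones; `IND₀` supplies all the witnesses below a given bound at once. -/

theorem Sub.lift_same_zero (σ : Ty) (s : Sub) : s.lift σ σ 0 = .var σ 0 := by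
  simp [Sub.lift]

theorem Sub.lift_same_succ (σ : Ty) (s : Sub) (n : ℕ) :
    s.lift σ σ (n + 1) = (s σ n).up σ 1 := by
  simp [Sub.lift]

theorem Sub.lift_same_one (σ : Ty) (s : Sub) : s.lift σ σ 1 = (s σ 0).up σ 1 :=
  s.lift_same_succ σ 0

theorem Sub.lift_of_ne {σ τ : Ty} (h : τ ≠ σ) (s : Sub) (n : ℕ) :
    s.lift σ τ n = (s τ n).up σ 1 := by
  simp [Sub.lift, h]

theorem Sub.inst_same_zero {σ : Ty} (t : Tm σ) : Sub.inst t σ 0 = t := by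
  simp [Sub.inst]

theorem Sub.inst_same_succ {σ : Ty} (t : Tm σ) (n : ℕ) : Sub.inst t σ (n + 1) = .var σ n := by
  simp [Sub.inst]

theorem Sub.inst_of_ne {σ τ : Ty} (h : τ ≠ σ) (t : Tm σ) (n : ℕ) :
    Sub.inst t τ n = .var τ n := by
  simp [Sub.inst, h]

theorem Sub.next_nat_zero : Sub.next .nat 0 = Tm.succ ⬝ .var .nat 0 := by
  simp [Sub.next]

theorem Sub.next_nat_succ (n : ℕ) : Sub.next .nat (n + 1) = .var .nat (n + 1) := by
  simp [Sub.next]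

theorem Sub.next_of_ne {τ : Ty} (h : τ ≠ .nat) (n : ℕ) : Sub.next τ n = .var τ n := by
  simp [Sub.next, h]

theorem Sub.up_same (σ : Ty) (k n : ℕ) : Sub.up σ k σ n = .var σ (n + k) := by
  simp [Sub.up]

theorem Sub.up_of_ne {σ τ : Ty} (h : τ ≠ σ) (k n : ℕ) : Sub.up σ k τ n = .var τ n := by
  simp [Sub.up, h]

/-- Composition of substitutions: first `s`, then `s'`. -/
def Sub.comp (s s' : Sub) : Sub := fun σ n => (s σ n).subst s'

theorem Tm.subst_subst (s s' : Sub) {σ : Ty} (t : Tm σ) :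
    (t.subst s).subst s' = t.subst (s.comp s') := by
  induction t <;> simp_all [Tm.subst, Sub.comp]

theorem Tm.subst_var {σ : Ty} (t : Tm σ) : t.subst Tm.var = t := by
  induction t <;> simp_all [Tm.subst]

theorem Sub.lift_comp (σ : Ty) (s s' : Sub) :
    (s.lift σ).comp (s'.lift σ) = (s.comp s').lift σ := by
  have key : ∀ {τ : Ty} (t : Tm τ), (t.up σ 1).subst (s'.lift σ) = (t.subst s').up σ 1 := by
    intro τ t
    rw [Tm.up, Tm.up, Tm.subst_subst, Tm.subst_subst]
    congr 1
    funext ρ n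
    by_cases h : ρ = σ
    · subst h
      simp [Sub.comp, Sub.up_same, Tm.subst, Sub.lift_same_succ, Tm.up]
    · simp [Sub.comp, Sub.up_of_ne h, Tm.subst, Sub.lift_of_ne h, Tm.up]
  funext τ n
  by_cases h : τ = σ
  · subst h
    cases n with
    | zero => simp [Sub.comp, Sub.lift_same_zero, Tm.subst]
    | succ n => simp [Sub.comp, Sub.lift_same_succ, key]
  · simp [Sub.comp, Sub.lift_of_ne h, key]

theorem Sub.lift_var (σ : Ty) : Sub.lift σ Tm.var = Tm.var := by
  funext τ n
  by_cases h : τ = σ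
  · subst h
    cases n with
    | zero => simp [Sub.lift_same_zero]
    | succ n => simp [Sub.lift_same_succ, Tm.up, Tm.subst, Sub.up_same]
  · simp [Sub.lift_of_ne h, Tm.up, Tm.subst, Sub.up_of_ne h]

theorem Fm.subst_subst (φ : Fm) (s s' : Sub) :
    (φ.subst s).subst s' = φ.subst (s.comp s') := by
  induction φ generalizing s s' with
  | eq t u => simp [Fm.subst, Tm.subst_subst]
  | bot => rfl
  | imp φ ψ ih₁ ih₂ => simp [Fm.subst, ih₁, ih₂]
  | all σ φ ih => simp [Fm.subst, ih, Sub.lift_comp]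

theorem Fm.subst_var (φ : Fm) : φ.subst Tm.var = φ := by
  induction φ with
  | eq t u => simp [Fm.subst, Tm.subst_var]
  | bot => rfl
  | imp φ ψ ih₁ ih₂ => simp [Fm.subst, ih₁, ih₂]
  | all σ φ ih => simp [Fm.subst, Sub.lift_var, ih]

/-- The substitution of `t` for `var σ 0` and of `s` for the other variables. -/
def Sub.cons {σ : Ty} (t : Tm σ) (s : Sub) : Sub := (s.lift σ).comp (Sub.inst t)

theorem Tm.up_subst_inst {σ τ : Ty} (t : Tm σ) (u : Tm τ) :
    (u.up σ 1).subst (Sub.inst t) = u := by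
  rw [Tm.up, Tm.subst_subst]
  conv_rhs => rw [← u.subst_var]
  congr 1
  funext ρ n
  by_cases h : ρ = σ
  · subst h
    simp [Sub.comp, Sub.up_same, Tm.subst, Sub.inst_same_succ]
  · simp [Sub.comp, Sub.up_of_ne h, Tm.subst, Sub.inst_of_ne h]

theorem Sub.cons_same_zero {σ : Ty} (t : Tm σ) (s : Sub) : s.cons t σ 0 = t := by
  simp [Sub.cons, Sub.comp, Sub.lift_same_zero, Tm.subst, Sub.inst_same_zero]

theorem Sub.cons_same_succ {σ : Ty} (t : Tm σ) (s : Sub) (n : ℕ) :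
    s.cons t σ (n + 1) = s σ n := by
  simp [Sub.cons, Sub.comp, Sub.lift_same_succ, Tm.up_subst_inst]

theorem Sub.cons_same_one {σ : Ty} (t : Tm σ) (s : Sub) : s.cons t σ 1 = s σ 0 :=
  s.cons_same_succ t 0

theorem Sub.cons_of_ne {σ τ : Ty} (h : τ ≠ σ) (t : Tm σ) (s : Sub) (n : ℕ) :
    s.cons t τ n = s τ n := by
  simp [Sub.cons, Sub.comp, Sub.lift_of_ne h, Tm.up_subst_inst]

theorem Fm.lift_inst (φ : Fm) (s : Sub) {σ : Ty} (t : Tm σ) :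
    (φ.subst (s.lift σ)).inst t = φ.subst (s.cons t) := by
  rw [Fm.inst, Fm.subst_subst, Sub.cons]

theorem Sub.inst_comp {σ : Ty} (t : Tm σ) (s : Sub) :
    (Sub.inst t).comp s = s.cons (t.subst s) := by
  funext τ n
  by_cases h : τ = σ
  · subst h
    cases n with
    | zero => simp [Sub.comp, Sub.inst_same_zero, Sub.cons_same_zero]
    | succ n => simp [Sub.comp, Sub.inst_same_succ, Sub.cons_same_succ, Tm.subst]
  · simp [Sub.comp, Sub.inst_of_ne h, Sub.cons_of_ne h, Tm.subst]

theorem Fm.inst_subst (φ : Fm) {σ : Ty} (t : Tm σ) (s : Sub) :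
    (φ.inst t).subst s = (φ.subst (s.lift σ)).inst (t.subst s) := by
  rw [Fm.lift_inst, Fm.inst, Fm.subst_subst, Sub.inst_comp]

theorem Tm.up_subst_lift {σ τ : Ty} (t : Tm τ) (s : Sub) :
    (t.up σ 1).subst (s.lift σ) = (t.subst s).up σ 1 := by
  rw [Tm.up, Tm.up, Tm.subst_subst, Tm.subst_subst]
  congr 1
  funext ρ n
  by_cases h : ρ = σ
  · subst h
    simp [Sub.comp, Sub.up_same, Tm.subst, Sub.lift_same_succ, Tm.up]
  · simp [Sub.comp, Sub.up_of_ne h, Tm.subst, Sub.lift_of_ne h, Tm.up]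

theorem Sub.up_comp_lift (σ : Ty) (s : Sub) :
    (Sub.up σ 1).comp (s.lift σ) = s.comp (Sub.up σ 1) := by
  funext τ n
  exact Tm.up_subst_lift (.var τ n) s

theorem Fm.up_subst_lift {σ : Ty} (φ : Fm) (s : Sub) :
    (φ.up σ).subst (s.lift σ) = (φ.subst s).up σ := by
  rw [Fm.up, Fm.up, Fm.subst_subst, Fm.subst_subst, Sub.up_comp_lift]

theorem eqAt_subst (σ : Ty) (t u : Tm σ) (s : Sub) :
    (eqAt σ t u).subst s = eqAt σ (t.subst s) (u.subst s) := by
  induction σ generalizing s with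
  | nat => rfl
  | arr σ τ _ ih =>
    simp [eqAt, Fm.subst, ih, Tm.subst, Tm.up_subst_lift, Sub.lift_same_zero]

theorem Fm.QF.subst {φ : Fm} (h : φ.QF) (s : Sub) : (φ.subst s).QF := by
  induction φ with
  | eq t u => trivial
  | bot => trivial
  | imp φ ψ ih₁ ih₂ => exact ⟨ih₁ h.1, ih₂ h.2⟩
  | all σ φ ih => exact h.elim

/-! ### Free variables -/

/-- A bound for the indices of the variables of a term. -/
def Tm.bd : {σ : Ty} → Tm σ → ℕ
  | _, .var _ n => n + 1
  | _, .app t u => max t.bd u.bd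
  | _, _ => 0

/-- A bound for the indices of the free variables of a formula. -/
def Fm.bd : Fm → ℕ
  | .eq t u => max t.bd u.bd
  | .bot => 0
  | .imp φ ψ => max φ.bd ψ.bd
  | .all _ φ => φ.bd

theorem Tm.subst_congr {σ : Ty} (t : Tm σ) {s s' : Sub}
    (h : ∀ τ n, n < t.bd → s τ n = s' τ n) : t.subst s = t.subst s' := by
  induction t with
  | var σ n => exact h _ _ (by simp [Tm.bd])
  | app t u ih₁ ih₂ =>
    simp only [Tm.subst]
    rw [ih₁ fun τ n hn => h τ n (by simp [Tm.bd, hn]),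
      ih₂ fun τ n hn => h τ n (by simp [Tm.bd, hn])]
  | _ => rfl

theorem Fm.subst_congr (φ : Fm) {s s' : Sub}
    (h : ∀ τ n, n < φ.bd → s τ n = s' τ n) : φ.subst s = φ.subst s' := by
  induction φ generalizing s s' with
  | eq t u =>
    simp only [Fm.subst]
    rw [t.subst_congr fun τ n hn => h τ n (by simp [Fm.bd, hn]),
      u.subst_congr fun τ n hn => h τ n (by simp [Fm.bd, hn])]
  | bot => rfl
  | imp φ ψ ih₁ ih₂ =>
    simp only [Fm.subst]
    rw [ih₁ fun τ n hn => h τ n (by simp [Fm.bd, hn]),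
      ih₂ fun τ n hn => h τ n (by simp [Fm.bd, hn])]
  | all σ φ ih =>
    simp only [Fm.subst]
    rw [ih]
    intro τ n hn
    by_cases hτ : τ = σ
    · subst hτ
      cases n with
      | zero => simp [Sub.lift_same_zero]
      | succ n => rw [Sub.lift_same_succ, Sub.lift_same_succ, h _ _ (by simp [Fm.bd]; omega)]
    · rw [Sub.lift_of_ne hτ, Sub.lift_of_ne hτ, h _ _ (by simpa [Fm.bd] using hn)]

/-! ### Derivations -/

theorem Derives.weaken {T : Set Fm} {Γ : List Fm} {φ : Fm} (h : Derives T Γ φ) :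
    ∀ {Δ : List Fm}, Γ ⊆ Δ → Derives T Δ φ := by
  induction h with
  | ax h => exact fun _ => .ax h
  | hyp h => exact fun hs => .hyp (hs h)
  | impI _ ih => exact fun hs => .impI (ih (List.cons_subset_cons _ hs))
  | impE _ _ ih₁ ih₂ => exact fun hs => .impE (ih₁ hs) (ih₂ hs)
  | raa _ ih => exact fun hs => .raa (ih (List.cons_subset_cons _ hs))
  | allI _ ih => exact fun hs => .allI (ih (List.map_subset _ hs))
  | allE t _ ih => exact fun hs => .allE t (ih hs)
  | eqRefl t => exact fun _ => .eqRefl t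
  | eqSubst φ _ _ ih₁ ih₂ => exact fun hs => .eqSubst φ (ih₁ hs) (ih₂ hs)

/-- Axioms are open formulas read universally, so their instances need only be derivable, not be
axioms themselves. The quantifier rules survive because lifting a substitution commutes with
weakening and instantiation. -/
theorem Derives.subst {T : Set Fm} (hT : ∀ φ ∈ T, ∀ s, Derives T [] (φ.subst s))
    {Γ : List Fm} {φ : Fm} (h : Derives T Γ φ) :
    ∀ s : Sub, Derives T (Γ.map (Fm.subst s)) (φ.subst s) := by
  induction h with
  | ax h => exact fun s => (hT _ h s).weaken (List.nil_subset _)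
  | hyp h => exact fun s => .hyp (List.mem_map_of_mem h)
  | impI _ ih => exact fun s => .impI (ih s)
  | impE _ _ ih₁ ih₂ => exact fun s => .impE (ih₁ s) (ih₂ s)
  | raa _ ih => exact fun s => .raa (ih s)
  | @allI Γ σ φ _ ih =>
    intro s
    refine .allI ?_
    have := ih (s.lift σ)
    rw [List.map_map] at this ⊢
    convert this using 2
    funext ψ
    exact (Fm.up_subst_lift ψ s).symm
  | @allE Γ σ φ t _ ih =>
    intro s
    rw [Fm.inst_subst]
    exact .allE _ (ih s)
  | eqRefl t => exact fun s => .eqRefl _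
  | @eqSubst Γ t u φ _ _ ih₁ ih₂ =>
    intro s
    rw [Fm.inst_subst]
    refine .eqSubst _ (ih₁ s) ?_
    rw [← Fm.inst_subst]
    exact ih₂ s

/-- Generalisation over a named variable that is fresh. The rule `allI` only generalises over index
0, so the derivation is first renamed. -/
theorem Derives.forall_of_fresh {T : Set Fm} (hT : ∀ φ ∈ T, ∀ s, Derives T [] (φ.subst s))
    {Γ : List Fm} {σ : Ty} {φ : Fm} {m : ℕ} (hΓ : ∀ ψ ∈ Γ, ψ.bd ≤ m) (hφ : φ.bd ≤ m)
    (h : Derives T Γ (φ.inst (.var σ m))) : Derives T Γ (.all σ φ) := by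
  -- The fresh variable goes to index 0 and the other variables of type `σ` move up, which is
  -- weakening on `Γ` and undoes the instantiation in `φ`.
  let s : Sub := fun τ n =>
    if τ = σ then if n = m then .var τ 0 else .var τ (n + 1) else .var τ n
  refine .allI ?_
  have h' := h.subst hT s
  have e₁ : Γ.map (Fm.subst s) = Γ.map (Fm.up σ) := by
    refine List.map_congr_left fun ψ hψ => ψ.subst_congr fun τ n hn => ?_
    have : n ≠ m := (hn.trans_le (hΓ ψ hψ)).ne
    by_cases hτ : τ = σ <;> simp [s, hτ, this, Sub.up]
  have e₂ : (φ.inst (.var σ m)).subst s = φ := by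
    conv_rhs => rw [← φ.subst_var]
    rw [Fm.inst, Fm.subst_subst]
    refine φ.subst_congr fun τ n hn => ?_
    by_cases hτ : τ = σ
    · subst hτ
      cases n with
      | zero => simp [Sub.comp, Sub.inst_same_zero, Tm.subst, s]
      | succ n =>
        have : n ≠ m := by omega
        simp [Sub.comp, Sub.inst_same_succ, Tm.subst, s, this]
    · simp [Sub.comp, Sub.inst_of_ne hτ, Tm.subst, s, hτ]
  rwa [e₁, e₂] at h'

/-! ### Countability of the language -/

/-- A numerical code of a type. -/
def Ty.code : Ty → ℕ
  | .nat => 0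
  | .arr σ τ => Nat.pair σ.code τ.code + 1

theorem Ty.code_injective : Function.Injective Ty.code := by
  intro σ
  induction σ with
  | nat => intro τ h; cases τ <;> simp_all [Ty.code]
  | arr σ τ ih₁ ih₂ =>
    intro ρ h
    cases ρ with
    | nat => simp [Ty.code] at h
    | arr σ' τ' =>
      simp only [Ty.code, Nat.add_right_cancel_iff, Nat.pair_eq_pair] at h
      rw [ih₁ h.1, ih₂ h.2]

/-- A numerical code of a term. -/
def Tm.code : {σ : Ty} → Tm σ → ℕ
  | _, .var σ n => Nat.pair 0 (Nat.pair σ.code n)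
  | _, .zero => Nat.pair 1 0
  | _, .succ => Nat.pair 2 0
  | _, .K σ τ => Nat.pair 3 (Nat.pair σ.code τ.code)
  | _, .S ρ σ τ => Nat.pair 4 (Nat.pair ρ.code (Nat.pair σ.code τ.code))
  | _, .R => Nat.pair 5 0
  | _, .app t u => Nat.pair 6 (Nat.pair t.code u.code)

/-- Terms of different types must be compared, since an application hides the type of its argument;
hence the equality in the sigma type. -/
theorem Tm.eq_of_code_eq {σ : Ty} (t : Tm σ) : ∀ {σ' : Ty} (t' : Tm σ'), t.code = t'.code →
    (⟨σ, t⟩ : Σ σ, Tm σ) = ⟨σ', t'⟩ := by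
  induction t with
  | @app σ τ t u ih₁ ih₂ =>
    intro σ' t' h
    cases t' with
    | @app σ' τ' t' u' =>
      simp only [Tm.code, Nat.pair_eq_pair, true_and] at h
      have h₁ := ih₁ t' h.1
      have h₂ := ih₂ u' h.2
      simp only [Sigma.mk.injEq, Ty.arr.injEq] at h₁ h₂
      obtain ⟨⟨rfl, rfl⟩, h₁⟩ := h₁
      obtain ⟨-, h₂⟩ := h₂
      rw [eq_of_heq h₁, eq_of_heq h₂]
    | _ => simp [Tm.code] at h
  | var σ n =>
    intro σ' t' h
    cases t' <;> simp [Tm.code] at h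
    obtain ⟨h, rfl⟩ := h
    obtain rfl := Ty.code_injective h
    rfl
  | zero => intro σ' t' h; cases t' <;> simp [Tm.code] at h; rfl
  | succ => intro σ' t' h; cases t' <;> simp [Tm.code] at h; rfl
  | R => intro σ' t' h; cases t' <;> simp [Tm.code] at h; rfl
  | K σ τ =>
    intro σ' t' h
    cases t' <;> simp [Tm.code] at h
    obtain rfl := Ty.code_injective h.1
    obtain rfl := Ty.code_injective h.2
    rfl
  | S ρ σ τ =>
    intro σ' t' h
    cases t' <;> simp [Tm.code] at h
    obtain rfl := Ty.code_injective h.1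
    obtain rfl := Ty.code_injective h.2.1
    obtain rfl := Ty.code_injective h.2.2
    rfl

theorem Tm.code_injective (σ : Ty) : Function.Injective (Tm.code (σ := σ)) := fun t t' h =>
  eq_of_heq (Sigma.mk.inj (t.eq_of_code_eq t' h)).2

/-- A numerical code of a formula. -/
def Fm.code : Fm → ℕ
  | .eq t u => Nat.pair 0 (Nat.pair t.code u.code)
  | .bot => Nat.pair 1 0
  | .imp φ ψ => Nat.pair 2 (Nat.pair φ.code ψ.code)
  | .all σ φ => Nat.pair 3 (Nat.pair σ.code φ.code)

theorem Fm.code_injective : Function.Injective Fm.code := by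
  intro φ
  induction φ with
  | eq t u =>
    intro ψ h
    cases ψ <;> simp [Fm.code] at h
    rw [Tm.code_injective _ h.1, Tm.code_injective _ h.2]
  | bot => intro ψ h; cases ψ <;> simp [Fm.code] at h; rfl
  | imp φ ψ ih₁ ih₂ =>
    intro ψ h
    cases ψ <;> simp [Fm.code] at h
    rw [ih₁ h.1, ih₂ h.2]
  | all σ φ ih =>
    intro ψ h
    cases ψ <;> simp [Fm.code] at h
    rw [Ty.code_injective h.1, ih h.2]

instance : Countable Fm := Fm.code_injective.countable

instance : Nonempty Fm := ⟨.bot⟩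

/-! ### Maximal consistent Henkin sets -/

/-- A maximal consistent set of formulas, closed under derivations from `T`, in which every false
universal statement has a counterexample. -/
structure Henkin (T : Set Fm) where
  carrier : Set Fm
  closed : ∀ {Γ : List Fm} {φ : Fm}, (∀ ψ ∈ Γ, ψ ∈ carrier) → Derives T Γ φ → φ ∈ carrier
  bot_notMem : Fm.bot ∉ carrier
  complete : ∀ φ, φ ∈ carrier ∨ φ.neg ∈ carrier
  witness : ∀ {σ : Ty} {φ : Fm}, (Fm.all σ φ).neg ∈ carrier →
    ∃ t : Tm σ, (φ.inst t).neg ∈ carrier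

section Construction

variable (T : Set Fm)

open Classical in
/-- One step of the construction of a Henkin set. -/
noncomputable def henkinStep (Γ : List Fm) (φ : Fm) : List Fm :=
  if Derives T (φ :: Γ) .bot then Γ
  else match φ with
    | .imp (.all σ χ) .bot =>
      (χ.inst (.var σ ((Γ.map Fm.bd).sum + χ.bd))).neg :: φ :: Γ
    | _ => φ :: Γ

/-- The stages of the construction of a Henkin set. -/
noncomputable def henkinStage (e : ℕ → Fm) (φ : Fm) : ℕ → List Fm
  | 0 => [φ]
  | n + 1 => henkinStep T (henkinStage e φ n) (e n)

variable {T}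

theorem subset_henkinStep (Γ : List Fm) (φ : Fm) : Γ ⊆ henkinStep T Γ φ := by
  unfold henkinStep
  split
  · exact List.Subset.refl _
  · split
    · exact List.Subset.trans (List.subset_cons_self _ _) (List.subset_cons_self _ _)
    · exact List.subset_cons_self _ _

theorem mem_henkinStep {Γ : List Fm} {φ : Fm} (h : ¬ Derives T (φ :: Γ) .bot) :
    φ ∈ henkinStep T Γ φ := by
  unfold henkinStep
  rw [if_neg h]
  split <;> simp

theorem henkinStep_consistent (hT : ∀ φ ∈ T, ∀ s, Derives T [] (φ.subst s)) {Γ : List Fm}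
    (hΓ : ¬ Derives T Γ .bot) (φ : Fm) : ¬ Derives T (henkinStep T Γ φ) .bot := by
  unfold henkinStep
  split
  · exact hΓ
  next h =>
    split
    next σ χ =>
      intro hd
      apply h
      -- If the new counterexample led to a contradiction, `χ` would be derivable at a fresh
      -- variable, hence universally, against its negated generalisation.
      refine .impE (.hyp List.mem_cons_self) (Derives.forall_of_fresh hT ?_ ?_ (.raa hd))
      · intro ψ hψ
        rcases List.mem_cons.1 hψ with rfl | hψ
        · simp [Fm.bd]
        · have := List.le_sum_of_mem (List.mem_map_of_mem (f := Fm.bd) hψ)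
          omega
      · omega
    · exact h

/-- Lindenbaum's construction along an enumeration of all formulas, starting from the negation of
`φ`. Each accepted negated universal formula receives a counterexample at a fresh variable, so no
new constants are needed. -/
theorem exists_henkin (hT : ∀ φ ∈ T, ∀ s, Derives T [] (φ.subst s)) {φ : Fm}
    (hφ : ¬ Derives T [] φ) : ∃ H : Henkin T, φ ∉ H.carrier := by
  obtain ⟨e, he⟩ := exists_surjective_nat Fm
  set G := henkinStage T e φ.neg with hG
  have hmono : Monotone fun n => {ψ | ψ ∈ G n} :=
    monotone_nat_of_le_succ fun n => subset_henkinStep (G n) (e n)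
  have hsub : ∀ {m n}, m ≤ n → G m ⊆ G n := fun h => hmono h
  have hcon : ∀ n, ¬ Derives T (G n) .bot := by
    intro n
    induction n with
    | zero => exact fun h => hφ (.raa h)
    | succ n ih => exact henkinStep_consistent hT ih _
  have hfin : ∀ Γ : List Fm, (∀ ψ ∈ Γ, ∃ n, ψ ∈ G n) → ∃ n, Γ ⊆ G n := by
    intro Γ
    induction Γ with
    | nil => exact fun _ => ⟨0, List.nil_subset _⟩
    | cons χ Γ ih =>
      intro h
      obtain ⟨n, hn⟩ := ih fun ψ hψ => h ψ (List.mem_cons_of_mem _ hψ)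
      obtain ⟨m, hm⟩ := h χ List.mem_cons_self
      exact ⟨max m n, List.cons_subset.2
        ⟨hsub (le_max_left _ _) hm, List.Subset.trans hn (hsub (le_max_right _ _))⟩⟩
  have hnot : ∀ k, e k ∉ G (k + 1) → Derives T (G k) (e k).neg := fun k hk =>
    .impI (by_contra fun h => hk (mem_henkinStep h))
  have hclosed : ∀ {Γ : List Fm} {ψ : Fm}, (∀ χ ∈ Γ, ∃ n, χ ∈ G n) → Derives T Γ ψ →
      ∃ n, ψ ∈ G n := by
    intro Γ ψ hΓ h
    obtain ⟨n, hn⟩ := hfin Γ hΓ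
    obtain ⟨k, rfl⟩ := he ψ
    by_contra! hk
    -- A formula never accepted was refuted at its own stage; being derivable as well, it would make
    -- a later stage inconsistent.
    refine hcon (max k n) (.impE ((hnot k (hk _)).weaken (hsub (le_max_left _ _)))
      ((h.weaken hn).weaken (hsub (le_max_right _ _))))
  refine ⟨⟨{ψ | ∃ n, ψ ∈ G n}, hclosed, ?_, ?_, ?_⟩, ?_⟩
  · rintro ⟨n, hn⟩
    exact hcon n (.hyp hn)
  · intro ψ
    by_contra! h
    obtain ⟨k, rfl⟩ := he ψ
    exact h.2 (hclosed (fun χ hχ => ⟨k, hχ⟩) (hnot k fun h' => h.1 ⟨_, h'⟩))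
  · rintro σ ψ ⟨n, hn⟩
    obtain ⟨k, hk⟩ := he (Fm.all σ ψ).neg
    have hc : ¬ Derives T (e k :: G k) .bot := fun h =>
      hcon (max k n) (.impE (Derives.weaken (.impI h) (hsub (le_max_left _ _)))
        (.hyp (hk ▸ hsub (le_max_right _ _) hn)))
    refine ⟨.var σ (((G k).map Fm.bd).sum + ψ.bd), k + 1, ?_⟩
    change _ ∈ henkinStep T (G k) (e k)
    rw [hk] at hc ⊢
    unfold henkinStep
    rw [if_neg hc]
    exact List.mem_cons_self
  · rintro ⟨n, hn⟩
    exact hcon n (.impE (.hyp (hsub (Nat.zero_le n) (List.mem_singleton.2 rfl))) (.hyp hn))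

end Construction

namespace Henkin

variable {T : Set Fm} (H : Henkin T)

theorem mem_imp {φ ψ : Fm} : φ.imp ψ ∈ H.carrier ↔ (φ ∈ H.carrier → ψ ∈ H.carrier) := by
  constructor
  · intro h h'
    exact H.closed (Γ := [φ.imp ψ, φ]) (by simp [h, h'])
      (.impE (φ := φ) (.hyp (by simp)) (.hyp (by simp)))
  · intro h
    rcases H.complete φ with hφ | hφ
    · exact H.closed (Γ := [ψ]) (by simp [h hφ]) (.impI (.hyp (by simp)))
    · exact H.closed (Γ := [φ.neg]) (by simp [hφ])
        (.impI (.raa (.impE (φ := φ) (.hyp (by simp [Fm.neg])) (.hyp (by simp)))))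

theorem mem_neg {φ : Fm} : φ.neg ∈ H.carrier ↔ φ ∉ H.carrier := by
  rw [Fm.neg, mem_imp]
  simp only [H.bot_notMem, imp_false]

theorem mem_all {σ : Ty} {φ : Fm} :
    Fm.all σ φ ∈ H.carrier ↔ ∀ t : Tm σ, φ.inst t ∈ H.carrier := by
  constructor
  · intro h t
    exact H.closed (Γ := [.all σ φ]) (by simp [h]) (.allE t (.hyp (by simp)))
  · intro h
    by_contra h'
    obtain ⟨t, ht⟩ := H.witness (H.mem_neg.2 h')
    exact H.mem_neg.1 ht (h t)

theorem mem_ex {σ : Ty} {φ : Fm} :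
    Fm.ex σ φ ∈ H.carrier ↔ ∃ t : Tm σ, φ.inst t ∈ H.carrier := by
  rw [Fm.ex, mem_neg, mem_all, not_forall]
  refine exists_congr fun t => ?_
  rw [show (φ.neg.inst t) = (φ.inst t).neg from rfl, mem_neg, not_not]

theorem mem_ax {φ : Fm} (h : φ ∈ T) : φ ∈ H.carrier :=
  H.closed (Γ := []) (by simp) (.ax h)

theorem mem_eqAt_arr {σ τ : Ty} {f g : Tm (.arr σ τ)} :
    eqAt _ f g ∈ H.carrier ↔ ∀ t : Tm σ, eqAt τ (f ⬝ t) (g ⬝ t) ∈ H.carrier := by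
  rw [eqAt, mem_all]
  refine forall_congr' fun t => ?_
  rw [Fm.inst, eqAt_subst]
  simp [Tm.subst, Tm.up_subst_inst, Sub.inst_same_zero]

theorem eqAt_refl {σ : Ty} (t : Tm σ) : eqAt σ t t ∈ H.carrier := by
  induction σ with
  | nat => exact H.closed (Γ := []) (by simp) (.eqRefl t)
  | arr σ τ _ ih => exact H.mem_eqAt_arr.2 fun u => ih _

theorem eqAt_symm {σ : Ty} {t u : Tm σ} (h : eqAt σ t u ∈ H.carrier) :
    eqAt σ u t ∈ H.carrier := by
  induction σ with
  | nat =>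
    refine H.closed (Γ := [.eq t u]) (by simpa [eqAt] using h) ?_
    have := Derives.eqSubst (T := T) (Γ := [.eq t u]) (s := t) (t := u)
      (.eq (.var .nat 0) (t.up .nat 1))
      (.hyp (by simp)) (by
        simpa [Fm.inst, Fm.subst, Tm.subst, Tm.up_subst_inst, Sub.inst_same_zero]
          using Derives.eqRefl t)
    simpa [Fm.inst, Fm.subst, Tm.subst, Tm.up_subst_inst, Sub.inst_same_zero, eqAt] using this
  | arr σ τ _ ih =>
    exact H.mem_eqAt_arr.2 fun v => ih (H.mem_eqAt_arr.1 h v)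

theorem eqAt_trans {σ : Ty} {t u v : Tm σ} (h : eqAt σ t u ∈ H.carrier)
    (h' : eqAt σ u v ∈ H.carrier) : eqAt σ t v ∈ H.carrier := by
  induction σ with
  | nat =>
    refine H.closed (Γ := [.eq t u, .eq u v]) (by simpa [eqAt] using ⟨h, h'⟩) ?_
    have := Derives.eqSubst (T := T) (Γ := [.eq t u, .eq u v]) (s := u) (t := v)
      (.eq (t.up .nat 1) (.var .nat 0)) (.hyp (by simp)) (by
        simpa [Fm.inst, Fm.subst, Tm.subst, Tm.up_subst_inst, Sub.inst_same_zero]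
          using Derives.hyp (by simp))
    simpa [Fm.inst, Fm.subst, Tm.subst, Tm.up_subst_inst, Sub.inst_same_zero, eqAt] using this
  | arr σ τ _ ih =>
    exact H.mem_eqAt_arr.2 fun w => ih (H.mem_eqAt_arr.1 h w) (H.mem_eqAt_arr.1 h' w)

end Henkin

end HigherOrderRM

/-! ### Extensional models and completeness by the term model. -/

namespace HigherOrderRM

/-! ### The axioms are closed under substitution -/

theorem Tm.up_subst_next {τ : Ty} (t : Tm τ) :
    (t.up .nat 1).subst Sub.next = t.up .nat 1 := by
  rw [Tm.up, Tm.subst_subst]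
  congr 1
  funext ρ n
  by_cases h : ρ = .nat
  · subst h
    simp [Sub.comp, Sub.up_same, Tm.subst, Sub.next_nat_succ]
  · simp [Sub.comp, Sub.up_of_ne h, Tm.subst, Sub.next_of_ne h]

theorem Sub.next_comp_lift (s : Sub) :
    Sub.next.comp (s.lift .nat) = (s.lift .nat).comp Sub.next := by
  funext τ n
  by_cases h : τ = .nat
  · subst h
    cases n with
    | zero => simp [Sub.comp, Sub.next_nat_zero, Tm.subst, Sub.lift_same_zero]
    | succ n =>
      simp [Sub.comp, Sub.next_nat_succ, Tm.subst, Sub.lift_same_succ, Tm.up_subst_next]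
  · simp [Sub.comp, Sub.next_of_ne h, Tm.subst, Sub.lift_of_ne h, Tm.up_subst_next]

theorem Tm.up_up_comm {σ τ ρ : Ty} (h : σ ≠ τ) (t : Tm ρ) :
    (t.up σ 1).up τ 1 = (t.up τ 1).up σ 1 := by
  simp only [Tm.up, Tm.subst_subst]
  congr 1
  funext υ n
  by_cases h₁ : υ = σ
  · subst h₁
    simp [Sub.comp, Sub.up_same, Sub.up_of_ne h, Tm.subst]
  · by_cases h₂ : υ = τ
    · subst h₂
      simp [Sub.comp, Sub.up_same, Sub.up_of_ne h₁, Tm.subst]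
    · simp [Sub.comp, Sub.up_of_ne h₁, Sub.up_of_ne h₂, Tm.subst]

theorem Sub.lift_lift_comm {σ τ : Ty} (h : σ ≠ τ) (s : Sub) :
    (s.lift σ).lift τ = (s.lift τ).lift σ := by
  have key : ∀ {σ τ : Ty}, σ ≠ τ → ∀ n, (s.lift σ).lift τ σ n = (s.lift τ).lift σ σ n := by
    intro σ τ h n
    rw [Sub.lift_of_ne h]
    cases n with
    | zero => simp [Sub.lift_same_zero, Tm.up, Tm.subst, Sub.up_of_ne h]
    | succ n => rw [Sub.lift_same_succ, Sub.lift_same_succ, Sub.lift_of_ne h, Tm.up_up_comm h]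
  funext υ n
  by_cases h₁ : υ = σ
  · subst h₁
    exact key h n
  · by_cases h₂ : υ = τ
    · subst h₂
      exact (key (Ne.symm h) n).symm
    · simp [Sub.lift_of_ne h₁, Sub.lift_of_ne h₂, Tm.up_up_comm h]

/-- All axioms are schemes closed under substitution, except the two successor axioms, whose
instances come from generalising and then instantiating. -/
theorem RCA0ω.derives_subst : ∀ φ ∈ RCA0ω, ∀ s, Derives RCA0ω [] (φ.subst s) := by
  intro φ hφ s
  cases hφ with
  | succ_ne_zero =>
    have h : Derives RCA0ω [] _ := .allE (s .nat 0) (.allI (Γ := []) (.ax .succ_ne_zero))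
    simpa [Fm.inst, Fm.neg, Fm.subst, Tm.subst, Sub.inst_same_zero] using h
  | succ_inj =>
    have h : Derives RCA0ω [] _ := .allE (s .nat 0) (.allE (s .nat 1)
      (.allI (Γ := []) (.allI (Γ := []) (.ax .succ_inj))))
    simpa [Fm.inst, Fm.subst, Tm.subst, Sub.inst_same_zero,
      Sub.lift_same_zero, Sub.lift_same_one, Tm.up_subst_inst] using h
  | K_ax σ τ x y =>
    rw [eqAt_subst]
    exact .ax (.K_ax σ τ _ _)
  | S_ax ρ σ τ x y z =>
    rw [eqAt_subst]
    exact .ax (.S_ax ρ σ τ _ _ _)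
  | R_zero m f => exact .ax (.R_zero _ _)
  | R_succ m f n => exact .ax (.R_succ _ _ _)
  | ext σ τ x y z =>
    rw [Fm.subst, eqAt_subst, eqAt_subst]
    exact .ax (.ext σ τ _ _ _)
  | qf_ind A hA =>
    have h := Derives.ax (Γ := []) (RCA0ω.qf_ind (A.subst (s.lift .nat)) (hA.subst _))
    rwa [Fm.subst_subst, ← Sub.next_comp_lift, ← Fm.subst_subst,
      show Tm.zero = Tm.zero.subst s from rfl, ← Fm.inst_subst] at h
  | qf_ac A hA =>
    have h := Derives.ax (Γ := [])
      (RCA0ω.qf_ac (A.subst ((s.lift .one).lift .nat)) (hA.subst _))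
    convert h using 1
    simp only [Fm.subst, Fm.ex, Fm.neg]
    rw [Fm.inst_subst, Sub.lift_lift_comm (s := s) (show Ty.two ≠ Ty.one by decide),
      Sub.lift_lift_comm (show Ty.two ≠ Ty.nat by decide), Fm.up_subst_lift]
    simp [Tm.subst, Sub.lift_same_zero, Sub.lift_of_ne (show Ty.one ≠ Ty.two by decide),
      Tm.up, Sub.up_of_ne (show Ty.one ≠ Ty.two by decide)]

/-! ### Models -/

/-- An extensional model of `RCA₀^ω`. -/
structure Model where
  D : Ty → Type
  app {σ τ : Ty} : D (.arr σ τ) → D σ → D τ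
  zero : D .nat
  succ : D .one
  K (σ τ : Ty) : D (.arr σ (.arr τ σ))
  S (ρ σ τ : Ty) : D (.arr (.arr ρ (.arr σ τ)) (.arr (.arr ρ σ) (.arr ρ τ)))
  R : D (.arr .nat (.arr (.arr .nat (.arr .nat .nat)) (.arr .nat .nat)))
  ext {σ τ : Ty} {f g : D (.arr σ τ)} : (∀ x, app f x = app g x) → f = g
  succ_ne_zero (n : D .nat) : app succ n ≠ zero
  succ_inj {m n : D .nat} : app succ m = app succ n → m = n
  K_app {σ τ : Ty} (x : D σ) (y : D τ) : app (app (K σ τ) x) y = x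
  S_app {ρ σ τ : Ty} (x : D (.arr ρ (.arr σ τ))) (y : D (.arr ρ σ)) (z : D ρ) :
    app (app (app (S ρ σ τ) x) y) z = app (app x z) (app y z)
  R_zero (m : D .nat) (f : D (.arr .nat (.arr .nat .nat))) : app (app (app R m) f) zero = m
  R_succ (m : D .nat) (f : D (.arr .nat (.arr .nat .nat))) (n : D .nat) :
    app (app (app R m) f) (app succ n) = app (app f n) (app (app (app R m) f) n)
  induction (f g h k : D .one) : app f zero = app g zero ∨ app h zero = app k zero →
    (∀ n, app f n = app g n ∨ app h n = app k n →
      app f (app succ n) = app g (app succ n) ∨ app h (app succ n) = app k (app succ n)) →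
    ∀ n, app f n = app g n ∨ app h n = app k n
  choice (e : D (.arr .one .one)) : (∀ f, ∃ n, app (app e f) n = zero) →
    ∃ Y : D .two, ∀ f, app (app e f) (app Y f) = zero

namespace Model

/-- Valuations of the variables in a model. -/
abbrev Val (M : Model) : Type := (σ : Ty) → ℕ → M.D σ

variable {M : Model}

/-- Assign `a` to `var σ 0` and shift the other variables of type `σ`. -/
def Val.push (v : M.Val) {σ : Ty} (a : M.D σ) : M.Val := fun τ n =>
  if h : τ = σ then
    match n with
    | 0 => h ▸ a
    | m + 1 => v τ m
  else v τ n

theorem Val.push_same_zero (v : M.Val) {σ : Ty} (a : M.D σ) : v.push a σ 0 = a := by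
  simp [Val.push]

theorem Val.push_same_succ (v : M.Val) {σ : Ty} (a : M.D σ) (n : ℕ) :
    v.push a σ (n + 1) = v σ n := by
  simp [Val.push]

theorem Val.push_of_ne (v : M.Val) {σ τ : Ty} (h : τ ≠ σ) (a : M.D σ) (n : ℕ) :
    v.push a τ n = v τ n := by
  simp [Val.push, h]

/-- The value of a term. -/
def eval (v : M.Val) : {σ : Ty} → Tm σ → M.D σ
  | _, .var σ n => v σ n
  | _, .zero => M.zero
  | _, .succ => M.succ
  | _, .K σ τ => M.K σ τ
  | _, .S ρ σ τ => M.S ρ σ τ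
  | _, .R => M.R
  | _, .app t u => M.app (eval v t) (eval v u)

/-- Truth of a formula in a model. -/
def Sat : M.Val → Fm → Prop
  | v, .eq t u => eval v t = eval v u
  | _, .bot => False
  | v, .imp φ ψ => Sat v φ → Sat v ψ
  | v, .all σ φ => ∀ a : M.D σ, Sat (v.push a) φ

end Model

/-! ### The term model of a Henkin set -/

namespace Henkin

variable (H : Henkin RCA0ω)

/-- Terms of type `σ` up to provable extensional equality. -/
def setoid (σ : Ty) : Setoid (Tm σ) where
  r t u := eqAt σ t u ∈ H.carrier
  iseqv := ⟨H.eqAt_refl, H.eqAt_symm, H.eqAt_trans⟩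

/-- The domains of the term model. -/
def Dom (σ : Ty) : Type := Quotient (H.setoid σ)

/-- The element of the term model denoted by a term. -/
def cls {σ : Ty} (t : Tm σ) : H.Dom σ := Quotient.mk (H.setoid σ) t

variable {H}

theorem cls_eq {σ : Ty} {t u : Tm σ} : H.cls t = H.cls u ↔ eqAt σ t u ∈ H.carrier :=
  ⟨fun h => Quotient.exact (s := H.setoid σ) h, fun h => Quotient.sound (s := H.setoid σ) h⟩

theorem cls_eq_nat {t u : Tm .nat} : H.cls t = H.cls u ↔ Fm.eq t u ∈ H.carrier := cls_eq

theorem exists_cls {σ : Ty} (a : H.Dom σ) : ∃ t, H.cls t = a := Quotient.exists_rep a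

theorem forall_cls {σ : Ty} {p : H.Dom σ → Prop} : (∀ a, p a) ↔ ∀ t, p (H.cls t) :=
  ⟨fun h t => h _, fun h a => by obtain ⟨t, rfl⟩ := exists_cls a; exact h t⟩

/-- Application in the term model. -/
def app {σ τ : Ty} : H.Dom (.arr σ τ) → H.Dom σ → H.Dom τ :=
  Quotient.lift₂ (s₁ := H.setoid _) (s₂ := H.setoid _) (fun f t => H.cls (f ⬝ t))
    fun _ _ f' _ hf ht => cls_eq.2 <| H.eqAt_trans (H.mem_eqAt_arr.1 hf _) <|
      H.mem_imp.1 (H.mem_ax (.ext _ _ _ _ f')) ht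

theorem app_cls {σ τ : Ty} (f : Tm (.arr σ τ)) (t : Tm σ) :
    app (H.cls f) (H.cls t) = H.cls (f ⬝ t) := rfl

theorem Fm.inst_imp {σ : Ty} (φ ψ : Fm) (t : Tm σ) :
    (φ.imp ψ).inst t = (φ.inst t).imp (ψ.inst t) := rfl

variable (H)

/-- The term model. -/
abbrev model : Model where
  D := H.Dom
  app := app
  zero := H.cls .zero
  succ := H.cls .succ
  K σ τ := H.cls (.K σ τ)
  S ρ σ τ := H.cls (.S ρ σ τ)
  R := H.cls .R
  ext {σ τ f g} h := by
    obtain ⟨f, rfl⟩ := exists_cls f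
    obtain ⟨g, rfl⟩ := exists_cls g
    exact cls_eq.2 (H.mem_eqAt_arr.2 fun t => cls_eq.1 (h (H.cls t)))
  succ_ne_zero := by
    rw [forall_cls]
    intro t
    have h := H.closed (Γ := []) (by simp)
      (RCA0ω.derives_subst _ .succ_ne_zero (Sub.cons t Tm.var))
    simp only [Fm.neg, Fm.subst, Tm.subst, Sub.cons_same_zero] at h
    rw [app_cls, Ne, cls_eq_nat]
    exact H.mem_neg.1 h
  succ_inj := by
    intro m n
    obtain ⟨t, rfl⟩ := exists_cls m
    obtain ⟨u, rfl⟩ := exists_cls n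
    have h := H.closed (Γ := []) (by simp)
      (RCA0ω.derives_subst _ .succ_inj (Sub.cons t (Sub.cons u Tm.var)))
    simp only [Fm.subst, Tm.subst, Sub.cons_same_zero, Sub.cons_same_one] at h
    rw [app_cls, app_cls, cls_eq_nat, cls_eq_nat]
    exact H.mem_imp.1 h
  K_app x y := by
    obtain ⟨x, rfl⟩ := exists_cls x
    obtain ⟨y, rfl⟩ := exists_cls y
    exact cls_eq.2 (H.mem_ax (.K_ax _ _ x y))
  S_app x y z := by
    obtain ⟨x, rfl⟩ := exists_cls x
    obtain ⟨y, rfl⟩ := exists_cls y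
    obtain ⟨z, rfl⟩ := exists_cls z
    exact cls_eq.2 (H.mem_ax (.S_ax _ _ _ x y z))
  R_zero m f := by
    obtain ⟨m, rfl⟩ := exists_cls m
    obtain ⟨f, rfl⟩ := exists_cls f
    exact cls_eq.2 (H.mem_ax (.R_zero m f))
  R_succ m f n := by
    obtain ⟨m, rfl⟩ := exists_cls m
    obtain ⟨f, rfl⟩ := exists_cls f
    obtain ⟨n, rfl⟩ := exists_cls n
    exact cls_eq.2 (H.mem_ax (.R_succ m f n))
  induction f g h k := by
    obtain ⟨f, rfl⟩ := exists_cls f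
    obtain ⟨g, rfl⟩ := exists_cls g
    obtain ⟨h, rfl⟩ := exists_cls h
    obtain ⟨k, rfl⟩ := exists_cls k
    have ax := H.mem_ax (.qf_ind (.disj
      (.eq (f.up .nat 1 ⬝ .var .nat 0) (g.up .nat 1 ⬝ .var .nat 0))
      (.eq (h.up .nat 1 ⬝ .var .nat 0) (k.up .nat 1 ⬝ .var .nat 0)))
      ⟨⟨trivial, trivial⟩, trivial⟩)
    rw [H.mem_imp, H.mem_imp, H.mem_all, H.mem_all] at ax
    simp only [Fm.inst_imp, H.mem_imp] at ax
    simp only [Fm.disj, Fm.neg, Fm.inst, Fm.subst, Tm.subst, Tm.up_subst_next,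
      Tm.up_subst_inst, Sub.inst_same_zero, Sub.next_nat_zero, H.mem_imp, H.bot_notMem] at ax
    simp only [forall_cls, app_cls, cls_eq_nat, or_iff_not_imp_left]
    exact ax
  choice e := by
    obtain ⟨t, rfl⟩ := exists_cls e
    have h := H.mem_ax
      (.qf_ac (.eq ((t.up .one 1).up .nat 1 ⬝ .var .one 0 ⬝ .var .nat 0) .zero) trivial)
    rw [H.mem_imp, H.mem_all, H.mem_ex] at h
    have e₁ : ∀ u : Tm .one, ((t.up .one 1).up .nat 1).subst ((Sub.inst u).lift .nat) =
        t.up .nat 1 := fun u => by rw [Tm.up_subst_lift, Tm.up_subst_inst]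
    have e₂ : ∀ y : Tm .two, ((((t.up .one 1).up .nat 1).subst (Sub.up .two 1)).subst
        (Sub.inst (Tm.var .two 0 ⬝ Tm.var .one 0))).subst ((Sub.inst y).lift .one) =
        t.up .one 1 := fun y => by
      change ((((t.up .one 1).up .nat 1).up .two 1).subst _).subst _ = _
      rw [Tm.up_up_comm (show Ty.nat ≠ Ty.two by decide), Tm.up_subst_inst,
        Tm.up_up_comm (show Ty.one ≠ Ty.two by decide), Tm.up_subst_lift, Tm.up_subst_inst]
    simp only [forall_cls, app_cls]
    intro h'
    obtain ⟨y, hy⟩ := h fun u => by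
      obtain ⟨n, hn⟩ := h' u
      obtain ⟨n, rfl⟩ := exists_cls n
      change Fm.ex .nat (Fm.subst ((Sub.inst u).lift .nat) _) ∈ _
      refine H.mem_ex.2 ⟨n, ?_⟩
      simpa [Fm.inst, Fm.subst, Tm.subst, e₁, Sub.inst_same_zero, Tm.up_subst_inst,
        Sub.lift_of_ne (show Ty.one ≠ Ty.nat by decide), Sub.lift_same_zero, Fm.neg,
        app_cls, cls_eq_nat] using hn
    refine ⟨H.cls y, fun f => ?_⟩
    rw [Fm.inst, Fm.subst, H.mem_all] at hy
    simpa [Fm.inst, Fm.up, Fm.subst, Tm.subst, e₂, Sub.inst_same_zero, Tm.up_subst_inst,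
        Sub.lift_of_ne (show Ty.one ≠ Ty.nat by decide), Sub.lift_same_zero,
        Sub.up_of_ne (show Ty.one ≠ Ty.two by decide), Sub.inst_of_ne (show Ty.one ≠ Ty.nat by decide),
        Sub.up_of_ne (show Ty.nat ≠ Ty.two by decide), Sub.lift_of_ne (show Ty.two ≠ Ty.one by decide),
        app_cls, cls_eq_nat] using hy f

/-- The valuation of the term model given by a substitution. -/
def val (s : Sub) : H.model.Val := fun σ n => H.cls (s σ n)

theorem eval_val (s : Sub) {σ : Ty} (t : Tm σ) :
    Model.eval (H.val s) t = H.cls (t.subst s) := by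
  induction t with
  | app t u ih₁ ih₂ => rw [Model.eval, ih₁, ih₂]; rfl
  | _ => rfl

theorem push_val (s : Sub) {σ : Ty} (t : Tm σ) :
    (H.val s).push (M := H.model) (H.cls t) = H.val (s.cons t) := by
  funext τ n
  by_cases h : τ = σ
  · subst h
    cases n with
    | zero => rw [Model.Val.push_same_zero, val, Sub.cons_same_zero]
    | succ n => rw [Model.Val.push_same_succ, val, val, Sub.cons_same_succ]
  · rw [Model.Val.push_of_ne _ h, val, val, Sub.cons_of_ne h]

/-- The truth lemma. Every element of the model is the class of a term, so a quantifier ranges over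
terms, and the Henkin witnesses decide it by `mem_all`. -/
theorem sat_val (φ : Fm) (s : Sub) : Model.Sat (H.val s) φ ↔ φ.subst s ∈ H.carrier := by
  induction φ generalizing s with
  | eq t u => rw [Model.Sat, eval_val, eval_val, cls_eq_nat, Fm.subst]
  | bot => simp [Model.Sat, Fm.subst, H.bot_notMem]
  | imp φ ψ ih₁ ih₂ => rw [Model.Sat, ih₁, ih₂, Fm.subst, H.mem_imp]
  | all σ φ ih =>
    rw [Model.Sat, Fm.subst, H.mem_all]
    refine forall_cls.trans (forall_congr' fun t => ?_)
    rw [push_val, ih, Fm.lift_inst]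

end Henkin

/-- Completeness for the extensional models of `RCA₀^ω`. -/
theorem proves_of_forall_model {φ : Fm} (h : ∀ (M : Model) (v : M.Val), Model.Sat v φ) :
    Proves RCA0ω φ := by
  by_contra hφ
  obtain ⟨H, hH⟩ := exists_henkin RCA0ω.derives_subst hφ
  have := (H.sat_val φ Tm.var).1 (h _ _)
  rw [Fm.subst_var] at this
  exact hH this

end HigherOrderRM

/-! ### Combinatory completeness inside a model. -/

namespace HigherOrderRM

namespace Model

variable {M : Model}

instance {σ τ : Ty} : CoeFun (M.D (.arr σ τ)) fun _ => M.D σ → M.D τ := ⟨M.app⟩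

instance instNonemptyD : (σ : Ty) → Nonempty (M.D σ)
  | .nat => ⟨M.zero⟩
  | .arr σ τ => (instNonemptyD τ).map fun y => M.K τ σ y

/-! ### Internal functions -/

/-- A type of tuples of elements of a model, with its coordinate functions. -/
class Ctx (M : Model) (α : Type) where
  IsCoord {σ : Ty} : (α → M.D σ) → Prop

/-- The identity function is the only coordinate function of a domain. -/
inductive IsId {σ : Ty} : {τ : Ty} → (M.D σ → M.D τ) → Prop
  | mk : IsId (σ := σ) (τ := σ) fun x => x

instance (σ : Ty) : Ctx M (M.D σ) := ⟨IsId⟩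

instance {α β : Type} [Ctx M α] [Ctx M β] : Ctx M (α × β) :=
  ⟨fun f => (∃ g, Ctx.IsCoord g ∧ f = fun p => g p.1) ∨ ∃ g, Ctx.IsCoord g ∧ f = fun p => g p.2⟩

variable {α β : Type} [Ctx M α] [Ctx M β]

/-- The functions on tuples generated by coordinates, constants and application. -/
inductive Poly : {σ : Ty} → (α → M.D σ) → Prop
  | coord {σ : Ty} {f : α → M.D σ} : Ctx.IsCoord f → Poly f
  | const {σ : Ty} (a : M.D σ) : Poly fun _ => a
  | app {σ τ : Ty} {f : α → M.D (.arr σ τ)} {g : α → M.D σ} :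
      Poly f → Poly g → Poly fun x => f x (g x)

/-- Bracket abstraction of the last coordinate: that coordinate becomes `S K K`, whatever does not
depend on it is put under `K`, and application becomes `S`. -/
theorem Poly.exists_lam {σ τ : Ty} {F : α × M.D σ → M.D τ} (h : Poly F) :
    ∃ G : α → M.D (.arr σ τ), Poly G ∧ ∀ x y, G x y = F (x, y) := by
  induction h with
  | coord h =>
    obtain ⟨g, hg, rfl⟩ | ⟨g, hg, rfl⟩ := h
    · exact ⟨fun x => M.K _ _ (g x), .app (.const _) (.coord hg), fun x y => M.K_app _ _⟩
    · cases hg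
      exact ⟨fun _ => M.S σ (.arr σ σ) σ (M.K _ _) (M.K _ _), .const _, fun x y => by
        rw [M.S_app, M.K_app]⟩
  | const a => exact ⟨fun _ => M.K _ _ a, .const _, fun x y => M.K_app _ _⟩
  | app _ _ ih₁ ih₂ =>
    obtain ⟨G₁, h₁, e₁⟩ := ih₁
    obtain ⟨G₂, h₂, e₂⟩ := ih₂
    exact ⟨fun x => M.S _ _ _ (G₁ x) (G₂ x), .app (.app (.const _) h₁) h₂, fun x y => by
      rw [M.S_app, e₁, e₂]⟩

/-- The function is given by an element of the model. -/
class Internal {σ : Ty} (f : α → M.D σ) : Prop where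
  poly : Poly f

/-- The function is a projection onto some of the coordinates. -/
class Proj (f : α → β) : Prop where
  coord {σ : Ty} {g : β → M.D σ} : Ctx.IsCoord g → Ctx.IsCoord fun x => g (f x)

open Classical in
/-- Abstraction: the element of the model that represents the internal function `F`. -/
noncomputable def lam {σ τ : Ty} (F : M.D σ → M.D τ) : M.D (.arr σ τ) :=
  if h : ∃ e : M.D (.arr σ τ), ∀ x, e x = F x then h.choose else Classical.arbitrary _

instance Proj.id : Proj (M := M) fun x : α => x := ⟨fun h => h⟩

instance Proj.fst {γ : Type} [Ctx M γ] (f : γ → α × β) [Proj (M := M) f] :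
    Proj (M := M) fun x => (f x).1 :=
  ⟨fun {_ g} h => Proj.coord (f := f) (g := fun p => g p.1) (Or.inl ⟨_, h, rfl⟩)⟩

instance Proj.snd {γ : Type} [Ctx M γ] (f : γ → α × β) [Proj (M := M) f] :
    Proj (M := M) fun x => (f x).2 :=
  ⟨fun {_ g} h => Proj.coord (f := f) (g := fun p => g p.2) (Or.inr ⟨_, h, rfl⟩)⟩

instance (priority := 900) Internal.of_proj {σ : Ty} (f : α → M.D σ) [Proj (M := M) f] :
    Internal f :=
  ⟨.coord (Proj.coord (f := f) (g := fun x => x) IsId.mk)⟩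

instance (priority := 2000) Internal.const {σ : Ty} (a : M.D σ) :
    Internal fun _ : α => a := ⟨.const a⟩

instance Internal.app {σ τ : Ty} (f : α → M.D (.arr σ τ)) (g : α → M.D σ) [Internal f]
    [Internal g] : Internal fun x => f x (g x) :=
  ⟨.app Internal.poly Internal.poly⟩

instance Internal.app_left {σ τ : Ty} (e : M.D (.arr σ τ)) : Internal (M.app e) :=
  Internal.app (fun _ => e) fun x => x

/-- Partial application of an internal function. -/
theorem Internal.curry {σ : Ty} (F : α → M.D σ → M.D τ)
    [h : Internal fun p : α × M.D σ => F p.1 p.2] (x : α) :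
    ∃ e : M.D (.arr σ τ), ∀ y, e y = F x y := by
  obtain ⟨G, -, hG⟩ := h.poly.exists_lam
  exact ⟨G x, fun y => hG x y⟩

theorem lam_app' {σ τ : Ty} (F : α → M.D σ → M.D τ)
    [Internal fun p : α × M.D σ => F p.1 p.2] (x : α) (y : M.D σ) : lam (F x) y = F x y := by
  have h := Internal.curry F x
  rw [lam, dif_pos h]
  exact h.choose_spec y

theorem Internal.exists_rep {σ τ : Ty} (F : M.D σ → M.D τ) [h : Internal F] :
    ∃ e : M.D (.arr σ τ), ∀ y, e y = F y := by
  obtain ⟨hf⟩ := h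
  induction hf with
  | coord h =>
    cases h
    exact ⟨M.S σ (.arr σ σ) σ (M.K _ _) (M.K _ _), fun y => by rw [M.S_app, M.K_app]⟩
  | const a => exact ⟨M.K _ _ a, fun y => M.K_app _ _⟩
  | app _ _ ih₁ ih₂ =>
    obtain ⟨e₁, h₁⟩ := ih₁
    obtain ⟨e₂, h₂⟩ := ih₂
    exact ⟨M.S _ _ _ e₁ e₂, fun y => by rw [M.S_app, h₁, h₂]⟩

theorem lam_app {σ τ : Ty} (F : M.D σ → M.D τ) [Internal F] (y : M.D σ) : lam F y = F y := by
  have h := Internal.exists_rep F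
  rw [lam, dif_pos h]
  exact h.choose_spec y

instance Internal.lam {σ τ : Ty} (F : α → M.D σ → M.D τ)
    [h : Internal fun p : α × M.D σ => F p.1 p.2] : Internal fun x => lam (F x) := by
  obtain ⟨G, hG, e⟩ := h.poly.exists_lam
  convert Internal.mk hG using 2 with x
  -- By extensionality the code chosen by `lam` is the only one, so it agrees with the polynomial
  -- `G`.
  exact M.ext fun y => by rw [lam_app', e]

end Model
end HigherOrderRM

/-! ### Arithmetic, decidable predicates and recursion inside a model. -/

namespace HigherOrderRM

namespace Model

variable {M : Model} {α β : Type} [Ctx M α] [Ctx M β]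

/-! ### Arithmetic in a model -/

instance : Zero (M.D .nat) := ⟨M.zero⟩

instance : One (M.D .nat) := ⟨M.succ M.zero⟩

instance : Add (M.D .nat) := ⟨fun a b => M.R a (M.K .one .nat M.succ) b⟩

instance : Mul (M.D .nat) :=
  ⟨fun a b => M.R M.zero (M.K .one .nat (M.R a (M.K .one .nat M.succ))) b⟩

instance : _root_.Sub (M.D .nat) :=
  ⟨fun a b => M.R a (M.K .one .nat (M.R M.zero (M.K .nat .nat))) b⟩

theorem one_def : (1 : M.D .nat) = M.succ M.zero := rfl

theorem add_def (a b : M.D .nat) : a + b = M.R a (M.K .one .nat M.succ) b := rfl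

theorem mul_def (a b : M.D .nat) :
    a * b = M.R M.zero (M.K .one .nat (M.R a (M.K .one .nat M.succ))) b := rfl

theorem sub_def (a b : M.D .nat) :
    a - b = M.R a (M.K .one .nat (M.R M.zero (M.K .nat .nat))) b := rfl

instance Internal.add (f g : α → M.D .nat) [Internal f] [Internal g] :
    Internal fun x => f x + g x := by
  simp only [add_def]; infer_instance

instance Internal.mul (f g : α → M.D .nat) [Internal f] [Internal g] :
    Internal fun x => f x * g x := by
  simp only [mul_def]; infer_instance

instance Internal.sub (f g : α → M.D .nat) [Internal f] [Internal g] :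
    Internal fun x => f x - g x := by
  simp only [sub_def]; infer_instance

instance Internal.add_left (a : M.D .nat) : Internal (a + ·) :=
  Internal.add (fun _ => a) fun x => x

instance Internal.mul_left (a : M.D .nat) : Internal (a * ·) :=
  Internal.mul (fun _ => a) fun x => x

instance Internal.sub_left (a : M.D .nat) : Internal (a - ·) :=
  Internal.sub (fun _ => a) fun x => x

namespace Arith

/-- The disjunctive form is needed to establish the ordering: a disjunction of equations cannot be
contracted to one equation before the arithmetic behind `Dec.or` exists. -/
theorem induction_or (f g h k : M.D .nat → M.D .nat) [Internal f] [Internal g] [Internal h]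
    [Internal k] (h₀ : f 0 = g 0 ∨ h 0 = k 0)
    (h₁ : ∀ n, f n = g n ∨ h n = k n → f (n + 1) = g (n + 1) ∨ h (n + 1) = k (n + 1))
    (n : M.D .nat) : f n = g n ∨ h n = k n := by
  have hs : ∀ n : M.D .nat, M.succ n = n + 1 := fun n => by
    rw [add_def, one_def, M.R_succ, M.K_app, M.R_zero]
  have := M.induction (Model.lam f) (Model.lam g) (Model.lam h) (Model.lam k)
  simp only [lam_app, hs] at this
  exact this h₀ h₁ n

theorem induction_eq (f g : M.D .nat → M.D .nat) [Internal f] [Internal g]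
    (h₀ : f 0 = g 0) (h₁ : ∀ n, f n = g n → f (n + 1) = g (n + 1)) (n : M.D .nat) :
    f n = g n :=
  or_self_iff.1 (induction_or f g f g (.inl h₀) (fun n h => .inl (h₁ n (or_self_iff.1 h))) n)

theorem add_zero (a : M.D .nat) : a + 0 = a := M.R_zero _ _

theorem succ_eq (n : M.D .nat) : M.succ n = n + 1 := by
  rw [add_def, one_def, M.R_succ, M.K_app, M.R_zero]

theorem add_succ (a b : M.D .nat) : a + (b + 1) = a + b + 1 := by
  rw [← succ_eq, ← succ_eq, add_def, M.R_succ, M.K_app, ← add_def]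

theorem mul_zero (a : M.D .nat) : a * 0 = 0 := M.R_zero _ _

theorem mul_succ (a b : M.D .nat) : a * (b + 1) = a + a * b := by
  rw [← succ_eq, mul_def, M.R_succ, M.K_app, ← mul_def, ← add_def]

theorem succ_ne_zero (a : M.D .nat) : a + 1 ≠ 0 := by
  rw [← succ_eq]
  exact M.succ_ne_zero a

theorem zero_add (a : M.D .nat) : 0 + a = a :=
  induction_eq (fun a => 0 + a) (fun a => a) (add_zero 0)
    (fun n h => by rw [add_succ, h]) a

theorem add_assoc (a b c : M.D .nat) : a + b + c = a + (b + c) :=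
  induction_eq (fun c => a + b + c) (fun c => a + (b + c)) (by simp only [add_zero])
    (fun n h => by simp only [add_succ, h]) c

theorem succ_add (a b : M.D .nat) : a + 1 + b = a + b + 1 :=
  induction_eq (fun b => a + 1 + b) (fun b => a + b + 1) (by simp only [add_zero])
    (fun n h => by simp only [add_succ, h]) b

theorem add_comm (a b : M.D .nat) : a + b = b + a :=
  induction_eq (fun b => a + b) (fun b => b + a) (by simp only [add_zero, zero_add])
    (fun n h => by simp only [add_succ, succ_add, h]) b

instance : AddCommMonoid (M.D .nat) where
  add_assoc := add_assoc
  zero_add := zero_add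
  add_zero := add_zero
  add_comm := add_comm
  nsmul := nsmulRec

theorem zero_mul (a : M.D .nat) : 0 * a = 0 :=
  induction_eq (fun a => 0 * a) (fun _ => 0) (mul_zero 0)
    (fun n h => by simp only [mul_succ, h, zero_add]) a

theorem succ_mul (a b : M.D .nat) : (a + 1) * b = a * b + b :=
  induction_eq (fun b => (a + 1) * b) (fun b => a * b + b) (by simp only [mul_zero, add_zero])
    (fun n h => by simp only [mul_succ, h]; abel) b

theorem mul_comm (a b : M.D .nat) : a * b = b * a :=
  induction_eq (fun b => a * b) (fun b => b * a) (by simp only [mul_zero, zero_mul])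
    (fun n h => by simp only [mul_succ, succ_mul, h]; abel) b

theorem mul_add (a b c : M.D .nat) : a * (b + c) = a * b + a * c :=
  induction_eq (fun c => a * (b + c)) (fun c => a * b + a * c)
    (by simp only [mul_zero, add_zero])
    (fun n h => by simp only [add_succ, mul_succ, h]; abel) c

theorem mul_assoc (a b c : M.D .nat) : a * b * c = a * (b * c) :=
  induction_eq (fun c => a * b * c) (fun c => a * (b * c)) (by simp only [mul_zero])
    (fun n h => by rw [mul_succ, mul_succ, mul_add, h]) c

theorem mul_one (a : M.D .nat) : a * 1 = a := by
  rw [← zero_add 1, mul_succ, mul_zero, add_zero]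

end Arith

open Arith

instance : CommSemiring (M.D .nat) where
  mul_assoc := Arith.mul_assoc
  mul_comm := Arith.mul_comm
  one_mul a := by rw [Arith.mul_comm, Arith.mul_one]
  mul_one := Arith.mul_one
  zero_mul := Arith.zero_mul
  mul_zero := Arith.mul_zero
  left_distrib := Arith.mul_add
  right_distrib a b c := by
    rw [Arith.mul_comm, Arith.mul_add, Arith.mul_comm c, Arith.mul_comm c]

namespace Arith

theorem sub_zero (a : M.D .nat) : a - 0 = a := M.R_zero _ _

theorem zero_pred : (0 : M.D .nat) - 1 = 0 := by
  rw [sub_def, one_def, M.R_succ, M.K_app, M.R_zero]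
  exact M.R_zero _ _

theorem sub_succ (a b : M.D .nat) : a - (b + 1) = a - b - 1 := by
  have h : ∀ c : M.D .nat, c - 1 = M.R M.zero (M.K .nat .nat) c := fun c => by
    rw [sub_def, one_def, M.R_succ, M.K_app, M.R_zero]
  rw [h, ← succ_eq, sub_def, M.R_succ, M.K_app, ← sub_def]

theorem succ_pred (a : M.D .nat) : a + 1 - 1 = a := by
  rw [sub_def, one_def, M.R_succ, M.K_app, M.R_zero, ← one_def, ← succ_eq, M.R_succ, M.K_app]

theorem succ_sub_succ (a b : M.D .nat) : a + 1 - (b + 1) = a - b :=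
  induction_eq (fun b => a + 1 - (b + 1)) (fun b => a - b)
    (by simp only [_root_.zero_add, succ_pred, sub_zero])
    (fun n h => by rw [sub_succ, h, sub_succ]) b

theorem add_sub_cancel (a c : M.D .nat) : a + c - a = c :=
  induction_eq (fun a => a + c - a) (fun _ => c) (by simp only [_root_.zero_add, sub_zero])
    (fun n h => by rw [succ_add, succ_sub_succ, h]) a

theorem zero_sub (a : M.D .nat) : 0 - a = 0 :=
  induction_eq (fun a => 0 - a) (fun _ => 0) (sub_zero _)
    (fun n h => by rw [sub_succ, h, zero_pred]) a

theorem sub_add (a p : M.D .nat) : a - (a + p) = 0 :=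
  induction_eq (fun a => a - (a + p)) (fun _ => 0) (zero_sub _)
    (fun n h => by rw [succ_add, succ_sub_succ, h]) a

theorem zero_or_succ (n : M.D .nat) : n = 0 ∨ n - 1 + 1 = n :=
  induction_or (fun n => n) (fun _ => 0) (fun n => n - 1 + 1) (fun n => n) (.inl rfl)
    (fun n _ => .inr (by rw [succ_pred])) n

/-- Comparability of two numbers, from which the linear order defined by `a - b = 0` and the
description of `≤` by addition follow. -/
theorem add_sub_or (a b : M.D .nat) : a + (b - a) = b ∨ b + (a - b) = a := by
  refine induction_or (fun b => a + (b - a)) (fun b => b) (fun b => b + (a - b)) (fun _ => a)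
    (.inr (by rw [sub_zero, _root_.zero_add])) (fun b h => ?_) b
  have key : a + (b - a) = b → a + (b + 1 - a) = b + 1 := fun h => by
    conv_lhs => rw [← h]
    rw [_root_.add_assoc, add_sub_cancel, ← _root_.add_assoc, h]
  rcases h with h | h
  · exact .inl (key h)
  · rcases zero_or_succ (a - b) with h' | h'
    · rw [h', _root_.add_zero] at h
      subst h
      exact .inl (by rw [add_sub_cancel])
    · refine .inr ?_
      rw [sub_succ, _root_.add_assoc, _root_.add_comm 1, h', h]

end Arith

noncomputable instance : LinearOrder (M.D .nat) where
  le a b := a - b = 0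
  le_refl a := by
    have := sub_add a 0
    rwa [_root_.add_zero] at this
  le_trans a b c h h' := by
    have key : ∀ {a b : M.D .nat}, a - b = 0 → ∃ p, b = a + p := by
      intro a b h
      rcases add_sub_or a b with h' | h'
      · exact ⟨_, h'.symm⟩
      · exact ⟨0, by rw [← h', h, _root_.add_zero, _root_.add_zero]⟩
    obtain ⟨p, rfl⟩ := key h
    obtain ⟨q, rfl⟩ := key h'
    rw [_root_.add_assoc]
    exact sub_add _ _
  le_antisymm a b h h' := by
    rcases add_sub_or a b with e | e
    · rwa [h', _root_.add_zero] at e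
    · rw [h, _root_.add_zero] at e
      exact e.symm
  le_total a b := by
    rcases add_sub_or a b with h | h
    · exact .inl (by rw [← h]; exact sub_add _ _)
    · exact .inr (by rw [← h]; exact sub_add _ _)
  toDecidableLE := Classical.decRel _

theorem le_def {a b : M.D .nat} : a ≤ b ↔ a - b = 0 := Iff.rfl

theorem le_iff_exists_add' {a b : M.D .nat} : a ≤ b ↔ ∃ c, b = a + c := by
  constructor
  · intro h
    rcases add_sub_or a b with h' | h'
    · exact ⟨_, h'.symm⟩
    · exact ⟨0, by rw [← h', le_def.1 h, _root_.add_zero, _root_.add_zero]⟩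
  · rintro ⟨c, rfl⟩
    exact sub_add _ _

theorem add_right_cancel'' {a b c : M.D .nat} (h : a + b = a + c) : b = c := by
  rw [← add_sub_cancel a b, h, add_sub_cancel]

instance : CanonicallyOrderedAdd (M.D .nat) where
  exists_add_of_le h := le_iff_exists_add'.1 h
  le_add_self _ b := le_iff_exists_add'.2 ⟨b, _root_.add_comm _ _⟩
  le_self_add _ b := le_iff_exists_add'.2 ⟨b, rfl⟩

instance : IsOrderedCancelAddMonoid (M.D .nat) where
  add_le_add_left _ b h c := by
    obtain ⟨d, rfl⟩ := le_iff_exists_add'.1 h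
    exact le_iff_exists_add'.2 ⟨d, by ring⟩
  le_of_add_le_add_left a _ c h := by
    obtain ⟨d, hd⟩ := le_iff_exists_add'.1 h
    rw [_root_.add_assoc] at hd
    exact le_iff_exists_add'.2 ⟨d, add_right_cancel'' hd⟩

instance : Nontrivial (M.D .nat) := ⟨0, 1, fun h => Arith.succ_ne_zero (0 : M.D .nat)
  (by rw [_root_.zero_add, h])⟩

theorem lt_iff_add_one_le' {a b : M.D .nat} : a < b ↔ a + 1 ≤ b := by
  constructor
  · intro h
    obtain ⟨c, rfl⟩ := le_iff_exists_add'.1 h.le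
    rcases zero_or_succ c with rfl | hc
    · simp at h
    · rw [← hc]
      exact le_iff_exists_add'.2 ⟨c - 1, by ring⟩
  · intro h
    refine lt_of_le_of_ne (le_trans le_self_add h) ?_
    rintro rfl
    obtain ⟨c, hc⟩ := le_iff_exists_add'.1 h
    rw [_root_.add_assoc] at hc
    refine Arith.succ_ne_zero c (add_right_cancel'' (a := a) ?_)
    rw [_root_.add_zero, _root_.add_comm c, ← hc]

instance : NoZeroDivisors (M.D .nat) where
  eq_zero_or_eq_zero_of_mul_eq_zero {a b} h := by
    rcases zero_or_succ a with ha | ha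
    · exact .inl ha
    · rcases zero_or_succ b with hb | hb
      · exact .inr hb
      · rw [← ha, ← hb] at h
        exact absurd ((by ring : _ = ((a - 1) * (b - 1) + (a - 1) + (b - 1)) + 1).symm.trans h)
          (Arith.succ_ne_zero _)

instance : IsStrictOrderedRing (M.D .nat) where
  zero_le_one := zero_le
  mul_lt_mul_of_pos_left a ha b c h := by
    obtain ⟨d, rfl⟩ := le_iff_exists_add'.1 h.le
    have hd : d ≠ 0 := by rintro rfl; simp at h
    show a * b < a * (b + d)
    rw [_root_.mul_add]
    exact lt_add_of_pos_right _ (pos_iff_ne_zero.2 (mul_ne_zero ha.ne' hd))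
  mul_lt_mul_of_pos_right a ha b c h := by
    obtain ⟨d, rfl⟩ := le_iff_exists_add'.1 h.le
    have hd : d ≠ 0 := by rintro rfl; simp at h
    show b * a < (b + d) * a
    rw [add_mul]
    exact lt_add_of_pos_right _ (pos_iff_ne_zero.2 (mul_ne_zero hd ha.ne'))

noncomputable instance : SuccOrder (M.D .nat) := SuccOrder.ofSuccLeIff (· + 1) lt_iff_add_one_le'.symm

noncomputable instance : SuccAddOrder (M.D .nat) := ⟨fun _ => rfl⟩

instance : OrderedSub (M.D .nat) where
  tsub_le_iff_right a b c := by
    rcases le_total a b with h | h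
    · rw [le_def.1 h]
      exact ⟨fun _ => h.trans le_add_self, fun _ => zero_le⟩
    · obtain ⟨d, rfl⟩ := le_iff_exists_add'.1 h
      rw [add_sub_cancel, _root_.add_comm, add_le_add_iff_right]

/-- Powers of two. -/
def pow2 (a : M.D .nat) : M.D .nat :=
  M.R (M.succ M.zero) (M.K .one .nat
    (M.R M.zero (M.K .one .nat (M.R (M.succ (M.succ M.zero)) (M.K .one .nat M.succ))))) a

instance Internal.pow2 (f : α → M.D .nat) [Internal f] : Internal fun x => pow2 (f x) := by
  simp only [Model.pow2]; infer_instance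

theorem pow2_zero : pow2 (0 : M.D .nat) = 1 := M.R_zero _ _

theorem pow2_succ (a : M.D .nat) : pow2 (a + 1) = 2 * pow2 a := by
  rw [← succ_eq, pow2, M.R_succ, M.K_app, ← pow2, ← mul_def, succ_eq, ← one_def,
    one_add_one_eq_two]

/-! ### Decidable predicates -/

/-- The predicate has an internal characteristic function. -/
class Dec (P : α → Prop) : Prop where
  exists_char : ∃ χ : α → M.D .nat, Internal χ ∧ ∀ x, P x ↔ χ x ≠ 0

instance (priority := 2000) Dec.const (p : Prop) : Dec (M := M) fun _ : α => p := by
  by_cases hp : p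
  · exact ⟨fun _ => 1, inferInstance, by simp [hp]⟩
  · exact ⟨fun _ => 0, inferInstance, by simp [hp]⟩

instance Dec.eq (f g : α → M.D .nat) [Internal f] [Internal g] :
    Dec (M := M) fun x => f x = g x := by
  refine ⟨fun x => 1 - ((f x - g x) + (g x - f x)), inferInstance, fun x => ?_⟩
  rw [Ne, tsub_eq_zero_iff_le, not_le, Order.lt_one_iff, add_eq_zero, tsub_eq_zero_iff_le,
    tsub_eq_zero_iff_le]
  exact ⟨fun h => ⟨h.le, h.ge⟩, fun h => le_antisymm h.1 h.2⟩

instance Dec.and (P Q : α → Prop) [hP : Dec (M := M) P] [hQ : Dec (M := M) Q] :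
    Dec (M := M) fun x => P x ∧ Q x := by
  obtain ⟨χ, hχ, h⟩ := hP
  obtain ⟨χ', hχ', h'⟩ := hQ
  exact ⟨fun x => χ x * χ' x, inferInstance, fun x => by rw [h, h', mul_ne_zero_iff]⟩

instance Dec.or (P Q : α → Prop) [hP : Dec (M := M) P] [hQ : Dec (M := M) Q] :
    Dec (M := M) fun x => P x ∨ Q x := by
  obtain ⟨χ, hχ, h⟩ := hP
  obtain ⟨χ', hχ', h'⟩ := hQ
  exact ⟨fun x => χ x + χ' x, inferInstance, fun x => by
    rw [h, h', ← not_and_or, ← add_eq_zero]⟩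

instance Dec.not (P : α → Prop) [hP : Dec (M := M) P] : Dec (M := M) fun x => ¬ P x := by
  obtain ⟨χ, hχ, h⟩ := hP
  exact ⟨fun x => 1 - χ x, inferInstance, fun x => by
    rw [h, not_not, Ne, tsub_eq_zero_iff_le, not_le, Order.lt_one_iff]⟩

instance Dec.imp (P Q : α → Prop) [Dec (M := M) P] [Dec (M := M) Q] :
    Dec (M := M) fun x => P x → Q x := by
  simp only [imp_iff_not_or]; infer_instance

instance Dec.iff (P Q : α → Prop) [Dec (M := M) P] [Dec (M := M) Q] :
    Dec (M := M) fun x => (P x ↔ Q x) := by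
  simp only [iff_def]; infer_instance

instance Dec.le (f g : α → M.D .nat) [Internal f] [Internal g] :
    Dec (M := M) fun x => f x ≤ g x := by
  simp only [le_def]; infer_instance

instance Dec.lt (f g : α → M.D .nat) [Internal f] [Internal g] :
    Dec (M := M) fun x => f x < g x := by
  simp only [lt_iff_add_one_le']; infer_instance

instance Internal.pow2_fun : Internal (M := M) Model.pow2 := Internal.pow2 fun x => x

instance Dec.le_left (a : M.D .nat) : Dec (M := M) (a ≤ ·) := Dec.le (fun _ => a) fun x => x

instance Dec.lt_left (a : M.D .nat) : Dec (M := M) (a < ·) := Dec.lt (fun _ => a) fun x => x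

/-! ### Induction and recursion -/

/-- Induction for decidable predicates. -/
theorem nat_induction (P : M.D .nat → Prop) [hP : Dec (M := M) P] (h₀ : P 0)
    (h₁ : ∀ n, P n → P (n + 1)) (n : M.D .nat) : P n := by
  obtain ⟨χ, hχ, h⟩ := hP
  have hn : ∀ n, P n ↔ 1 - χ n = 0 := fun n => by
    rw [h, tsub_eq_zero_iff_le, Order.one_le_iff_pos, pos_iff_ne_zero]
  rw [hn]
  refine induction_eq (fun n => 1 - χ n) (fun _ => 0) ((hn 0).1 h₀) (fun n h => ?_) n
  exact (hn _).1 (h₁ n ((hn n).2 h))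

/-- Primitive recursion. -/
noncomputable def natRec (a : M.D .nat) (f : M.D .nat → M.D .nat → M.D .nat) (n : M.D .nat) :
    M.D .nat :=
  M.R a (Model.lam fun k => Model.lam fun r => f k r) n

theorem natRec_zero (a : M.D .nat) (f : M.D .nat → M.D .nat → M.D .nat) :
    natRec a f 0 = a := M.R_zero _ _

theorem natRec_succ (a : M.D .nat) (f : M.D .nat → M.D .nat → M.D .nat)
    [Internal fun p : M.D .nat × M.D .nat => f p.1 p.2] (n : M.D .nat) :
    natRec a f (n + 1) = f n (natRec a f n) := by
  rw [natRec, ← succ_eq, M.R_succ, lam_app, lam_app' (fun n r => f n r) n, ← natRec]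

instance Internal.natRec (a : α → M.D .nat) (f : α → M.D .nat → M.D .nat → M.D .nat)
    (n : α → M.D .nat) [Internal a] [Internal n]
    [Internal fun p : (α × M.D .nat) × M.D .nat => f p.1.1 p.1.2 p.2] :
    Internal fun x => natRec (a x) (f x) (n x) := by
  simp only [Model.natRec]; infer_instance

instance Internal.natRec_left (a : M.D .nat) (f : M.D .nat → M.D .nat → M.D .nat)
    [Internal fun p : M.D .nat × M.D .nat => f p.1 p.2] : Internal (Model.natRec a f) := by
  show Internal fun n => M.R a (Model.lam fun k => Model.lam fun r => f k r) n
  infer_instance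

end Model

end HigherOrderRM

/-! ### Bounded search, definition by cases, choice and `∃²`. -/

namespace HigherOrderRM

namespace Model

variable {M : Model} {α β : Type} [Ctx M α] [Ctx M β]

/-! ### Bounded quantifiers, least elements and definition by cases -/

theorem Internal.comp_proj {σ : Ty} (f : β → α) [Proj (M := M) f] (G : α → M.D σ)
    [h : Internal G] : Internal fun x => G (f x) := by
  obtain ⟨hG⟩ := h
  induction hG with
  | coord h => exact ⟨.coord (Proj.coord h)⟩
  | const a => infer_instance
  | app _ _ ih₁ ih₂ => infer_instance

theorem Dec.comp_proj (f : β → α) [Proj (M := M) f] (P : α → Prop) [h : Dec (M := M) P] :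
    Dec (M := M) fun x => P (f x) := by
  obtain ⟨χ, hχ, h⟩ := h
  exact ⟨fun x => χ (f x), Internal.comp_proj f χ, fun x => h _⟩

theorem Dec.exists_char_curry (P : α → M.D .nat → Prop)
    [hP : Dec (M := M) fun p : α × M.D .nat => P p.1 p.2] :
    ∃ G : α → M.D .one, Internal G ∧ ∀ x n, P x n ↔ G x n ≠ 0 := by
  obtain ⟨χ, hχ, h⟩ := hP
  obtain ⟨G, hG, e⟩ := hχ.poly.exists_lam
  exact ⟨G, ⟨hG⟩, fun x n => by rw [e]; exact h (x, n)⟩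

/-- The product of the values of the characteristic function below the bound, computed by recursion,
vanishes exactly when one of them does. -/
instance Dec.forall_lt (n : α → M.D .nat) (P : α → M.D .nat → Prop) [Internal n]
    [hP : Dec (M := M) fun p : α × M.D .nat => P p.1 p.2] :
    Dec (M := M) fun x => ∀ i, i < n x → P x i := by
  obtain ⟨G, hG, h⟩ := Dec.exists_char_curry P
  have := Internal.comp_proj (fun p : (α × M.D .nat) × M.D .nat => p.1.1) G
  refine ⟨fun x => Model.natRec 1 (fun i r => r * G x i) (n x), inferInstance, fun x => ?_⟩
  simp only [h]
  constructor
  · intro h'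
    refine nat_induction (fun k => k ≤ n x → Model.natRec 1 (fun i r => r * G x i) k ≠ 0)
      (fun _ => ?_) (fun k ih hk => ?_) (n x) le_rfl
    · rw [natRec_zero]; exact one_ne_zero
    · rw [natRec_succ]
      have hk' := Order.add_one_le_iff.1 hk
      exact mul_ne_zero (ih hk'.le) (h' k hk')
  · intro h' i hi hG0
    refine h' (nat_induction (fun k => i < k → Model.natRec 1 (fun i r => r * G x i) k = 0)
      (fun h => absurd h not_lt_zero) (fun k ih hk => ?_) (n x) hi)
    rw [natRec_succ]
    rcases (Order.lt_add_one_iff.1 hk).eq_or_lt with rfl | hk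
    · rw [hG0, mul_zero]
    · rw [ih hk, zero_mul]

/-- Without a least element, "nothing below `n` has the property" is inductive, and it is decidable
because its quantifier is bounded. -/
theorem exists_least (P : M.D .nat → Prop) [Dec (M := M) P] (h : ∃ n, P n) :
    ∃ n, P n ∧ ∀ m, m < n → ¬ P m := by
  by_contra! hn
  have := Dec.comp_proj (M := M) (fun p : M.D .nat × M.D .nat => p.2) P
  have key : ∀ n, ∀ m, m < n → ¬ P m := by
    refine nat_induction _ (fun m hm => absurd hm not_lt_zero) fun n ih m hm => ?_
    rcases (Order.lt_add_one_iff.1 hm).eq_or_lt with rfl | hm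
    · intro hP
      obtain ⟨k, hk, hPk⟩ := hn m hP
      exact ih k hk hPk
    · exact ih m hm
  obtain ⟨n, hP⟩ := h
  exact key (n + 1) n (Order.lt_add_one_iff.2 le_rfl) hP

/-- At type 0 the cases are combined arithmetically with a 0-1 factor; at function types they are
distinguished pointwise, under an abstraction. -/
theorem Internal.ite_aux (σ : Ty) : ∀ {α : Type} [Ctx M α] (P : α → Prop) [Dec (M := M) P]
    [∀ x, Decidable (P x)] (f g : α → M.D σ) [Internal f] [Internal g],
    Internal fun x => if P x then f x else g x := by
  induction σ with
  | nat =>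
    intro α _ P hP _ f g _ _
    obtain ⟨χ, hχ, h⟩ := hP
    have : Internal fun x => f x * (1 - (1 - χ x)) + g x * (1 - χ x) := inferInstance
    convert this using 2 with x
    by_cases hx : P x
    · have := Order.one_le_iff_pos.2 (pos_iff_ne_zero.2 ((h x).1 hx))
      rw [if_pos hx, tsub_eq_zero_of_le this, tsub_zero, mul_one, mul_zero, add_zero]
    · have : χ x = 0 := by_contra fun h' => hx ((h x).2 h')
      rw [if_neg hx, this, tsub_zero, tsub_self, mul_zero, mul_one, zero_add]
  | arr σ τ _ ih =>
    intro α _ P _ _ f g _ _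
    have := Dec.comp_proj (M := M) (fun p : α × M.D σ => p.1) P
    have := Internal.comp_proj (fun p : α × M.D σ => p.1) f
    have := Internal.comp_proj (fun p : α × M.D σ => p.1) g
    have hI := ih (fun p : α × M.D σ => P p.1) (fun p => f p.1 p.2) (fun p => g p.1 p.2)
    have : Internal fun x => Model.lam fun y => if P x then f x y else g x y :=
      Internal.lam _
    convert this using 2 with x
    refine M.ext fun y => ?_
    rw [lam_app' (fun x y => if P x then f x y else g x y)]
    split_ifs <;> rfl

instance Internal.ite {σ : Ty} (P : α → Prop) [Dec (M := M) P] [∀ x, Decidable (P x)]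
    (f g : α → M.D σ) [Internal f] [Internal g] :
    Internal fun x => if P x then f x else g x :=
  Internal.ite_aux σ P f g

open Classical in
/-- The least number with the property `P`, or `0` if there is none. -/
noncomputable def least (P : M.D .nat → Prop) : M.D .nat :=
  if h : ∃ n, P n ∧ ∀ m, m < n → ¬ P m then h.choose else 0

theorem least_spec (P : M.D .nat → Prop) [Dec (M := M) P] (h : ∃ n, P n) : P (least P) := by
  have h' := exists_least P h
  rw [least, dif_pos h']
  exact h'.choose_spec.1

theorem least_le (P : M.D .nat → Prop) {n : M.D .nat} [Dec (M := M) P] (h : P n) :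
    least P ≤ n := by
  have h' := exists_least P ⟨n, h⟩
  rw [least, dif_pos h']
  exact not_lt.1 fun hlt => h'.choose_spec.2 n hlt h

theorem least_eq (P : M.D .nat → Prop) {n : M.D .nat} (h : P n) (hn : ∀ m, m < n → ¬ P m) :
    least P = n := by
  have h' : ∃ n, P n ∧ ∀ m, m < n → ¬ P m := ⟨n, h, hn⟩
  rw [least, dif_pos h']
  refine le_antisymm (not_lt.1 fun hlt => h'.choose_spec.2 n hlt h)
    (not_lt.1 fun hlt => hn _ hlt h'.choose_spec.1)

/-! ### Quantifier-free choice -/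

open Classical in
/-- The sequence `n, f 0, f 1, …`. -/
noncomputable def cons (n : M.D .nat) (f : M.D .one) : M.D .one :=
  Model.lam fun i => if i = 0 then n else f (i - 1)

theorem cons_zero (n : M.D .nat) (f : M.D .one) : cons n f 0 = n := by
  rw [cons, lam_app, if_pos rfl]

theorem cons_succ (n : M.D .nat) (f : M.D .one) (i : M.D .nat) : cons n f (i + 1) = f i := by
  rw [cons, lam_app, if_neg (by simp), add_tsub_cancel_right]

instance Internal.cons (n : α → M.D .nat) (f : α → M.D .one) [Internal n] [Internal f] :
    Internal fun x => Model.cons (n x) (f x) := by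
  have := Internal.comp_proj (fun p : α × M.D .nat => p.1) n
  have := Internal.comp_proj (fun p : α × M.D .nat => p.1) f
  simp only [Model.cons]
  infer_instance

/-- The sequence without its first element. -/
noncomputable def tail (f : M.D .one) : M.D .one := Model.lam fun i => f (i + 1)

theorem tail_app (f : M.D .one) (i : M.D .nat) : tail f i = f (i + 1) := lam_app _ _

instance Internal.tail (f : α → M.D .one) [Internal f] :
    Internal fun x => Model.tail (f x) := by
  have := Internal.comp_proj (fun p : α × M.D .nat => p.1) f
  simp only [Model.tail]
  infer_instance

theorem tail_cons (n : M.D .nat) (f : M.D .one) : tail (cons n f) = f :=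
  M.ext fun i => by rw [tail_app, cons_succ]

/-- The choice axiom has a single parameter of type 1, so the number parameter is prefixed to the
function by `cons`. -/
theorem exists_search (P : M.D .one → M.D .nat → M.D .nat → Prop)
    [hP : Dec (M := M) fun p : (M.D .one × M.D .nat) × M.D .nat => P p.1.1 p.1.2 p.2]
    (h : ∀ f n, ∃ r, P f n r) : ∃ Y : M.D (.arr .one .one), ∀ f n, P f n (Y f n) := by
  obtain ⟨χ, hχ, e⟩ := hP
  obtain ⟨G, hG, e₁⟩ := hχ.poly.exists_lam
  obtain ⟨G', hG', e₂⟩ := hG.exists_lam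
  have := Internal.mk hG'
  obtain ⟨c, hc⟩ := Internal.exists_rep G'
  have e' : ∀ f n r, P f n r ↔ c f n r ≠ 0 := fun f n r => by
    rw [hc, e₂, e₁]; exact e ((f, n), r)
  obtain ⟨Y, hY⟩ := M.choice
    (Model.lam fun f => Model.lam fun r => 1 - c (tail f) (f 0) r) fun f => by
      obtain ⟨r, hr⟩ := h (tail f) (f 0)
      refine ⟨r, ?_⟩
      simp only [lam_app]
      rw [e', ← pos_iff_ne_zero, ← Order.one_le_iff_pos] at hr
      exact tsub_eq_zero_of_le hr
  refine ⟨Model.lam fun f => Model.lam fun n => Y (cons n f), fun f n => ?_⟩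
  have := hY (cons n f)
  simp only [lam_app, tail_cons, cons_zero] at this ⊢
  rw [e', ← pos_iff_ne_zero, ← Order.one_le_iff_pos]
  exact tsub_eq_zero_iff_le.1 this

theorem exists_search_nat (P : M.D .nat → M.D .nat → Prop)
    [hP : Dec (M := M) fun p : M.D .nat × M.D .nat => P p.1 p.2]
    (h : ∀ n, ∃ r, P n r) : ∃ f : M.D .one, ∀ n, P n (f n) := by
  obtain ⟨G, hG, e⟩ := Dec.exists_char_curry P
  have := Internal.comp_proj (fun p : (M.D .one × M.D .nat) × M.D .nat => p.1.2) G
  obtain ⟨Y, hY⟩ := exists_search (fun _ n r => G n r ≠ 0) fun _ n => by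
    simpa only [← e] using h n
  exact ⟨Y (Classical.arbitrary _), fun n => (e _ _).2 (hY _ n)⟩

/-! ### Arithmetical comprehension from `∃²` -/

/-- The model contains the functional `∃²`. -/
class HasE2 (M : Model) : Prop where
  exists_functional : ∃ E : M.D .two, ∀ f : M.D .one, E f ≠ 0 ↔ ∀ n, f n ≠ 0

section HasE2

variable [HasE2 M]

instance Dec.forall_nat (P : α → M.D .nat → Prop)
    [Dec (M := M) fun p : α × M.D .nat => P p.1 p.2] :
    Dec (M := M) fun x => ∀ n, P x n := by
  obtain ⟨G, hG, e⟩ := Dec.exists_char_curry P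
  obtain ⟨E, hE⟩ := HasE2.exists_functional (M := M)
  exact ⟨fun x => E (G x), inferInstance, fun x => by rw [hE]; simp only [e]⟩

instance Dec.exists_nat (P : α → M.D .nat → Prop)
    [Dec (M := M) fun p : α × M.D .nat => P p.1 p.2] :
    Dec (M := M) fun x => ∃ n, P x n := by
  have : Dec (M := M) fun x => ¬ ∀ n, ¬ P x n := inferInstance
  simpa using this

instance Dec.eq_one (f g : α → M.D .one) [Internal f] [Internal g] :
    Dec (M := M) fun x => f x = g x := by
  have := Internal.comp_proj (fun p : α × M.D .nat => p.1) f
  have := Internal.comp_proj (fun p : α × M.D .nat => p.1) g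
  have : Dec (M := M) fun x => ∀ n, f x n = g x n := inferInstance
  convert this using 2 with x
  exact ⟨fun h n => by rw [h], fun h => M.ext h⟩

instance Internal.least (P : α → M.D .nat → Prop)
    [Dec (M := M) fun p : α × M.D .nat => P p.1 p.2] :
    Internal fun x => Model.least (P x) := by
  obtain ⟨G, hG, e⟩ := Dec.exists_char_curry P
  -- A total search needs an answer when there is no solution. That case is decidable by `∃²`, and
  -- its answer 0 is the default value of `least`.
  obtain ⟨Y, hY⟩ := exists_search
    (fun f (_ : M.D .nat) r => (f r ≠ 0 ∧ ∀ i, i < r → f i = 0) ∨ ((∀ n, f n = 0) ∧ r = 0))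
    fun f n => by
      by_cases h : ∃ n, f n ≠ 0
      · obtain ⟨r, hr, hlt⟩ := exists_least (fun n => f n ≠ 0) h
        exact ⟨r, .inl ⟨hr, fun i hi => not_not.1 (hlt i hi)⟩⟩
      · exact ⟨0, .inr ⟨by simpa using h, rfl⟩⟩
  have : Internal fun x => Y (G x) 0 := inferInstance
  convert this using 2 with x
  rcases hY (G x) 0 with ⟨h, hlt⟩ | ⟨h, h0⟩
  · exact least_eq _ ((e _ _).2 h) fun m hm => by rw [e, hlt m hm]; simp
  · rw [h0, Model.least, dif_neg]
    rintro ⟨n, hn, -⟩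
    exact (e _ _).1 hn (h n)

end HasE2

end Model

end HigherOrderRM

/-! ### The rational numbers built from the numbers of a model. -/

namespace HigherOrderRM

namespace Model

variable {M : Model}

/-! ### The ordered field of rationals of a model -/

/-- A formal fraction `(a - b) / (c + 1)`. -/
@[ext] structure Frac (M : Model) where
  a : M.D .nat
  b : M.D .nat
  c : M.D .nat

/-- Equality of fractions. -/
instance Frac.setoid (M : Model) : Setoid M.Frac where
  r x y := x.a * (y.c + 1) + y.b * (x.c + 1) = y.a * (x.c + 1) + x.b * (y.c + 1)
  iseqv := by
    refine ⟨fun x => rfl, fun h => h.symm, fun {x y z} h h' => ?_⟩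
    have hy : y.c + 1 ≠ 0 := Arith.succ_ne_zero _
    -- Subtraction is truncated, so the terms with `y.a` and `y.b` are added to both sides instead
    -- of being cancelled.
    refine mul_right_cancel₀ hy (add_right_cancel (b := y.a * (x.c + 1) * (z.c + 1) + y.b * (x.c + 1) * (z.c + 1)) ?_)
    calc _ = (x.a * (y.c + 1) + y.b * (x.c + 1)) * (z.c + 1) + (y.a * (z.c + 1) + z.b * (y.c + 1)) * (x.c + 1) := by ring
      _ = (y.a * (x.c + 1) + x.b * (y.c + 1)) * (z.c + 1) + (z.a * (y.c + 1) + y.b * (z.c + 1)) * (x.c + 1) := by rw [h, h']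
      _ = _ := by ring

theorem Frac.equiv_def {x y : M.Frac} :
    x ≈ y ↔ x.a * (y.c + 1) + y.b * (x.c + 1) = y.a * (x.c + 1) + x.b * (y.c + 1) := Iff.rfl

/-- The rational numbers of a model. -/
def Rat (M : Model) : Type := Quotient (Frac.setoid M)

namespace Rat

/-- The rational number `(a - b) / (c + 1)`. -/
def mk (x : M.Frac) : M.Rat := Quotient.mk _ x

theorem mk_eq {x y : M.Frac} : mk x = mk y ↔ x ≈ y := Quotient.eq

theorem exists_mk (x : M.Rat) : ∃ y, x = mk y := (Quotient.exists_rep x).imp fun _ h => h.symm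

instance : Zero M.Rat := ⟨mk ⟨0, 0, 0⟩⟩

instance : One M.Rat := ⟨mk ⟨1, 0, 0⟩⟩

instance : Neg M.Rat := ⟨Quotient.map (fun x => ⟨x.b, x.a, x.c⟩) fun x y h => by
  rw [Frac.equiv_def] at h ⊢
  rw [add_comm, add_comm (y.b * _)]
  exact h.symm ▸ rfl⟩

instance : Add M.Rat := ⟨Quotient.map₂
  (fun x y => ⟨x.a * (y.c + 1) + y.a * (x.c + 1), x.b * (y.c + 1) + y.b * (x.c + 1),
    x.c * y.c + x.c + y.c⟩) fun x x' h y y' h' => by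
  rw [Frac.equiv_def] at h h' ⊢
  dsimp only
  calc _ = (x.a * (x'.c + 1) + x'.b * (x.c + 1)) * (y.c + 1) * (y'.c + 1)
        + (y.a * (y'.c + 1) + y'.b * (y.c + 1)) * (x.c + 1) * (x'.c + 1) := by ring
    _ = (x'.a * (x.c + 1) + x.b * (x'.c + 1)) * (y.c + 1) * (y'.c + 1)
        + (y'.a * (y.c + 1) + y.b * (y'.c + 1)) * (x.c + 1) * (x'.c + 1) := by rw [h, h']
    _ = _ := by ring⟩

instance : Mul M.Rat := ⟨Quotient.map₂
  (fun x y => ⟨x.a * y.a + x.b * y.b, x.a * y.b + x.b * y.a,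
    x.c * y.c + x.c + y.c⟩) fun x x' h y y' h' => by
  have step : ∀ {x x' : M.Frac} (y : M.Frac), x ≈ x' →
      (⟨x.a * y.a + x.b * y.b, x.a * y.b + x.b * y.a, x.c * y.c + x.c + y.c⟩ : M.Frac) ≈
        ⟨x'.a * y.a + x'.b * y.b, x'.a * y.b + x'.b * y.a, x'.c * y.c + x'.c + y.c⟩ := by
    intro x x' y h
    rw [Frac.equiv_def] at h ⊢
    dsimp only
    calc _ = (y.c + 1) * (y.a * (x.a * (x'.c + 1) + x'.b * (x.c + 1))
          + y.b * (x'.a * (x.c + 1) + x.b * (x'.c + 1))) := by ring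
      _ = (y.c + 1) * (y.a * (x'.a * (x.c + 1) + x.b * (x'.c + 1))
          + y.b * (x.a * (x'.c + 1) + x'.b * (x.c + 1))) := by rw [h]
      _ = _ := by ring
  refine Setoid.trans (step y h) ?_
  have := step x' h'
  convert this using 1 <;> ext <;> dsimp only <;> ring⟩

theorem mk_add (x y : M.Frac) : mk x + mk y =
    mk ⟨x.a * (y.c + 1) + y.a * (x.c + 1), x.b * (y.c + 1) + y.b * (x.c + 1),
      x.c * y.c + x.c + y.c⟩ := rfl

theorem mk_mul (x y : M.Frac) : mk x * mk y =
    mk ⟨x.a * y.a + x.b * y.b, x.a * y.b + x.b * y.a, x.c * y.c + x.c + y.c⟩ := rfl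

theorem mk_neg (x : M.Frac) : -mk x = mk ⟨x.b, x.a, x.c⟩ := rfl

theorem zero_eq : (0 : M.Rat) = mk ⟨0, 0, 0⟩ := rfl

theorem one_eq : (1 : M.Rat) = mk ⟨1, 0, 0⟩ := rfl

theorem mk_eq_zero {x : M.Frac} : mk x = 0 ↔ x.a = x.b := by
  rw [zero_eq, mk_eq, Frac.equiv_def]
  simp

instance : CommRing M.Rat where
  add_assoc x y z := by
    obtain ⟨x, rfl⟩ := exists_mk x
    obtain ⟨y, rfl⟩ := exists_mk y
    obtain ⟨z, rfl⟩ := exists_mk z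
    simp only [mk_add, mk_eq, Frac.equiv_def]; ring
  zero_add x := by
    obtain ⟨x, rfl⟩ := exists_mk x
    simp only [zero_eq, mk_add, mk_eq, Frac.equiv_def]; ring
  add_zero x := by
    obtain ⟨x, rfl⟩ := exists_mk x
    simp only [zero_eq, mk_add, mk_eq, Frac.equiv_def]; ring
  add_comm x y := by
    obtain ⟨x, rfl⟩ := exists_mk x
    obtain ⟨y, rfl⟩ := exists_mk y
    simp only [mk_add, mk_eq, Frac.equiv_def]; ring
  neg_add_cancel x := by
    obtain ⟨x, rfl⟩ := exists_mk x
    simp only [zero_eq, mk_neg, mk_add, mk_eq, Frac.equiv_def]; ring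
  mul_assoc x y z := by
    obtain ⟨x, rfl⟩ := exists_mk x
    obtain ⟨y, rfl⟩ := exists_mk y
    obtain ⟨z, rfl⟩ := exists_mk z
    simp only [mk_mul, mk_eq, Frac.equiv_def]; ring
  one_mul x := by
    obtain ⟨x, rfl⟩ := exists_mk x
    simp only [one_eq, mk_mul, mk_eq, Frac.equiv_def]; ring
  mul_one x := by
    obtain ⟨x, rfl⟩ := exists_mk x
    simp only [one_eq, mk_mul, mk_eq, Frac.equiv_def]; ring
  mul_comm x y := by
    obtain ⟨x, rfl⟩ := exists_mk x
    obtain ⟨y, rfl⟩ := exists_mk y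
    simp only [mk_mul, mk_eq, Frac.equiv_def]; ring
  left_distrib x y z := by
    obtain ⟨x, rfl⟩ := exists_mk x
    obtain ⟨y, rfl⟩ := exists_mk y
    obtain ⟨z, rfl⟩ := exists_mk z
    simp only [mk_mul, mk_add, mk_eq, Frac.equiv_def]; ring
  right_distrib x y z := by
    obtain ⟨x, rfl⟩ := exists_mk x
    obtain ⟨y, rfl⟩ := exists_mk y
    obtain ⟨z, rfl⟩ := exists_mk z
    simp only [mk_mul, mk_add, mk_eq, Frac.equiv_def]; ring
  zero_mul x := by
    obtain ⟨x, rfl⟩ := exists_mk x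
    simp only [zero_eq, mk_mul, mk_eq, Frac.equiv_def]; ring
  mul_zero x := by
    obtain ⟨x, rfl⟩ := exists_mk x
    simp only [zero_eq, mk_mul, mk_eq, Frac.equiv_def]; ring
  nsmul := nsmulRec
  zsmul := zsmulRec

/-- The order of the numbers is discrete, so unequal `a` and `b` differ by some `d + 1`, which has
the form required of a denominator. -/
theorem exists_mul_eq_one {x : M.Rat} (h : x ≠ 0) : ∃ y, x * y = 1 := by
  obtain ⟨x, rfl⟩ := exists_mk x
  rw [Ne, mk_eq_zero] at h
  rcases lt_or_gt_of_ne h with h | h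
  · obtain ⟨d, hd⟩ := le_iff_exists_add'.1 (lt_iff_add_one_le'.1 h)
    refine ⟨mk ⟨0, x.c + 1, d⟩, ?_⟩
    simp only [one_eq, mk_mul, mk_eq, Frac.equiv_def, hd]; ring
  · obtain ⟨d, hd⟩ := le_iff_exists_add'.1 (lt_iff_add_one_le'.1 h)
    refine ⟨mk ⟨x.c + 1, 0, d⟩, ?_⟩
    simp only [one_eq, mk_mul, mk_eq, Frac.equiv_def, hd]; ring

instance : Nontrivial M.Rat := ⟨0, 1, fun h => by
  rw [eq_comm, one_eq, mk_eq_zero] at h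
  exact one_ne_zero h⟩

open Classical in
noncomputable instance : Field M.Rat where
  inv x := if h : x = 0 then 0 else (exists_mul_eq_one h).choose
  mul_inv_cancel x h := by
    change x * dite _ _ _ = 1
    rw [dif_neg h]
    exact (exists_mul_eq_one h).choose_spec
  inv_zero := dif_pos rfl
  nnqsmul := _
  qsmul := _

/-- The nonnegative rational numbers. -/
def Nonneg : M.Rat → Prop :=
  Quotient.lift (fun x => x.b ≤ x.a) fun x y h => by
    have key : ∀ {x y : M.Frac}, x ≈ y → x.b ≤ x.a → y.b ≤ y.a := by
      intro x y h hx
      rw [Frac.equiv_def] at h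
      by_contra! hy
      have h₁ := mul_lt_mul_of_pos_right hy (pos_iff_ne_zero.2 (Arith.succ_ne_zero x.c))
      have h₂ := mul_le_mul_left hx (y.c + 1)
      have h₃ := add_lt_add_of_lt_of_le h₁ h₂
      rw [← h, add_comm] at h₃
      exact lt_irrefl _ h₃
    exact propext ⟨key h, key (Setoid.symm h)⟩

theorem nonneg_mk {x : M.Frac} : Nonneg (mk x) ↔ x.b ≤ x.a := Iff.rfl

theorem Nonneg.add {x y : M.Rat} (hx : Nonneg x) (hy : Nonneg y) : Nonneg (x + y) := by
  obtain ⟨x, rfl⟩ := exists_mk x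
  obtain ⟨y, rfl⟩ := exists_mk y
  rw [nonneg_mk] at hx hy
  rw [mk_add, nonneg_mk]
  dsimp only
  gcongr

theorem Nonneg.mul {x y : M.Rat} (hx : Nonneg x) (hy : Nonneg y) : Nonneg (x * y) := by
  obtain ⟨x, rfl⟩ := exists_mk x
  obtain ⟨y, rfl⟩ := exists_mk y
  rw [nonneg_mk] at hx hy
  rw [mk_mul, nonneg_mk]
  dsimp only
  obtain ⟨d, hd⟩ := le_iff_exists_add'.1 hx
  obtain ⟨e, he⟩ := le_iff_exists_add'.1 hy
  rw [hd, he]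
  exact le_iff_exists_add'.2 ⟨d * e, by ring⟩

theorem Nonneg.eq_zero {x : M.Rat} (hx : Nonneg x) (hx' : Nonneg (-x)) : x = 0 := by
  obtain ⟨x, rfl⟩ := exists_mk x
  rw [mk_neg, nonneg_mk] at hx'
  rw [nonneg_mk] at hx
  exact mk_eq_zero.2 (le_antisymm hx' hx)

theorem nonneg_or_neg (x : M.Rat) : Nonneg x ∨ Nonneg (-x) := by
  obtain ⟨x, rfl⟩ := exists_mk x
  rw [mk_neg, nonneg_mk, nonneg_mk]
  exact le_total _ _

noncomputable instance : LinearOrder M.Rat where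
  le x y := Nonneg (y - x)
  le_refl x := by rw [sub_self, zero_eq, nonneg_mk]
  le_trans x y z h h' := by simpa using h'.add h
  le_antisymm x y h h' := (sub_eq_zero.1 (h.eq_zero (by simpa using h'))).symm
  le_total x y := by simpa using nonneg_or_neg (y - x)
  toDecidableLE := Classical.decRel _

theorem le_def {x y : M.Rat} : x ≤ y ↔ Nonneg (y - x) := Iff.rfl

instance : IsOrderedRing M.Rat where
  add_le_add_left x y h z := by rw [le_def] at h ⊢; simpa using h
  zero_le_one := by rw [le_def, sub_zero, one_eq, nonneg_mk]; exact zero_le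
  mul_le_mul_of_nonneg_left x hx y z h := by
    have hx' : Nonneg x := by simpa [le_def] using hx
    have := hx'.mul (le_def.1 h)
    change x * y ≤ x * z
    rwa [le_def, ← mul_sub]
  mul_le_mul_of_nonneg_right x hx y z h := by
    have hx' : Nonneg x := by simpa [le_def] using hx
    have := (le_def.1 h).mul hx'
    change y * x ≤ z * x
    rwa [le_def, ← sub_mul]

instance : IsStrictOrderedRing M.Rat := IsOrderedRing.toIsStrictOrderedRing _

/-- The embedding of the natural numbers of a model into its rational numbers. -/
def ofNat : M.D .nat →+* M.Rat where
  toFun n := mk ⟨n, 0, 0⟩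
  map_zero' := rfl
  map_one' := rfl
  map_add' a b := by simp only [mk_add, mk_eq, Frac.equiv_def]; ring
  map_mul' a b := by simp only [mk_mul, mk_eq, Frac.equiv_def]; ring

theorem ofNat_apply (n : M.D .nat) : ofNat n = mk ⟨n, 0, 0⟩ := rfl

theorem ofNat_nonneg (n : M.D .nat) : 0 ≤ ofNat n := by
  rw [le_def, sub_zero, ofNat_apply, nonneg_mk]
  exact zero_le

theorem ofNat_injective : Function.Injective (ofNat (M := M)) := by
  intro m n h
  simp only [ofNat_apply, mk_eq, Frac.equiv_def] at h
  simpa using h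

theorem ofNat_strictMono : StrictMono (ofNat (M := M)) := by
  intro m n h
  obtain ⟨d, rfl⟩ := le_iff_exists_add'.1 h.le
  refine lt_of_le_of_ne ?_ fun h' => h.ne (ofNat_injective h')
  rw [map_add]
  exact le_add_of_nonneg_right (ofNat_nonneg d)

theorem ofNat_le {m n : M.D .nat} : ofNat m ≤ ofNat n ↔ m ≤ n := ofNat_strictMono.le_iff_le

theorem ofNat_lt {m n : M.D .nat} : ofNat m < ofNat n ↔ m < n := ofNat_strictMono.lt_iff_lt

theorem ofNat_succ_pos (n : M.D .nat) : 0 < ofNat n + 1 :=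
  add_pos_of_nonneg_of_pos (ofNat_nonneg n) one_pos

theorem mk_eq_div (x : M.Frac) : mk x = (ofNat x.a - ofNat x.b) / (ofNat x.c + 1) := by
  rw [eq_div_iff (ofNat_succ_pos _).ne', ← map_one ofNat, ← map_add, sub_eq_add_neg]
  simp only [ofNat_apply, mk_neg, mk_add, mk_mul, mk_eq, Frac.equiv_def]; ring

end Rat

end Model

end HigherOrderRM

/-! ### Pairs, codes of rationals and the Archimedean property. -/

namespace HigherOrderRM

namespace Model

variable {M : Model} {α β : Type} [Ctx M α] [Ctx M β]

/-! ### Pairing -/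

/-- The pairing function. -/
def pairN (s t : M.D .nat) : M.D .nat := (s + t) * (s + t) + s

instance Internal.pairN (f g : α → M.D .nat) [Internal f] [Internal g] :
    Internal fun x => Model.pairN (f x) (g x) := by
  simp only [Model.pairN]; infer_instance

instance Internal.pairN_left (a : M.D .nat) : Internal (Model.pairN a) :=
  Internal.pairN (fun _ => a) fun x => x

/-- A pair with sum `r` lies between `r ^ 2` and `(r + 1) ^ 2`, so the sum can be read off the code.
-/
theorem pairN_lt {s t s' t' : M.D .nat} (h : s + t < s' + t') : pairN s t < pairN s' t' := by
  have h' := Order.add_one_le_iff.2 h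
  calc pairN s t < (s + t + 1) * (s + t + 1) := by
        rw [pairN, ← Order.add_one_le_iff]
        exact le_iff_exists_add'.2 ⟨s + t + t, by ring⟩
    _ ≤ (s' + t') * (s' + t') := mul_le_mul' h' h'
    _ ≤ pairN s' t' := le_self_add

theorem pairN_inj {s t s' t' : M.D .nat} (h : pairN s t = pairN s' t') : s = s' ∧ t = t' := by
  have hst : s + t = s' + t' :=
    le_antisymm (not_lt.1 fun hlt => (pairN_lt hlt).ne h.symm)
      (not_lt.1 fun hlt => (pairN_lt hlt).ne h)
  rw [pairN, pairN, hst] at h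
  have hs := add_left_cancel h
  subst hs
  exact ⟨rfl, add_left_cancel hst⟩

theorem le_pairN_left (s t : M.D .nat) : s ≤ pairN s t := le_add_self

theorem le_pairN_right (s t : M.D .nat) : t ≤ pairN s t := by
  rcases eq_or_ne t 0 with rfl | ht
  · exact zero_le
  · have : 1 ≤ s + t := (Order.one_le_iff_pos.2 (pos_iff_ne_zero.2 ht)).trans le_add_self
    calc t ≤ s + t := le_add_self
      _ = (s + t) * 1 := (mul_one _).symm
      _ ≤ (s + t) * (s + t) := mul_le_mul_right this _
      _ ≤ pairN s t := le_self_add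

/-- Both components are bounded by the code, so the specification uses bounded quantifiers only and
is open to search. The pairing is not surjective; on non-codes the value is unspecified. -/
theorem exists_fst (M : Model) : ∃ f : M.D .one, ∀ s t : M.D .nat, f (pairN s t) = s := by
  obtain ⟨f, hf⟩ := exists_search_nat (M := M)
    (fun p r => ∀ s, s < p + 1 → ∀ t, t < p + 1 → pairN s t = p → r = s) fun p => by
      by_cases h : ∃ s t, pairN s t = p
      · obtain ⟨s, t, rfl⟩ := h
        exact ⟨s, fun s' _ t' _ h => (pairN_inj h).1.symm⟩
      · exact ⟨0, fun s _ t _ h' => absurd ⟨s, t, h'⟩ h⟩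
  exact ⟨f, fun s t => hf _ s (Order.lt_add_one_iff.2 (le_pairN_left _ _)) t
    (Order.lt_add_one_iff.2 (le_pairN_right _ _)) rfl⟩

theorem exists_snd (M : Model) : ∃ f : M.D .one, ∀ s t : M.D .nat, f (pairN s t) = t := by
  obtain ⟨f, hf⟩ := exists_search_nat (M := M)
    (fun p r => ∀ s, s < p + 1 → ∀ t, t < p + 1 → pairN s t = p → r = t) fun p => by
      by_cases h : ∃ s t, pairN s t = p
      · obtain ⟨s, t, rfl⟩ := h
        exact ⟨t, fun s' _ t' _ h => (pairN_inj h).2.symm⟩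
      · exact ⟨0, fun s _ t _ h' => absurd ⟨s, t, h'⟩ h⟩
  exact ⟨f, fun s t => hf _ s (Order.lt_add_one_iff.2 (le_pairN_left _ _)) t
    (Order.lt_add_one_iff.2 (le_pairN_right _ _)) rfl⟩

/-- The first component of a pair. -/
noncomputable def fst : M.D .one := (exists_fst M).choose

/-- The second component of a pair. -/
noncomputable def snd : M.D .one := (exists_snd M).choose

theorem fst_pairN (s t : M.D .nat) : fst (pairN s t) = s := (exists_fst M).choose_spec s t

theorem snd_pairN (s t : M.D .nat) : snd (pairN s t) = t := (exists_snd M).choose_spec s t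

/-! ### Internal rational-valued functions -/

/-- The rational-valued function has an internal numerator and denominator. -/
class InternalQ (f : α → M.Rat) : Prop where
  exists_frac : ∃ a b c : α → M.D .nat, Internal a ∧ Internal b ∧ Internal c ∧
    ∀ x, f x = Rat.mk ⟨a x, b x, c x⟩

instance (priority := 2000) InternalQ.const (q : M.Rat) : InternalQ fun _ : α => q := by
  obtain ⟨⟨a, b, c⟩, rfl⟩ := Rat.exists_mk q
  exact ⟨fun _ => a, fun _ => b, fun _ => c, inferInstance, inferInstance, inferInstance,
    fun _ => rfl⟩

instance InternalQ.ofNat (f : α → M.D .nat) [Internal f] :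
    InternalQ fun x => Rat.ofNat (f x) :=
  ⟨f, fun _ => 0, fun _ => 0, inferInstance, inferInstance, inferInstance, fun _ => rfl⟩

instance InternalQ.add (f g : α → M.Rat) [hf : InternalQ f] [hg : InternalQ g] :
    InternalQ fun x => f x + g x := by
  obtain ⟨a, b, c, ha, hb, hc, h⟩ := hf
  obtain ⟨a', b', c', ha', hb', hc', h'⟩ := hg
  exact ⟨fun x => a x * (c' x + 1) + a' x * (c x + 1), fun x => b x * (c' x + 1) + b' x * (c x + 1),
    fun x => c x * c' x + c x + c' x, inferInstance, inferInstance, inferInstance,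
    fun x => by rw [h, h', Rat.mk_add]⟩

instance InternalQ.mul (f g : α → M.Rat) [hf : InternalQ f] [hg : InternalQ g] :
    InternalQ fun x => f x * g x := by
  obtain ⟨a, b, c, ha, hb, hc, h⟩ := hf
  obtain ⟨a', b', c', ha', hb', hc', h'⟩ := hg
  exact ⟨fun x => a x * a' x + b x * b' x, fun x => a x * b' x + b x * a' x,
    fun x => c x * c' x + c x + c' x, inferInstance, inferInstance, inferInstance,
    fun x => by rw [h, h', Rat.mk_mul]⟩

open Classical in
instance InternalQ.inv (f : α → M.Rat) [hf : InternalQ f] : InternalQ fun x => (f x)⁻¹ := by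
  obtain ⟨a, b, c, ha, hb, hc, h⟩ := hf
  -- One of the two truncated differences vanishes, so their sum is `|a - b|`; one is subtracted
  -- because denominators are stored as `c + 1`. For `a = b` the result is 0, matching the inverse
  -- of 0.
  refine ⟨fun x => if b x < a x then c x + 1 else 0, fun x => if a x < b x then c x + 1 else 0,
    fun x => (a x - b x) + (b x - a x) - 1, inferInstance, inferInstance, inferInstance,
    fun x => ?_⟩
  rw [h]
  dsimp only
  rcases lt_trichotomy (a x) (b x) with hx | hx | hx
  · rw [if_pos hx, if_neg hx.not_gt, tsub_eq_zero_of_le hx.le]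
    obtain ⟨d, hd⟩ := le_iff_exists_add'.1 (lt_iff_add_one_le'.1 hx)
    refine inv_eq_of_mul_eq_one_right ?_
    rw [hd, Rat.mk_mul, show 0 + (a x + 1 + d - a x) - 1 = d by
        rw [zero_add, add_assoc, add_tsub_cancel_left, add_tsub_cancel_left],
      Rat.one_eq, Rat.mk_eq, Frac.equiv_def]
    ring
  · rw [Rat.mk_eq_zero.2 hx, inv_zero, eq_comm, Rat.mk_eq_zero, if_neg (by simp [hx]),
      if_neg (by simp [hx])]
  · rw [if_pos hx, if_neg hx.not_gt, tsub_eq_zero_of_le hx.le]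
    obtain ⟨d, hd⟩ := le_iff_exists_add'.1 (lt_iff_add_one_le'.1 hx)
    refine inv_eq_of_mul_eq_one_right ?_
    rw [hd, Rat.mk_mul, show b x + 1 + d - b x + 0 - 1 = d by
        rw [add_zero, add_assoc, add_tsub_cancel_left, add_tsub_cancel_left],
      Rat.one_eq, Rat.mk_eq, Frac.equiv_def]
    ring

instance InternalQ.div (f g : α → M.Rat) [InternalQ f] [InternalQ g] :
    InternalQ fun x => f x / g x := by
  simp only [div_eq_mul_inv]; infer_instance

theorem Rat.mk_le {x y : M.Frac} : Rat.mk x ≤ Rat.mk y ↔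
    x.a * (y.c + 1) + y.b * (x.c + 1) ≤ y.a * (x.c + 1) + x.b * (y.c + 1) := by
  rw [Rat.le_def, sub_eq_add_neg, Rat.mk_neg, Rat.mk_add, Rat.nonneg_mk]
  dsimp only
  rw [add_comm (y.b * _)]

instance Dec.leQ (f g : α → M.Rat) [hf : InternalQ f] [hg : InternalQ g] :
    Dec (M := M) fun x => f x ≤ g x := by
  obtain ⟨a, b, c, ha, hb, hc, h⟩ := hf
  obtain ⟨a', b', c', ha', hb', hc', h'⟩ := hg
  simp only [h, h', Rat.mk_le]
  infer_instance

instance Dec.ltQ (f g : α → M.Rat) [InternalQ f] [InternalQ g] :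
    Dec (M := M) fun x => f x < g x := by
  simp only [← not_le]; infer_instance

/-! ### Codes of rational numbers -/

/-- The code of the rational number `(a - b) / (c + 1)`. -/
def ratN (a b c : M.D .nat) : M.D .nat := pairN a (pairN b c)

/-- The number is a code of a rational number. -/
def IsRat (p : M.D .nat) : Prop := ∃ a b c, p = ratN a b c

/-- The rational number with the code `p`. -/
noncomputable def val (p : M.D .nat) : M.Rat := Rat.mk ⟨fst p, fst (snd p), snd (snd p)⟩

theorem val_ratN (a b c : M.D .nat) : val (ratN a b c) = Rat.mk ⟨a, b, c⟩ := by
  rw [val, ratN, fst_pairN, snd_pairN, fst_pairN, snd_pairN]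

theorem isRat_iff {p : M.D .nat} :
    IsRat p ↔ p = ratN (fst p) (fst (snd p)) (snd (snd p)) := by
  constructor
  · rintro ⟨a, b, c, rfl⟩
    simp only [ratN, fst_pairN, snd_pairN]
  · exact fun h => ⟨_, _, _, h⟩

instance Internal.ratN (f g h : α → M.D .nat) [Internal f] [Internal g] [Internal h] :
    Internal fun x => Model.ratN (f x) (g x) (h x) := by
  simp only [Model.ratN]; infer_instance

instance Dec.isRat (f : α → M.D .nat) [Internal f] : Dec (M := M) fun x => IsRat (f x) := by
  simp only [isRat_iff]; infer_instance

instance InternalQ.val (f : α → M.D .nat) [Internal f] : InternalQ fun x => Model.val (f x) :=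
  ⟨_, _, _, inferInstance, inferInstance, inferInstance, fun _ => rfl⟩

theorem InternalQ.exists_code (f : α → M.Rat) [hf : InternalQ f] :
    ∃ r : α → M.D .nat, Internal r ∧ ∀ x, IsRat (r x) ∧ Model.val (r x) = f x := by
  obtain ⟨a, b, c, ha, hb, hc, h⟩ := hf
  exact ⟨fun x => Model.ratN (a x) (b x) (c x), inferInstance, fun x =>
    ⟨⟨_, _, _, rfl⟩, by rw [val_ratN, h]⟩⟩

/-! ### Powers of two -/

theorem pow2_pos (n : M.D .nat) : 0 < pow2 n :=
  nat_induction (fun n => 0 < pow2 n) (by rw [pow2_zero]; exact one_pos)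
    (fun n h => by rw [pow2_succ]; exact mul_pos two_pos h) n

theorem pow2_add (m n : M.D .nat) : pow2 (m + n) = pow2 m * pow2 n :=
  nat_induction (fun n => pow2 (m + n) = pow2 m * pow2 n) (by rw [pow2_zero, add_zero, mul_one])
    (fun n h => by rw [← add_assoc, pow2_succ, pow2_succ, h]; ring) n

theorem lt_pow2 (n : M.D .nat) : n < pow2 n :=
  nat_induction (fun n => n < pow2 n) (by rw [pow2_zero]; exact one_pos)
    (fun n h => by
      rw [pow2_succ, two_mul]
      exact add_lt_add_of_lt_of_le h (Order.one_le_iff_pos.2 (pow2_pos n))) n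

theorem pow2_mono {m n : M.D .nat} (h : m ≤ n) : pow2 m ≤ pow2 n := by
  obtain ⟨d, rfl⟩ := le_iff_exists_add'.1 h
  rw [pow2_add]
  exact le_mul_of_one_le_right zero_le (Order.one_le_iff_pos.2 (pow2_pos d))

/-- `1 / 2 ^ n` as a rational number. -/
noncomputable def eps (n : M.D .nat) : M.Rat := 1 / Rat.ofNat (pow2 n)

instance InternalQ.eps (f : α → M.D .nat) [Internal f] : InternalQ fun x => Model.eps (f x) := by
  simp only [Model.eps]; infer_instance

theorem ofNat_pow2_pos (n : M.D .nat) : 0 < Rat.ofNat (pow2 n) := by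
  rw [← map_zero Rat.ofNat, Rat.ofNat_lt]
  exact pow2_pos n

theorem eps_pos (n : M.D .nat) : 0 < eps n := div_pos one_pos (ofNat_pow2_pos n)

theorem eps_succ (n : M.D .nat) : 2 * eps (n + 1) = eps n := by
  have := (ofNat_pow2_pos n).ne'
  rw [eps, eps, pow2_succ, map_mul, map_ofNat]
  field_simp

theorem eps_zero : eps (0 : M.D .nat) = 1 := by
  rw [eps, pow2_zero, map_one, div_one]

theorem eps_anti {m n : M.D .nat} (h : m ≤ n) : eps n ≤ eps m :=
  one_div_le_one_div_of_le (ofNat_pow2_pos m) (Rat.ofNat_le.2 (pow2_mono h))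

/-- A positive fraction with denominator `c + 1` is at least `1 / (c + 1)`, and `c + 1 < 2 ^ (c +
1)`. -/
theorem exists_eps_lt {q : M.Rat} (h : 0 < q) : ∃ n : M.D .nat, eps n < q := by
  obtain ⟨⟨a, b, c⟩, rfl⟩ := Rat.exists_mk q
  refine ⟨c + 1, ?_⟩
  rw [Rat.mk_eq_div] at h ⊢
  have hc := Rat.ofNat_succ_pos c
  have hab : Rat.ofNat b < Rat.ofNat a := by
    have := (div_pos_iff_of_pos_right hc).1 h
    linarith
  rw [Rat.ofNat_lt, lt_iff_add_one_le', ← Rat.ofNat_le, map_add, map_one] at hab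
  have h₁ := Rat.ofNat_lt.2 (lt_pow2 (c + 1))
  rw [map_add, map_one] at h₁
  calc eps (c + 1) < 1 / (Rat.ofNat c + 1) := one_div_lt_one_div_of_lt hc h₁
    _ ≤ _ := by gcongr; linarith

theorem exists_eps_mul_lt {q r : M.Rat} (h : 0 < q) (n₀ : M.D .nat) :
    ∃ n, n₀ ≤ n ∧ r * eps n < q := by
  rcases le_or_gt r 0 with hr | hr
  · exact ⟨n₀, le_rfl, (mul_nonpos_of_nonpos_of_nonneg hr (eps_pos _).le).trans_lt h⟩
  · obtain ⟨n, hn⟩ := exists_eps_lt (div_pos h hr)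
    refine ⟨max n₀ n, le_max_left _ _, ?_⟩
    rw [mul_comm, ← lt_div_iff₀ hr]
    exact (eps_anti (le_max_right _ _)).trans_lt hn

end Model

end HigherOrderRM

/-! ### Semantics of the formal sentences in a model. -/

namespace HigherOrderRM

namespace Model

variable {M : Model}

/-! ### Truth of the defined notions in a model -/

theorem sat_imp {v : M.Val} {φ ψ : Fm} : Sat v (φ.imp ψ) ↔ (Sat v φ → Sat v ψ) := Iff.rfl

theorem sat_all {v : M.Val} {σ : Ty} {φ : Fm} :
    Sat v (.all σ φ) ↔ ∀ a : M.D σ, Sat (v.push a) φ := Iff.rfl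

theorem sat_eq {v : M.Val} {t u : Tm .nat} : Sat v (.eq t u) ↔ eval v t = eval v u := Iff.rfl

theorem sat_neg {v : M.Val} {φ : Fm} : Sat v φ.neg ↔ ¬ Sat v φ := Iff.rfl

theorem sat_conj {v : M.Val} {φ ψ : Fm} : Sat v (φ.conj ψ) ↔ Sat v φ ∧ Sat v ψ := by
  simp only [Fm.conj, sat_neg, sat_imp]; tauto

theorem sat_disj {v : M.Val} {φ ψ : Fm} : Sat v (φ.disj ψ) ↔ Sat v φ ∨ Sat v ψ := by
  simp only [Fm.disj, sat_neg, sat_imp]; tauto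

theorem sat_iff {v : M.Val} {φ ψ : Fm} : Sat v (φ.iff ψ) ↔ (Sat v φ ↔ Sat v ψ) := by
  simp only [Fm.iff, sat_conj, sat_imp]; tauto

theorem sat_ex {v : M.Val} {σ : Ty} {φ : Fm} :
    Sat v (.ex σ φ) ↔ ∃ a : M.D σ, Sat (v.push a) φ := by
  simp only [Fm.ex, sat_neg, sat_all, not_forall, not_not]

theorem eval_subst (v : M.Val) (s : Sub) {σ : Ty} (t : Tm σ) :
    eval v (t.subst s) = eval (fun τ n => eval v (s τ n)) t := by
  induction t with
  | app t u ih₁ ih₂ => simp only [Tm.subst, eval, ih₁, ih₂]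
  | _ => rfl

theorem eval_up_one (v : M.Val) {σ τ : Ty} (a : M.D σ) (t : Tm τ) :
    eval (v.push a) (t.up σ 1) = eval v t := by
  rw [Tm.up, eval_subst]
  congr 1
  funext ρ n
  by_cases h : ρ = σ
  · subst h
    rw [Sub.up_same]
    exact v.push_same_succ a n
  · rw [Sub.up_of_ne h]
    exact v.push_of_ne h a n

theorem eval_up_succ (v : M.Val) {σ τ : Ty} (a : M.D σ) (k : ℕ) (t : Tm τ) :
    eval (v.push a) (t.up σ (k + 1)) = eval v (t.up σ k) := by
  rw [← eval_up_one v a (t.up σ k)]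
  congr 1
  rw [Tm.up, Tm.up, Tm.up, Tm.subst_subst]
  congr 1
  funext ρ n
  by_cases h : ρ = σ
  · subst h
    simp [Sub.comp, Sub.up_same, Tm.subst, add_assoc]
  · simp [Sub.comp, Sub.up_of_ne h, Tm.subst]

theorem eval_var (v : M.Val) (σ : Ty) (n : ℕ) : eval v (.var σ n) = v σ n := rfl

theorem eval_app (v : M.Val) {σ τ : Ty} (t : Tm (.arr σ τ)) (u : Tm σ) :
    eval v (t ⬝ u) = eval v t (eval v u) := rfl

theorem eval_zero (v : M.Val) : eval v .zero = 0 := rfl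

theorem eval_suc (v : M.Val) (t : Tm .nat) : eval v (suc t) = eval v t + 1 :=
  Arith.succ_eq _

theorem eval_add (v : M.Val) (t u : Tm .nat) : eval v (add t u) = eval v t + eval v u := rfl

theorem eval_mul (v : M.Val) (t u : Tm .nat) : eval v (mul t u) = eval v t * eval v u := rfl

theorem eval_pow2 (v : M.Val) (t : Tm .nat) : eval v (HigherOrderRM.pow2 t) = pow2 (eval v t) :=
  rfl

theorem eval_pair (v : M.Val) (t u : Tm .nat) :
    eval v (pair t u) = pairN (eval v t) (eval v u) := rfl

theorem eval_rat (v : M.Val) (t u w : Tm .nat) :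
    eval v (rat t u w) = ratN (eval v t) (eval v u) (eval v w) := rfl

theorem sat_le {v : M.Val} {t u : Tm .nat} : Sat v (le t u) ↔ eval v t ≤ eval v u := Iff.rfl

theorem sat_lt {v : M.Val} {t u : Tm .nat} : Sat v (lt t u) ↔ eval v t < eval v u := by
  rw [lt, sat_le, eval_suc, lt_iff_add_one_le']

theorem sat_eqAt_one {v : M.Val} {t u : Tm .one} :
    Sat v (eqAt .one t u) ↔ eval v t = eval v u := by
  simp only [eqAt, sat_all, sat_eq, eval_app, eval_up_one, eval_var, Val.push_same_zero]
  exact ⟨M.ext, fun h n => by rw [h]⟩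

/-! ### Real numbers in a model -/

/-- The sequence of codes is a real number. -/
def IsReal (x : M.D .one) : Prop :=
  (∀ n, IsRat (x n)) ∧ ∀ n i, |val (x n) - val (x (n + i))| < eps n

/-- The ordering of the reals. -/
def LeR (x y : M.D .one) : Prop :=
  ∀ n, IsRat (x n) → IsRat (y n) → val (x n) ≤ val (y n) + 2 * eps n

/-- Equality of reals. -/
def EqR (x y : M.D .one) : Prop := LeR x y ∧ LeR y x

/-- Membership in the set given by a real-valued function. -/
def Mem (x : M.D .one) (A : M.D (.arr .one .one)) : Prop :=
  ∃ n, IsRat (A x n) ∧ 2 * eps n < val (A x n)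

/-- The real number zero. -/
def zeroReal : M.D .one := M.K .nat .nat (ratN 0 0 0)

/-- The real number one. -/
def oneReal : M.D .one := M.K .nat .nat (ratN 1 0 0)

theorem zeroReal_app (n : M.D .nat) : zeroReal n = ratN 0 0 0 := M.K_app _ _

theorem oneReal_app (n : M.D .nat) : oneReal n = ratN 1 0 0 := M.K_app _ _

theorem val_zero : val (ratN 0 0 0 : M.D .nat) = 0 := by rw [val_ratN]; rfl

theorem val_one : val (ratN 1 0 0 : M.D .nat) = 1 := by rw [val_ratN]; rfl

theorem isRat_ratN (a b c : M.D .nat) : IsRat (ratN a b c) := ⟨_, _, _, rfl⟩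

theorem frac_le {a b c a' b' c' u d : M.D .nat} (hd : 0 < d) :
    d * (a * (c' + 1) + b' * (c + 1)) ≤
      d * (a' * (c + 1) + b * (c' + 1)) + u * ((c + 1) * (c' + 1)) ↔
    Rat.mk ⟨a, b, c⟩ ≤ Rat.mk ⟨a', b', c'⟩ + Rat.ofNat u / Rat.ofNat d := by
  have hd' : 0 < Rat.ofNat d := by rwa [← map_zero Rat.ofNat, Rat.ofNat_lt]
  have hc := Rat.ofNat_succ_pos c
  have hc' := Rat.ofNat_succ_pos c'
  rw [← Rat.ofNat_le]
  simp only [map_add, map_mul, map_one]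
  rw [Rat.mk_eq_div, Rat.mk_eq_div, div_add_div _ _ hc'.ne' hd'.ne',
    div_le_div_iff₀ hc (mul_pos hc' hd')]
  dsimp only
  constructor <;> intro h <;> linarith

theorem frac_lt {a b c a' b' c' u d : M.D .nat} (hd : 0 < d) :
    d * (a * (c' + 1) + b' * (c + 1)) <
      d * (a' * (c + 1) + b * (c' + 1)) + u * ((c + 1) * (c' + 1)) ↔
    Rat.mk ⟨a, b, c⟩ < Rat.mk ⟨a', b', c'⟩ + Rat.ofNat u / Rat.ofNat d := by
  have hd' : 0 < Rat.ofNat d := by rwa [← map_zero Rat.ofNat, Rat.ofNat_lt]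
  have hc := Rat.ofNat_succ_pos c
  have hc' := Rat.ofNat_succ_pos c'
  rw [← Rat.ofNat_lt]
  simp only [map_add, map_mul, map_one]
  rw [Rat.mk_eq_div, Rat.mk_eq_div, div_add_div _ _ hc'.ne' hd'.ne',
    div_lt_div_iff₀ hc (mul_pos hc' hd')]
  dsimp only
  constructor <;> intro h <;> linarith

theorem sat_ratLe {v : M.Val} {a b c a' b' c' u n : Tm .nat} :
    Sat v (ratLe a b c a' b' c' u (HigherOrderRM.pow2 n)) ↔
      Rat.mk ⟨eval v a, eval v b, eval v c⟩ ≤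
        Rat.mk ⟨eval v a', eval v b', eval v c'⟩ + Rat.ofNat (eval v u) * eps (eval v n) := by
  simp only [ratLe, sat_le, eval_add, eval_mul, eval_suc, eval_pow2]
  rw [frac_le (pow2_pos _), eps, mul_one_div]

theorem sat_ratLt {v : M.Val} {a b c a' b' c' u n : Tm .nat} :
    Sat v (ratLt a b c a' b' c' u (HigherOrderRM.pow2 n)) ↔
      Rat.mk ⟨eval v a, eval v b, eval v c⟩ <
        Rat.mk ⟨eval v a', eval v b', eval v c'⟩ + Rat.ofNat (eval v u) * eps (eval v n) := by
  simp only [ratLt, sat_lt, eval_add, eval_mul, eval_suc, eval_pow2]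
  rw [frac_lt (pow2_pos _), eps, mul_one_div]

theorem eval_up_zero (v : M.Val) {σ τ : Ty} (t : Tm τ) : eval v (t.up σ 0) = eval v t := by
  rw [Tm.up, eval_subst]
  congr 1
  funext ρ n
  by_cases h : ρ = σ
  · subst h; rw [Sub.up_same]; rfl
  · rw [Sub.up_of_ne h]; rfl

theorem sat_isReal {v : M.Val} {x : Tm .one} : Sat v (isReal x) ↔ IsReal (eval v x) := by
  simp only [isReal, sat_conj, sat_all, sat_ex, Fm.allNat, sat_imp, sat_eq, sat_ratLt, eval_app,
    eval_up_succ, eval_up_zero, eval_var, eval_rat, eval_suc, eval_zero, eval_add,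
    Val.push_same_zero, Val.push_same_succ, zero_add, map_one, one_mul]
  refine and_congr_right fun h => ⟨fun h' n i => ?_, fun h' n i a b c a' b' c' e e' => ?_⟩
  · obtain ⟨a, b, c, e⟩ := h n
    obtain ⟨a', b', c', e'⟩ := h (n + i)
    have := h' n i a b c a' b' c' e e'
    rw [e, e', val_ratN, val_ratN, abs_sub_lt_iff, sub_lt_iff_lt_add', sub_lt_iff_lt_add']
    exact this
  · have := h' n i
    rw [e, e', val_ratN, val_ratN, abs_sub_lt_iff, sub_lt_iff_lt_add', sub_lt_iff_lt_add'] at this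
    exact this

theorem sat_leR {v : M.Val} {x y : Tm .one} :
    Sat v (leR x y) ↔ LeR (eval v x) (eval v y) := by
  simp only [leR, sat_all, Fm.allNat, sat_imp, sat_eq, sat_ratLe, eval_app,
    eval_up_succ, eval_up_zero, eval_var, eval_rat, eval_suc, eval_zero,
    Val.push_same_zero, Val.push_same_succ, zero_add, one_add_one_eq_two, map_ofNat]
  constructor
  · rintro h n ⟨a, b, c, e⟩ ⟨a', b', c', e'⟩
    rw [e, e', val_ratN, val_ratN]
    exact h n a b c a' b' c' e e'
  · intro h n a b c a' b' c' e e'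
    have := h n ⟨a, b, c, e⟩ ⟨a', b', c', e'⟩
    rwa [e, e', val_ratN, val_ratN] at this

theorem sat_eqR {v : M.Val} {x y : Tm .one} :
    Sat v (eqR x y) ↔ EqR (eval v x) (eval v y) := by
  rw [eqR, sat_conj, sat_leR, sat_leR]; rfl

theorem eval_zeroR (v : M.Val) : eval v zeroR = zeroReal := rfl

theorem eval_oneR (v : M.Val) : eval v oneR = oneReal := rfl

theorem sat_mem {v : M.Val} {x : Tm .one} {A : Tm (.arr .one .one)} :
    Sat v (mem x A) ↔ Mem (eval v x) (eval v A) := by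
  rw [mem, ltR, sat_neg, sat_leR, eval_zeroR, eval_app, LeR, Mem, not_forall]
  refine exists_congr fun n => ?_
  rw [zeroReal_app, val_zero, zero_add]
  simp [isRat_ratN]

/-! ### The principles in a model -/

/-- The function is an element of Cantor space. -/
def IsBin (f : M.D .one) : Prop := ∀ n, f n ≤ 1

/-- The function maps reals to reals and respects equality of reals. -/
def IsRealToReal (F : M.D (.arr .one .one)) : Prop :=
  (∀ x, IsReal x → IsReal (F x)) ∧ ∀ x, IsReal x → ∀ y, IsReal y → EqR x y → EqR (F x) (F y)

/-- The functional maps equal reals to the same number. -/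
def IsRealToNat (Y : M.D .two) : Prop :=
  ∀ x, IsReal x → ∀ y, IsReal y → EqR x y → Y x = Y y

/-- The functional is injective on the set of reals. -/
def InjOnReal (Y : M.D .two) (A : M.D (.arr .one .one)) : Prop :=
  ∀ x, IsReal x → ∀ y, IsReal y → Mem x A → Mem y A → Y x = Y y → EqR x y

/-- The function represents a subset of Cantor space. -/
def IsCantorSet (A : M.D (.arr .one .one)) : Prop := ∀ f, IsBin f → IsReal (A f)

/-- The functional is injective on the subset of Cantor space. -/
def InjOnBin (Y : M.D .two) (A : M.D (.arr .one .one)) : Prop :=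
  ∀ f, IsBin f → ∀ g, IsBin g → Mem f A → Mem g A → Y f = Y g → f = g

/-- The lexicographic ordering. -/
def LeLex (f g : M.D .one) : Prop := f = g ∨ ∃ n, (∀ m, m < n → f m = g m) ∧ f n < g n

/-- `cocode₀` in a model. -/
def Cocode (M : Model) : Prop :=
  ∀ (A : M.D (.arr .one .one)) (Y : M.D .two), IsRealToReal A → IsRealToNat Y →
    InjOnReal Y A → (∀ x, IsReal x → Mem x A → LeR zeroReal x ∧ LeR x oneReal) →
    (∃ x, IsReal x ∧ Mem x A) →
    ∃ X : M.D (.arr .nat .one), (∀ n, IsReal (X n) ∧ Mem (X n) A) ∧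
      ∀ x, IsReal x → (Mem x A ↔ ∃ n, EqR (X n) x)

/-- `BWC₀` in a model. -/
def BWC (M : Model) : Prop :=
  ∀ (A : M.D (.arr .one .one)) (Y : M.D .two), IsCantorSet A → InjOnBin Y A →
    ∃ s, IsBin s ∧ (∀ f, IsBin f → Mem f A → LeLex f s) ∧
      ∀ g, IsBin g → (∀ f, IsBin f → Mem f A → LeLex f g) → LeLex s g

/-- `BWC₀^pwo` in a model. -/
def BWCPw (M : Model) : Prop :=
  ∀ (A : M.D (.arr .one .one)) (Y : M.D .two), IsCantorSet A → InjOnBin Y A →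
    ∃ s, IsBin s ∧ (∀ f, IsBin f → Mem f A → ∀ n, f n ≤ s n) ∧
      ∀ k, s k = 1 → ∃ f, IsBin f ∧ Mem f A ∧ f k = 1

/-- `range₀` in a model. -/
def Range (M : Model) : Prop :=
  ∀ (A : M.D (.arr .one .one)) (Y : M.D .two), IsCantorSet A → InjOnBin Y A →
    ∃ X, IsBin X ∧ ∀ n, (∃ f, IsBin f ∧ Mem f A ∧ Y f = n) ↔ X n = 1

/-- `IND₀` in a model. -/
def Ind (M : Model) : Prop :=
  ∀ Y : M.D (.arr .one .one),
    (∀ n, ∀ f, IsBin f → ∀ g, IsBin g → Y f n = 0 → Y g n = 0 → f = g) →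
    ∀ k, ∃ (w : M.D (.arr .nat .one)) (l : M.D .nat), ∀ m, m ≤ k →
      ((∃ i, i < l ∧ IsBin (w i) ∧ Y (w i) m = 0) ↔ ∃ f, IsBin f ∧ Y f m = 0)

theorem sat_isBin {v : M.Val} {f : Tm .one} : Sat v (isBin f) ↔ IsBin (eval v f) := by
  simp only [isBin, sat_all, sat_le, eval_app, eval_up_one, eval_var, Val.push_same_zero, eval_suc,
    eval_zero, zero_add]
  rfl

theorem Val.push_one_nat (v : M.Val) (a : M.D .nat) (n : ℕ) : v.push a .one n = v .one n :=
  v.push_of_ne (by decide) a n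

theorem Val.push_oneone_nat (v : M.Val) (a : M.D .nat) (n : ℕ) :
    v.push a (.arr .one .one) n = v (.arr .one .one) n :=
  v.push_of_ne (by decide) a n

theorem Val.push_natone_nat (v : M.Val) (a : M.D .nat) (n : ℕ) :
    v.push a (.arr .nat .one) n = v (.arr .nat .one) n :=
  v.push_of_ne (by decide) a n

theorem Val.push_two_nat (v : M.Val) (a : M.D .nat) (n : ℕ) : v.push a .two n = v .two n :=
  v.push_of_ne (by decide) a n

theorem Val.push_nat_one (v : M.Val) (a : M.D .one) (n : ℕ) : v.push a .nat n = v .nat n :=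
  v.push_of_ne (by decide) a n

theorem Val.push_oneone_one (v : M.Val) (a : M.D .one) (n : ℕ) :
    v.push a (.arr .one .one) n = v (.arr .one .one) n :=
  v.push_of_ne (by decide) a n

theorem Val.push_natone_one (v : M.Val) (a : M.D .one) (n : ℕ) :
    v.push a (.arr .nat .one) n = v (.arr .nat .one) n :=
  v.push_of_ne (by decide) a n

theorem Val.push_two_one (v : M.Val) (a : M.D .one) (n : ℕ) : v.push a .two n = v .two n :=
  v.push_of_ne (by decide) a n

theorem Val.push_oneone_two (v : M.Val) (a : M.D .two) (n : ℕ) :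
    v.push a (.arr .one .one) n = v (.arr .one .one) n :=
  v.push_of_ne (by decide) a n

theorem Val.push_oneone_natone (v : M.Val) (a : M.D (.arr .nat .one)) (n : ℕ) :
    v.push a (.arr .one .one) n = v (.arr .one .one) n :=
  v.push_of_ne (by decide) a n

theorem sat_cocode0 {v : M.Val} : Sat v cocode0 ↔ M.Cocode := by
  simp only [cocode0, isRealToReal, isRealToNat, injOnReal, allReal, exReal, sat_all, sat_imp,
    sat_ex, sat_conj, sat_iff, sat_isReal, sat_eqR, sat_leR, sat_mem, sat_eq, eval_app,
    eval_up_succ, eval_up_zero, eval_var, eval_zeroR, eval_oneR,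
    Val.push_same_zero, Val.push_same_succ, Val.push_one_nat, Val.push_oneone_nat, Val.push_natone_nat,
    Val.push_oneone_one, Val.push_natone_one,
    Val.push_oneone_two, Val.push_oneone_natone]
  rfl

theorem sat_allCountableBin {v : M.Val} {φ : Fm} : Sat v (allCountableBin φ) ↔
    ∀ (A : M.D (.arr .one .one)) (Y : M.D .two), IsCantorSet A → InjOnBin Y A →
      Sat ((v.push A).push Y) φ := by
  simp only [allCountableBin, isCantorSet, injOnBin, allBin, sat_all, sat_imp,
    sat_isReal, sat_isBin, sat_mem, sat_eq, sat_eqAt_one, eval_app,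
    eval_up_succ, eval_up_zero, eval_var,
    Val.push_same_zero, Val.push_same_succ, Val.push_oneone_two]
  rfl

theorem sat_leLex {v : M.Val} {f g : Tm .one} :
    Sat v (leLex f g) ↔ LeLex (eval v f) (eval v g) := by
  simp only [leLex, sat_disj, sat_ex, sat_conj, sat_all, sat_imp, sat_lt, sat_eq, sat_eqAt_one,
    eval_app, eval_up_succ, eval_up_zero, eval_var, Val.push_same_zero, Val.push_same_succ]
  rfl

theorem sat_BWC0 {v : M.Val} : Sat v BWC0 ↔ M.BWC := by
  simp only [BWC0, isSupLex, isUbLex, allBin, sat_allCountableBin, sat_ex, sat_conj, sat_all,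
    sat_imp, sat_isBin, sat_mem, sat_leLex, eval_up_succ, eval_up_zero, eval_var,
    Val.push_same_zero, Val.push_oneone_one, Val.push_oneone_two]
  rfl

theorem sat_BWC0pwo {v : M.Val} : Sat v BWC0pwo ↔ M.BWCPw := by
  simp only [BWC0pwo, isSupPw, lePw, allBin, exBin, sat_allCountableBin, sat_ex, sat_conj, sat_all,
    sat_imp, sat_isBin, sat_mem, sat_le, sat_eq, eval_up_succ, eval_up_zero, eval_var, eval_app,
    eval_suc, eval_zero, zero_add,
    Val.push_same_zero, Val.push_oneone_one, Val.push_oneone_two, Val.push_nat_one]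
  rfl

theorem sat_range0 {v : M.Val} : Sat v range0 ↔ M.Range := by
  simp only [range0, exBin, sat_allCountableBin, sat_ex, sat_conj, sat_all,
    sat_iff, sat_isBin, sat_mem, sat_eq, eval_var, eval_app, eval_suc, eval_zero, zero_add,
    Val.push_same_zero, Val.push_oneone_one, Val.push_oneone_two, Val.push_oneone_nat,
    Val.push_one_nat, Val.push_nat_one, Val.push_two_one, Val.push_two_nat]
  rfl

theorem sat_IND0 {v : M.Val} : Sat v IND0 ↔ M.Ind := by
  simp only [IND0, allBin, exBin, sat_ex, sat_conj, sat_all, sat_imp,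
    sat_iff, sat_isBin, sat_eq, sat_lt, sat_le, sat_eqAt_one, eval_var, eval_app, eval_zero,
    Val.push_same_zero, Val.push_same_succ, Val.push_oneone_one, Val.push_oneone_nat,
    Val.push_natone_nat, Val.push_oneone_natone, Val.push_nat_one]
  rfl

end Model

end HigherOrderRM

/-! ### Grilliot's trick, unique choice, and `range₀` versus `BWC₀^pwo`. -/

namespace HigherOrderRM

namespace Model

variable {M : Model} {α : Type} [Ctx M α]

/-! ### Representing decidable predicates -/

theorem Dec.exists_rep {σ : Ty} (P : M.D σ → Prop) [hP : Dec (M := M) P] :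
    ∃ c : M.D (.arr σ .nat), ∀ x, P x ↔ c x ≠ 0 := by
  obtain ⟨χ, hχ, h⟩ := hP
  obtain ⟨c, hc⟩ := Internal.exists_rep χ
  exact ⟨c, fun x => by rw [hc]; exact h x⟩

theorem Dec.exists_rep₂ {σ τ : Ty} (P : M.D σ → M.D τ → Prop)
    [hP : Dec (M := M) fun p : M.D σ × M.D τ => P p.1 p.2] :
    ∃ c : M.D (.arr σ (.arr τ .nat)), ∀ x y, P x y ↔ c x y ≠ 0 := by
  obtain ⟨χ, hχ, h⟩ := hP
  obtain ⟨G, hG, e⟩ := hχ.poly.exists_lam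
  have := Internal.mk hG
  obtain ⟨c, hc⟩ := Internal.exists_rep G
  exact ⟨c, fun x y => by rw [hc, e]; exact h (x, y)⟩

/-! ### `∃²` from discontinuity -/

/-- Grilliot's trick. -/
theorem hasE2_of_discontinuous (P : M.D .one → Prop) [Dec (M := M) P] (x : M.D .one)
    (x' : M.D (.arr .nat .one)) (hx : P x) (hx' : ∀ n, ¬ P (x' n))
    (h : ∀ n m, m < n → x' n m = x m) : HasE2 M := by
  obtain ⟨c, hc⟩ := Dec.exists_rep P
  -- `Y g m` is the first zero of `g` up to `m`, or `m + 1` if there is none; only bounded search is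
  -- involved.
  obtain ⟨Y, hY⟩ := exists_search
    (fun (g : M.D .one) (m l : M.D .nat) => (l ≤ m ∧ g l = 0 ∨ l = m + 1) ∧ ∀ i, i < l → g i ≠ 0) fun g m => by
      by_cases h : ∃ l, l ≤ m ∧ g l = 0
      · obtain ⟨l, hl, hlt⟩ := exists_least _ h
        exact ⟨l, .inl hl, fun i hi h0 => hlt i hi ⟨hi.le.trans hl.1, h0⟩⟩
      · push Not at h
        exact ⟨m + 1, .inr rfl, fun i hi => h i (Order.lt_add_one_iff.1 hi)⟩
  -- The diagonal sequence `m ↦ x' (Y g m) m` is `x` when `g` has no zero and `x' n` when `n` is the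
  -- first zero: for `m < n` it takes `x' (m + 1) m`, on which `x` and `x' n` agree. Hence `P` tells
  -- the two cases apart.
  refine ⟨Model.lam fun g => c (Model.lam fun m => x' (Y g m) m), fun g => ?_⟩
  rw [lam_app, ← hc]
  constructor
  · intro hP
    by_contra! hg
    obtain ⟨n, hn, hlt⟩ := exists_least _ hg
    refine hx' n ?_
    convert hP using 1
    refine M.ext fun m => ?_
    rw [lam_app]
    obtain ⟨h₁, h₂⟩ := hY g m
    rcases h₁ with ⟨h₁, h₃⟩ | h₁
    · rw [le_antisymm (not_lt.1 fun hl => h₂ _ hl hn) (not_lt.1 fun hl => hlt _ hl h₃)]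
    · have : m < n := by
        refine not_le.1 fun hm => h₂ n ?_ hn
        rw [h₁]
        exact Order.lt_add_one_iff.2 hm
      rw [h₁, h _ _ this, h _ _ (Order.lt_add_one_iff.2 le_rfl)]
  · intro hg
    convert hx using 1
    refine M.ext fun m => ?_
    rw [lam_app]
    obtain ⟨⟨-, h₁⟩ | h₁, h₂⟩ := hY g m
    · exact absurd h₁ (hg _)
    · rw [h₁, h _ _ (Order.lt_add_one_iff.2 le_rfl)]

theorem IsBin.eq_zero_or_one {f : M.D .one} (h : IsBin f) (n : M.D .nat) :
    f n = 0 ∨ f n = 1 := by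
  rcases (h n).lt_or_eq with h | h
  · exact .inl (Order.lt_one_iff.1 h)
  · exact .inr h

open Classical in
-- Flipping the `n`-th bit of `f` gives binary sequences that converge to `f` but violate `P`.
theorem hasE2_of_unique (P : M.D .one → Prop) [Dec (M := M) P] {f : M.D .one} (hf : IsBin f)
    (hP : P f) (h : ∀ g, IsBin g → P g → g = f) : HasE2 M := by
  refine hasE2_of_discontinuous P f
    (Model.lam fun n => Model.lam fun m => if m = n then 1 - f m else f m) hP (fun n hn => ?_)
    fun n m hm => ?_
  · simp only [lam_app] at hn
    have := h _ (fun m => ?_) hn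
    · have := congrArg (fun g => M.app g n) this
      simp only [lam_app, if_true] at this
      rcases hf.eq_zero_or_one n with h' | h' <;> simp [h'] at this
    · rw [lam_app]
      split_ifs
      · exact tsub_le_self
      · exact hf m
  · simp only [lam_app]
    rw [if_neg hm.ne]

/-- Membership in the part of the set `A` that the functional `Y` maps to `n`. -/
def Fiber (A : M.D (.arr .one .one)) (Y : M.D .two) (f : M.D .one) (n : M.D .nat) : Prop :=
  IsBin f ∧ Mem f A ∧ Y f = n

theorem InjOnBin.fiber_eq {A : M.D (.arr .one .one)} {Y : M.D .two} (h : InjOnBin Y A)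
    {f g : M.D .one} {n : M.D .nat} (hf : Fiber A Y f n) (hg : Fiber A Y g n) : f = g :=
  h f hf.1 g hg.1 hf.2.1 hg.2.1 (hf.2.2.trans hg.2.2.symm)

/-- Membership in `A` is an existential statement, but fixing the index `k` that witnesses it for
`f` leaves a decidable condition, which injectivity makes unique. -/
theorem InjOnBin.hasE2 {A : M.D (.arr .one .one)} {Y : M.D .two} (h : InjOnBin Y A)
    {f : M.D .one} {n : M.D .nat} (hf : Fiber A Y f n) : HasE2 M := by
  obtain ⟨k, hk⟩ := hf.2.1
  refine hasE2_of_unique (fun g => (IsRat (A g k) ∧ 2 * eps k < val (A g k)) ∧ Y g = n) hf.1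
    ⟨hk, hf.2.2⟩ fun g hg hP => h.fiber_eq ⟨hg, ⟨k, hP.1⟩, hP.2⟩ hf

section HasE2

variable [HasE2 M]

instance Dec.isBin (f : α → M.D .one) [Internal f] : Dec (M := M) fun x => IsBin (f x) := by
  have := Internal.comp_proj (fun p : α × M.D .nat => p.1) f
  simp only [IsBin]; infer_instance

instance Dec.mem (f : α → M.D .one) (A : α → M.D (.arr .one .one)) [Internal f] [Internal A] :
    Dec (M := M) fun x => Mem (f x) (A x) := by
  have := Internal.comp_proj (fun p : α × M.D .nat => p.1) f
  have := Internal.comp_proj (fun p : α × M.D .nat => p.1) A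
  simp only [Mem]; infer_instance

instance Dec.fiber (A : α → M.D (.arr .one .one)) (Y : α → M.D .two) (f : α → M.D .one)
    (n : α → M.D .nat) [Internal A] [Internal Y] [Internal f] [Internal n] :
    Dec (M := M) fun x => Fiber (A x) (Y x) (f x) (n x) := by
  simp only [Fiber]; infer_instance

instance Dec.fiber_left (A : M.D (.arr .one .one)) (Y : M.D .two) (f : M.D .one) :
    Dec (M := M) (Fiber A Y f) :=
  Dec.fiber (fun _ => A) (fun _ => Y) (fun _ => f) fun n => n

end HasE2

/-! ### Sets given by characteristic functions -/

theorem isReal_oneReal : IsReal (oneReal : M.D .one) :=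
  ⟨fun n => by rw [oneReal_app]; exact isRat_ratN _ _ _, fun n i => by
    rw [oneReal_app, oneReal_app, sub_self, abs_zero]; exact eps_pos n⟩

theorem isReal_zeroReal : IsReal (zeroReal : M.D .one) :=
  ⟨fun n => by rw [zeroReal_app]; exact isRat_ratN _ _ _, fun n i => by
    rw [zeroReal_app, zeroReal_app, sub_self, abs_zero]; exact eps_pos n⟩

open Classical in
/-- The characteristic function of a decidable set, with real values. -/
noncomputable def charReal (P : M.D .one → Prop) : M.D (.arr .one .one) :=
  Model.lam fun x => if P x then oneReal else zeroReal

theorem charReal_app (P : M.D .one → Prop) [Dec (M := M) P] (x : M.D .one) [Decidable (P x)] :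
    charReal P x = if P x then oneReal else zeroReal := by
  rw [charReal, lam_app]
  congr

theorem charReal_congr (P : M.D .one → Prop) [Dec (M := M) P] {x y : M.D .one} (h : P x ↔ P y) :
    charReal P x = charReal P y := by
  classical
  simp only [charReal_app, h]

theorem isReal_charReal (P : M.D .one → Prop) [Dec (M := M) P] (x : M.D .one) :
    IsReal (charReal P x) := by
  classical
  rw [charReal_app]
  split_ifs
  · exact isReal_oneReal
  · exact isReal_zeroReal

theorem mem_charReal (P : M.D .one → Prop) [Dec (M := M) P] (x : M.D .one) :
    Mem x (charReal P) ↔ P x := by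
  classical
  rw [Mem, charReal_app]
  split_ifs with h
  · simp only [h, iff_true]
    -- At index 2 the required bound is `2 / 2 ^ 2`, which is below 1.
    refine ⟨0 + 1 + 1, ?_⟩
    rw [oneReal_app, val_one, eps_succ, ← mul_lt_mul_iff_right₀ (two_pos : (0 : M.Rat) < 2),
      eps_succ, eps_zero, mul_one]
    exact ⟨isRat_ratN _ _ _, one_lt_two⟩
  · simp only [h, iff_false]
    rintro ⟨n, -, hn⟩
    rw [zeroReal_app, val_zero] at hn
    exact absurd hn (mul_pos two_pos (eps_pos n)).not_gt

/-! ### Unique choice -/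

/-- Choice for sequences of functions that are determined uniquely. -/
def UniqueChoice (M : Model) : Prop :=
  ∀ c : M.D (.arr .one .one), (∀ n z z', c z n ≠ 0 → c z' n ≠ 0 → z = z') →
    ∃ W : M.D (.arr .nat .one), ∀ n z, c z n ≠ 0 → W n = z

theorem UniqueChoice.exists_seq (h : UniqueChoice M) (P : M.D .one → M.D .nat → Prop)
    [Dec (M := M) fun p : M.D .one × M.D .nat => P p.1 p.2]
    (hP : ∀ n z z', P z n → P z' n → z = z') :
    ∃ W : M.D (.arr .nat .one), ∀ n z, P z n → W n = z := by
  obtain ⟨c, hc⟩ := Dec.exists_rep₂ P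
  simp only [hc] at hP ⊢
  exact h c hP

section Graph

open Classical in
/-- The graph of a function as an element of Cantor space. -/
noncomputable def graph (u : M.D .one) : M.D .one :=
  Model.lam fun p => if u (fst p) = snd p then 1 else 0

instance Internal.graph (f : α → M.D .one) [Internal f] :
    Internal fun x => Model.graph (f x) := by
  have := Internal.comp_proj (fun p : α × M.D .nat => p.1) f
  simp only [Model.graph]; infer_instance

open Classical in
theorem graph_app (u : M.D .one) (i j : M.D .nat) :
    graph u (pairN i j) = if u i = j then 1 else 0 := by
  rw [graph, lam_app, fst_pairN, snd_pairN]

theorem isBin_graph (u : M.D .one) : IsBin (graph u) := fun n => by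
  classical
  rw [graph, lam_app]
  split_ifs
  · exact le_rfl
  · exact zero_le

/-- The function with the given graph. -/
noncomputable def ofGraph (f : M.D .one) : M.D .one :=
  Model.lam fun i => least fun j => f (pairN i j) = 1

instance Internal.ofGraph [HasE2 M] (f : α → M.D .one) [Internal f] :
    Internal fun x => Model.ofGraph (f x) := by
  have := Internal.comp_proj (fun p : α × M.D .nat => p.1) f
  have := Internal.comp_proj (fun p : (α × M.D .nat) × M.D .nat => p.1.1) f
  simp only [Model.ofGraph]; infer_instance

instance Internal.ofGraph_fun [HasE2 M] : Internal (Model.ofGraph (M := M)) :=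
  Internal.ofGraph (M := M) (α := M.D .one) fun x => x

theorem ofGraph_app [HasE2 M] (f : M.D .one) (i : M.D .nat) :
    ofGraph f i = least fun j => f (pairN i j) = 1 := by
  rw [ofGraph, lam_app]

theorem ofGraph_graph [HasE2 M] (u : M.D .one) : ofGraph (graph u) = u := by
  classical
  refine M.ext fun i => ?_
  rw [ofGraph_app]
  have := least_spec (fun j => graph u (pairN i j) = 1) ⟨u i, by rw [graph_app, if_pos rfl]⟩
  rw [graph_app] at this
  split_ifs at this with h
  · exact h.symm
  · exact absurd this zero_ne_one

end Graph

/-- The triples `(n, i, z)` with `c(z, n) ≠ 0` are mapped to `(n, i, z(i))`. This is injective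
because `n` determines `z`, and the range contains every value of every chosen `z`. Since `z` need
not be binary, a triple enters Cantor space through the graph of `n, i, z(0), z(1), …`. -/
theorem Range.uniqueChoice [HasE2 M] (h : M.Range) : UniqueChoice M := by
  classical
  intro c hc
  obtain ⟨X, -, hX⟩ := h
    (charReal fun f => c (tail (tail (ofGraph f))) (ofGraph f 0) ≠ 0 ∧ graph (ofGraph f) = f)
    (Model.lam fun f => pairN (ofGraph f 0)
      (pairN (ofGraph f 1) (ofGraph f (ofGraph f 1 + 1 + 1))))
    (fun f _ => isReal_charReal _ _) (by
      intro f _ g _ hf hg e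
      rw [mem_charReal] at hf hg
      simp only [lam_app] at e
      obtain ⟨e₀, e⟩ := pairN_inj e
      obtain ⟨e₁, e⟩ := pairN_inj e
      have ht := hc _ _ _ hf.1 (e₀ ▸ hg.1)
      rw [← hf.2, ← hg.2]
      congr 1
      refine M.ext fun i => ?_
      rcases Arith.zero_or_succ i with rfl | hi
      · exact e₀
      · rcases Arith.zero_or_succ (i - 1) with h0 | hi'
        · rw [h0, zero_add] at hi
          rw [← hi]
          exact e₁
        · rw [← hi, ← hi', ← tail_app, ← tail_app, ht, tail_app, tail_app])
  simp only [mem_charReal, lam_app] at hX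
  -- Where `z` exists for `n`, exactly one `j` has `(n, i, j)` in the range, namely `z(i)`.
  refine ⟨Model.lam fun n => Model.lam fun i => least fun j => X (pairN n (pairN i j)) = 1,
    fun n z hz => M.ext fun i => ?_⟩
  simp only [lam_app]
  have := least_spec (fun j => X (pairN n (pairN i j)) = 1) ⟨z i, ?_⟩
  · obtain ⟨f, -, hf, e⟩ := (hX _).2 this
    obtain ⟨e₀, e⟩ := pairN_inj e
    obtain ⟨e₁, e⟩ := pairN_inj e
    rw [e₀] at hf
    rw [← e, ← hc _ _ _ hf.1 hz, e₁, tail_app, tail_app]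
  · refine (hX _).1 ⟨graph (cons n (cons i z)), isBin_graph _, ?_⟩
    rw [ofGraph_graph, tail_cons, tail_cons, cons_zero, cons_succ, cons_succ]
    have : cons n (cons i z) 1 = i := by rw [← zero_add 1, cons_succ, cons_zero]
    rw [this]
    exact ⟨⟨hz, rfl⟩, rfl⟩

theorem InjOnBin.exists_enum {A : M.D (.arr .one .one)} {Y : M.D .two} (h : InjOnBin Y A)
    [HasE2 M] (hU : UniqueChoice M) :
    ∃ W : M.D (.arr .nat .one), ∀ n f, Fiber A Y f n → W n = f :=
  hU.exists_seq _ fun _ _ _ => h.fiber_eq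

/-! ### Consequences of `range₀` -/

/-- Unique choice lists all solutions `f` of `Y(f, n) = 0` along `n`; the first `k + 1` terms of the
list suffice. -/
theorem Range.ind (h : M.Range) : M.Ind := by
  intro Y hY k
  by_cases hne : ∃ f n, IsBin f ∧ Y f n = 0
  · obtain ⟨f, n, hf, hfn⟩ := hne
    have := hasE2_of_unique (fun g => Y g n = 0) hf hfn fun g hg hgn => hY n g hg f hf hgn hfn
    obtain ⟨W, hW⟩ := h.uniqueChoice.exists_seq (fun f n => IsBin f ∧ Y f n = 0)
      fun n f g hf hg => hY n f hf.1 g hg.1 hf.2 hg.2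
    refine ⟨W, k + 1, fun m hm => ⟨fun ⟨i, _, hi⟩ => ⟨_, hi⟩, fun ⟨g, hg⟩ => ?_⟩⟩
    exact ⟨m, Order.lt_add_one_iff.2 hm, by rwa [hW m g hg]⟩
  · push Not at hne
    refine ⟨Classical.arbitrary _, 0, fun m _ => ⟨?_, ?_⟩⟩
    · rintro ⟨i, hi, -⟩
      exact absurd hi not_lt_zero
    · rintro ⟨f, hf, hfm⟩
      exact absurd hfm (hne f m hf)

/-- The constant function zero. -/
def zeroFn : M.D .one := M.K .nat .nat 0

theorem zeroFn_app (n : M.D .nat) : zeroFn n = 0 := M.K_app _ _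

theorem isBin_zeroFn : IsBin (zeroFn : M.D .one) := fun n => by rw [zeroFn_app]; exact zero_le

/-- Quantification over `A` becomes quantification over the indices of its enumeration, which `∃²`
decides. -/
theorem Range.bwcPw (h : M.Range) : M.BWCPw := by
  classical
  intro A Y _ hY
  by_cases hne : ∃ f n, Fiber A Y f n
  · obtain ⟨f, n, hf⟩ := hne
    have := hY.hasE2 hf
    obtain ⟨W, hW⟩ := hY.exists_enum h.uniqueChoice
    refine ⟨Model.lam fun k => if ∃ n, Fiber A Y (W n) n ∧ W n k = 1 then 1 else 0,
      fun k => ?_, fun f hf hA k => ?_, fun k hk => ?_⟩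
    · rw [lam_app]
      split_ifs
      · exact le_rfl
      · exact zero_le
    · rcases hf.eq_zero_or_one k with h0 | h1
      · rw [h0]; exact zero_le
      · have hF : Fiber A Y f (Y f) := ⟨hf, hA, rfl⟩
        have e := hW _ _ hF
        rw [lam_app, if_pos ⟨Y f, by rw [e]; exact ⟨hF, h1⟩⟩, h1]
    · rw [lam_app] at hk
      split_ifs at hk with h'
      · obtain ⟨n, hn, hk⟩ := h'
        exact ⟨_, hn.1, hn.2.1, hk⟩
      · exact absurd hk zero_ne_one
  · refine ⟨zeroFn, isBin_zeroFn, fun f hf hA => absurd ⟨f, _, hf, hA, rfl⟩ hne, fun k hk => ?_⟩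
    rw [zeroFn_app] at hk
    exact absurd hk zero_ne_one

/-- Each `f ∈ A` is joined with the characteristic function of `{Y(f)}` in an extra column. In that
column the pointwise supremum is the union of these singletons, that is, the range. -/
theorem BWCPw.range (h : M.BWCPw) : M.Range := by
  classical
  intro A Y _ hY
  by_cases hne : ∃ f n, Fiber A Y f n
  · obtain ⟨f, n, hf⟩ := hne
    have := hY.hasE2 hf
    obtain ⟨code, hcode⟩ : ∃ code : M.D (.arr .one .one), ∀ f p, code f p =
        if fst p = 0 then if snd p = Y f then 1 else 0 else f (snd p) :=
      ⟨Model.lam fun f => Model.lam fun p =>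
        if fst p = 0 then if snd p = Y f then 1 else 0 else f (snd p),
        fun f p => by simp only [lam_app]⟩
    obtain ⟨dec, hdec⟩ : ∃ dec : M.D (.arr .one .one), ∀ g i, dec g i = g (pairN 1 i) :=
      ⟨Model.lam fun g => Model.lam fun i => g (pairN 1 i), fun g i => by simp only [lam_app]⟩
    have code_zero : ∀ f n, code f (pairN 0 n) = if n = Y f then 1 else 0 := fun f n => by
      simp only [hcode, fst_pairN, snd_pairN, if_true]
    have dec_code : ∀ f, dec (code f) = f := fun f => M.ext fun i => by
      simp only [hcode, hdec, fst_pairN, snd_pairN, if_neg one_ne_zero]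
    have isBin_code : ∀ f, IsBin f → IsBin (code f) := fun f hf p => by
      rw [hcode]
      split_ifs
      · exact le_rfl
      · exact zero_le
      · exact hf _
    obtain ⟨s, hs, hub, hex⟩ := h
      -- The last condition admits only the codes themselves, so that `g` is determined by the
      -- decoded function.
      (charReal fun g => (IsBin (dec g) ∧ Mem (dec g) A) ∧ code (dec g) = g)
      (Model.lam fun g => Y (dec g)) (fun f _ => isReal_charReal _ _) (by
        intro f _ g _ hf hg e
        rw [mem_charReal] at hf hg
        rw [lam_app, lam_app] at e
        rw [← hf.2, ← hg.2, hY _ hf.1.1 _ hg.1.1 hf.1.2 hg.1.2 e])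
    simp only [mem_charReal] at hub hex
    refine ⟨Model.lam fun n => s (pairN 0 n), fun n => by rw [lam_app]; exact hs _,
      fun n => ?_⟩
    rw [lam_app]
    constructor
    · rintro ⟨f, hf, hA, rfl⟩
      refine le_antisymm (hs _) ?_
      have := hub (code f) (isBin_code f hf) (by rw [dec_code]; exact ⟨⟨hf, hA⟩, rfl⟩)
        (pairN 0 (Y f))
      rwa [code_zero, if_pos rfl] at this
    · intro hn
      obtain ⟨g, -, hg, e⟩ := hex _ hn
      rw [← hg.2, code_zero] at e
      split_ifs at e with h'
      · exact ⟨_, hg.1.1, hg.1.2, h'.symm⟩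
      · exact absurd e zero_ne_one
  · refine ⟨zeroFn, isBin_zeroFn, fun n => ?_⟩
    rw [zeroFn_app]
    exact ⟨fun ⟨f, hf⟩ => absurd ⟨f, n, hf⟩ hne, fun h' => absurd h' zero_ne_one⟩

end Model

end HigherOrderRM

/-! ### The lexicographic supremum: `range₀` versus `BWC₀` with `IND₀`. -/

namespace HigherOrderRM

namespace Model

variable {M : Model} {α : Type} [Ctx M α]

/-! ### Initial segments of binary sequences -/

/-- The number with the binary digits `f 0, …, f (k - 1)`. -/
noncomputable def bits (f : M.D .one) (k : M.D .nat) : M.D .nat :=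
  natRec 0 (fun i r => 2 * r + f i) k

theorem bits_zero (f : M.D .one) : bits f 0 = 0 := natRec_zero _ _

theorem bits_succ (f : M.D .one) (k : M.D .nat) : bits f (k + 1) = 2 * bits f k + f k :=
  natRec_succ _ _ _

instance Internal.bits (f : α → M.D .one) (k : α → M.D .nat) [Internal f] [Internal k] :
    Internal fun x => Model.bits (f x) (k x) := by
  have := Internal.comp_proj (fun p : (α × M.D .nat) × M.D .nat => p.1.1) f
  simp only [Model.bits]; infer_instance

instance Internal.bits_left (f : M.D .one) : Internal (Model.bits f) :=
  Internal.bits (fun _ => f) fun k => k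

theorem two_mul_ne_two_mul_add_one (a b : M.D .nat) : 2 * a ≠ 2 * b + 1 := by
  intro h
  rcases le_or_gt a b with hab | hab
  · exact absurd h (Order.lt_add_one_iff.2 (mul_le_mul_right hab 2)).ne
  · have := mul_le_mul_right (Order.add_one_le_iff.2 hab) 2
    rw [h, mul_add, mul_one, ← one_add_one_eq_two, ← add_assoc] at this
    exact absurd this (not_le.2 (Order.lt_add_one_iff.2 le_rfl))

theorem two_mul_inj {a b : M.D .nat} (h : 2 * a = 2 * b) : a = b :=
  mul_left_cancel₀ two_ne_zero h

theorem IsBin.two_mul_add_inj {f g : M.D .one} (hf : IsBin f) (hg : IsBin g) {a b m n : M.D .nat}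
    (h : 2 * a + f m = 2 * b + g n) : a = b ∧ f m = g n := by
  rcases hf.eq_zero_or_one m with hm | hm <;> rcases hg.eq_zero_or_one n with hn | hn <;>
    rw [hm, hn] at h ⊢
  · exact ⟨two_mul_inj (by simpa using h), rfl⟩
  · exact absurd (by simpa using h) (two_mul_ne_two_mul_add_one a b)
  · exact absurd (by simpa using h.symm) (two_mul_ne_two_mul_add_one b a)
  · exact ⟨two_mul_inj (add_right_cancel h), rfl⟩

theorem IsBin.bits_eq_iff {f g : M.D .one} (hf : IsBin f) (hg : IsBin g) (k : M.D .nat) :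
    bits f k = bits g k ↔ ∀ i, i < k → f i = g i := by
  refine nat_induction (fun k => bits f k = bits g k ↔ ∀ i, i < k → f i = g i) ?_
    (fun k ih => ?_) k
  · rw [bits_zero, bits_zero]
    exact ⟨fun _ i hi => absurd hi not_lt_zero, fun _ => rfl⟩
  · rw [bits_succ, bits_succ]
    constructor
    · intro h i hi
      obtain ⟨h₁, h₂⟩ := hf.two_mul_add_inj hg h
      rcases (Order.lt_add_one_iff.1 hi).eq_or_lt with rfl | hi
      · exact h₂
      · exact ih.1 h₁ i hi
    · intro h
      rw [ih.2 fun i hi => h i (hi.trans (Order.lt_add_one_iff.2 le_rfl)),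
        h k (Order.lt_add_one_iff.2 le_rfl)]

/-! ### The lexicographic ordering -/

theorem exists_first_ne {f g : M.D .one} (h : f ≠ g) :
    ∃ k, (∀ m, m < k → f m = g m) ∧ f k ≠ g k := by
  obtain ⟨k, hk, hlt⟩ := exists_least (fun k => f k ≠ g k) (by
    by_contra! h'
    exact h (M.ext h'))
  exact ⟨k, fun m hm => not_not.1 (hlt m hm), hk⟩

theorem leLex_of_forall {f g : M.D .one}
    (h : ∀ k, (∀ m, m < k → f m = g m) → f k ≠ g k → f k < g k) : LeLex f g := by
  by_cases hfg : f = g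
  · exact .inl hfg
  · obtain ⟨k, h₁, h₂⟩ := exists_first_ne hfg
    exact .inr ⟨k, h₁, h k h₁ h₂⟩

theorem not_leLex {f g : M.D .one} {k : M.D .nat} (h : ∀ m, m < k → f m = g m) (hk : g k < f k) :
    ¬ LeLex f g := by
  rintro (rfl | ⟨n, hn, hlt⟩)
  · exact hk.false
  · rcases lt_trichotomy n k with hnk | rfl | hnk
    · exact hlt.ne (h n hnk)
    · exact hlt.not_gt hk
    · exact hk.ne' (hn k hnk)

/-! ### `range₀` implies `BWC₀` -/

/-- The supremum is built greedily: the next bit is 1 when some element of `A` extends the current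
prefix by 1. The enumeration of `A` makes this question arithmetical. -/
theorem Range.bwc (h : M.Range) : M.BWC := by
  classical
  intro A Y _ hY
  by_cases hne : ∃ f n, Fiber A Y f n
  · obtain ⟨f, n, hf⟩ := hne
    have := hY.hasE2 hf
    obtain ⟨W, hW⟩ := hY.exists_enum h.uniqueChoice
    -- Only recursion at type 0 is available, so a prefix of length `k` is represented by the number
    -- `r` with its binary digits, and `2 * r + 1` is the prefix extended by 1.
    let bit (k r : M.D .nat) : M.D .nat :=
      if ∃ n, Fiber A Y (W n) n ∧ bits (W n) (k + 1) = 2 * r + 1 then 1 else 0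
    have hbit : Internal fun p : M.D .nat × M.D .nat => bit p.1 p.2 := by
      simp only [bit]; infer_instance
    obtain ⟨s, hs⟩ : ∃ s : M.D .one, ∀ k,
        s k = bit k (natRec 0 (fun k r => 2 * r + bit k r) k) := by
      refine ⟨Model.lam fun k => bit k (natRec 0 (fun k r => 2 * r + bit k r) k), fun k => ?_⟩
      simp only [bit, lam_app]
    have hsb : IsBin s := fun k => by
      rw [hs]
      simp only [bit]
      split_ifs
      · exact le_rfl
      · exact zero_le
    have hc : ∀ k, natRec 0 (fun k r => 2 * r + bit k r) k = bits s k := by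
      refine nat_induction (fun k => natRec 0 (fun k r => 2 * r + bit k r) k = bits s k) ?_
        fun k ih => ?_
      · rw [natRec_zero, bits_zero]
      · rw [natRec_succ, bits_succ, hs, ih]
    have key : ∀ k, s k = 1 ↔
        ∃ f, (IsBin f ∧ Mem f A) ∧ (∀ m, m < k → f m = s m) ∧ f k = 1 := by
      intro k
      have h₁ : s k = 1 ↔ ∃ n, Fiber A Y (W n) n ∧ bits (W n) (k + 1) = 2 * bits s k + 1 := by
        rw [hs, hc]
        simp only [bit]
        split_ifs with h' <;> simp [h']
      have h₂ : ∀ f, IsBin f → (bits f (k + 1) = 2 * bits s k + 1 ↔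
          (∀ m, m < k → f m = s m) ∧ f k = 1) := by
        intro f hf
        rw [bits_succ, ← hf.bits_eq_iff hsb]
        constructor
        · intro e
          rcases hf.eq_zero_or_one k with h' | h' <;> rw [h'] at e
          · exact absurd (by simpa using e) (two_mul_ne_two_mul_add_one _ _)
          · exact ⟨two_mul_inj (add_right_cancel e), h'⟩
        · rintro ⟨e, e'⟩
          rw [e, e']
      rw [h₁]
      constructor
      · rintro ⟨n, hn, e⟩
        exact ⟨W n, ⟨hn.1, hn.2.1⟩, (h₂ _ hn.1).1 e⟩
      · rintro ⟨f, hf, e⟩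
        have hF : Fiber A Y f (Y f) := ⟨hf.1, hf.2, rfl⟩
        refine ⟨Y f, ?_⟩
        rw [hW _ _ hF]
        exact ⟨hF, (h₂ f hf.1).2 e⟩
    refine ⟨s, hsb, fun f hf hA => leLex_of_forall fun k hk hne => ?_,
      fun g hg hub => leLex_of_forall fun k hk hne => ?_⟩
    · rcases hf.eq_zero_or_one k with h' | h'
      · rw [h'] at hne ⊢
        exact pos_iff_ne_zero.2 hne.symm
      · exact absurd (h'.trans ((key k).2 ⟨f, ⟨hf, hA⟩, hk, h'⟩).symm) hne
    · rcases hg.eq_zero_or_one k with h' | h'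
      · have hsk := (hsb.eq_zero_or_one k).resolve_left fun h0 => hne (h0.trans h'.symm)
        obtain ⟨f, hf, hfs, hfk⟩ := (key k).1 hsk
        refine absurd (hub f hf.1 hf.2)
          (not_leLex (fun m hm => (hfs m hm).trans (hk m hm)) ?_)
        rw [h', hfk]
        exact one_pos
      · rw [h'] at hne ⊢
        exact (hsb k).lt_of_ne hne
  · exact ⟨zeroFn, isBin_zeroFn, fun f hf hA => absurd ⟨f, _, hf, hA, rfl⟩ hne,
      fun g _ _ => leLex_of_forall fun k _ hk => by
        rw [zeroFn_app] at hk ⊢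
        exact pos_iff_ne_zero.2 hk.symm⟩

/-! ### `BWC₀` and `IND₀` imply `range₀` -/

/-- `V` contains witnesses for all elements of the range that are at most `k`. -/
def Witnesses (A : M.D (.arr .one .one)) (Y : M.D .two) (k : M.D .nat)
    (V : M.D (.arr .nat .one)) : Prop :=
  ∀ m, m ≤ k → (∃ f, Fiber A Y f m) → Fiber A Y (V m) m

/-- `IND₀` gives an unindexed finite list of witnesses; `∃²` recognises which entry belongs to which
`m`. -/
theorem Ind.exists_witnesses [HasE2 M] (h : M.Ind) {A : M.D (.arr .one .one)} {Y : M.D .two}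
    (hY : InjOnBin Y A) (k : M.D .nat) : ∃ V, Witnesses A Y k V := by
  classical
  obtain ⟨w, l, hw⟩ := h (Model.lam fun f => Model.lam fun m => if Fiber A Y f m then 0 else 1)
    (fun n f _ g _ hf hg => by
      simp only [lam_app, ite_eq_left_iff, one_ne_zero, imp_false, not_not] at hf hg
      exact hY.fiber_eq hf hg) k
  simp only [lam_app, ite_eq_left_iff, one_ne_zero, imp_false, not_not] at hw
  refine ⟨Model.lam fun m => w (least fun i => i < l ∧ Fiber A Y (w i) m), fun m hm ⟨f, hf⟩ => ?_⟩
  rw [lam_app]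
  obtain ⟨i, hi, hwi⟩ := (hw m hm).2 ⟨f, hf.1, hf⟩
  exact (least_spec (fun i => i < l ∧ Fiber A Y (w i) m) ⟨i, hi, hwi.2⟩).2

/-- The position of the first zero at an odd place. -/
noncomputable def mark (g : M.D .one) : M.D .nat := least fun n => g (2 * n + 1) = 0

/-- The `i`-th of the functions that are coded behind the mark. -/
noncomputable def slice (g : M.D .one) (i : M.D .nat) : M.D .one :=
  Model.lam fun m => g (2 * mark g + 2 + pairN i m)

theorem slice_app (g : M.D .one) (i m : M.D .nat) :
    slice g i m = g (2 * mark g + 2 + pairN i m) := lam_app _ _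

/-- The sequence `g` consists of a finite part of the range together with its witnesses. -/
def IsApprox (A : M.D (.arr .one .one)) (Y : M.D .two) (g : M.D .one) : Prop :=
  (∃ n, g (2 * n + 1) = 0) ∧
    -- The claim is one-sided: an entry 1 must be backed by a witness, whereas an entry 0 asserts
    -- nothing.
    (∀ i, i < mark g + 1 → g (2 * i) = 1 → Fiber A Y (slice g i) i) ∧
    -- All places that hold no witness are 0, including those whose offset is not the code of a
    -- pair.
    ∀ q, ¬ (fst q < mark g + 1 ∧ g (2 * fst q) = 1 ∧ pairN (fst q) (snd q) = q) →
      g (2 * mark g + 2 + q) = 0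

open Classical in
/-- The part of the range given by the witnesses in `V`, up to the mark `n`, with the witnesses. -/
noncomputable def approx (A : M.D (.arr .one .one)) (Y : M.D .two) (V : M.D (.arr .nat .one))
    (n : M.D .nat) : M.D .one :=
  Model.lam fun p =>
    if p < 2 * n + 1 then if ∃ i, i < p + 1 ∧ p = 2 * i ∧ ¬ Fiber A Y (V i) i then 0 else 1
    -- The place `p = 2 * n + 1` also reaches this branch; the conjunct `2 * n + 2 ≤ p` fails there
    -- and yields the 0 that serves as the mark.
    else if fst (p - (2 * n + 2)) < n + 1 ∧
        Fiber A Y (V (fst (p - (2 * n + 2)))) (fst (p - (2 * n + 2))) ∧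
        pairN (fst (p - (2 * n + 2))) (snd (p - (2 * n + 2))) = p - (2 * n + 2) ∧ 2 * n + 2 ≤ p
      then V (fst (p - (2 * n + 2))) (snd (p - (2 * n + 2))) else 0

/-- The part up to the mark says which witnesses follow, and injectivity of `Y` leaves no freedom
for them. Hence these sequences form a countable set, indexed by finite data. -/
theorem IsApprox.eq_of {A : M.D (.arr .one .one)} {Y : M.D .two} {g g' : M.D .one}
    (hY : InjOnBin Y A) (h : IsApprox A Y g)
    (h' : IsApprox A Y g') (hm : mark g = mark g')
    (hlt : ∀ p, p < 2 * mark g + 2 → g p = g' p) : g = g' := by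
  refine M.ext fun p => ?_
  rcases lt_or_ge p (2 * mark g + 2) with hp | hp
  · exact hlt p hp
  · obtain ⟨q, rfl⟩ := le_iff_exists_add'.1 hp
    by_cases hq : fst q < mark g + 1 ∧ g (2 * fst q) = 1 ∧ pairN (fst q) (snd q) = q
    · have e := hlt (2 * fst q) (by
        rw [← one_add_one_eq_two, ← add_assoc, one_add_one_eq_two]
        exact (Order.lt_add_one_iff.2 (mul_le_mul_right (Order.lt_add_one_iff.1 hq.1) 2)).trans
          (Order.lt_add_one_iff.2 le_rfl))
      have := hY.fiber_eq (h.2.1 _ hq.1 hq.2.1) (h'.2.1 _ (hm ▸ hq.1) (e ▸ hq.2.1))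
      have := congrArg (fun f => M.app f (snd q)) this
      rwa [slice_app, slice_app, hq.2.2, ← hm] at this
    · rw [h.2.2 q hq, hm, h'.2.2 q]
      rintro ⟨h₁, h₂, h₃⟩
      rw [← hm] at h₁
      refine hq ⟨h₁, ?_, h₃⟩
      rw [hlt _ ?_, h₂]
      rw [← one_add_one_eq_two, ← add_assoc, one_add_one_eq_two]
      exact (Order.lt_add_one_iff.2 (mul_le_mul_right (Order.lt_add_one_iff.1 h₁) 2)).trans
          (Order.lt_add_one_iff.2 le_rfl)

section HasE2

variable [HasE2 M] {A : M.D (.arr .one .one)} {Y : M.D .two} {V : M.D (.arr .nat .one)}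
  {n : M.D .nat}

instance Internal.mark (g : α → M.D .one) [Internal g] : Internal fun x => Model.mark (g x) := by
  have := Internal.comp_proj (fun p : α × M.D .nat => p.1) g
  simp only [Model.mark]; infer_instance

instance Internal.mark_fun : Internal (Model.mark (M := M)) :=
  Internal.mark (M := M) (α := M.D .one) fun x => x

instance Internal.slice (g : α → M.D .one) (i : α → M.D .nat) [Internal g] [Internal i] :
    Internal fun x => Model.slice (g x) (i x) := by
  have := Internal.comp_proj (fun p : α × M.D .nat => p.1) g
  have := Internal.comp_proj (fun p : α × M.D .nat => p.1) i
  simp only [Model.slice]; infer_instance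

set_option synthInstance.maxSize 512 in
instance Dec.isApprox (A : M.D (.arr .one .one)) (Y : M.D .two) :
    Dec (M := M) (IsApprox A Y) := by
  have : Dec (M := M) fun g => IsApprox A Y g := by simp only [IsApprox]; infer_instance
  exact this

theorem isBin_approx (A : M.D (.arr .one .one)) (Y : M.D .two) (V : M.D (.arr .nat .one))
    (n : M.D .nat) : IsBin (approx A Y V n) := by
  intro p
  simp only [approx, lam_app]
  split_ifs with h₁ h₂ h₃
  · exact zero_le
  · exact le_rfl
  · exact h₃.2.1.1 _
  · exact zero_le

theorem approx_two_mul {i : M.D .nat} (hi : i ≤ n) :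
    approx A Y V n (2 * i) = 1 ↔ Fiber A Y (V i) i := by
  simp only [approx, lam_app]
  rw [if_pos (Order.lt_add_one_iff.2 (mul_le_mul_right hi 2))]
  split_ifs with h
  · obtain ⟨j, -, e, hj⟩ := h
    rw [← two_mul_inj e] at hj
    simp [hj]
  · simp only [true_iff]
    by_contra hV
    exact h ⟨i, Order.lt_add_one_iff.2 (le_mul_of_one_le_left zero_le one_le_two), rfl, hV⟩

theorem approx_two_mul_add_one {i : M.D .nat} (hi : i < n) :
    approx A Y V n (2 * i + 1) = 1 := by
  simp only [approx, lam_app]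
  rw [if_pos, if_neg]
  · rintro ⟨j, -, e, -⟩
    exact two_mul_ne_two_mul_add_one _ _ e.symm
  · have := mul_lt_mul_of_pos_left hi (two_pos : (0 : M.D .nat) < 2)
    exact add_lt_add_of_lt_of_le this le_rfl

theorem approx_mark : approx A Y V n (2 * n + 1) = 0 := by
  simp only [approx, lam_app]
  rw [if_neg (lt_irrefl _), if_neg]
  rintro ⟨-, -, -, h⟩
  rw [← one_add_one_eq_two, ← add_assoc, Order.add_one_le_iff] at h
  simp at h

theorem mark_approx : mark (approx A Y V n) = n :=
  least_eq _ approx_mark fun m hm => by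
    rw [approx_two_mul_add_one hm]; exact one_ne_zero

theorem approx_add (q : M.D .nat) [Decidable (fst q < n + 1 ∧ Fiber A Y (V (fst q)) (fst q) ∧
      pairN (fst q) (snd q) = q)] :
    approx A Y V n (2 * n + 2 + q) =
      if fst q < n + 1 ∧ Fiber A Y (V (fst q)) (fst q) ∧ pairN (fst q) (snd q) = q
      then V (fst q) (snd q) else 0 := by
  simp only [approx, lam_app]
  rw [if_neg, add_tsub_cancel_left]
  · simp only [le_self_add, and_true]
  · rw [not_lt]
    exact (add_le_add_right one_le_two _).trans le_self_add

theorem isApprox_approx : IsApprox A Y (approx A Y V n) := by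
  classical
  refine ⟨⟨n, approx_mark⟩, fun i hi h => ?_, fun q hq => ?_⟩
  · rw [mark_approx] at hi
    rw [approx_two_mul (Order.lt_add_one_iff.1 hi)] at h
    convert h using 1
    refine M.ext fun m => ?_
    rw [slice_app, mark_approx, approx_add, fst_pairN, snd_pairN, if_pos ⟨hi, h, rfl⟩]
  · rw [mark_approx] at hq ⊢
    rw [approx_add, if_neg]
    rintro ⟨h₁, h₂, h₃⟩
    exact hq ⟨h₁, (approx_two_mul (Order.lt_add_one_iff.1 h₁)).2 h₂, h₃⟩

/-- With complete witnesses, `approx` coincides up to its mark with the target: the characteristic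
function of the range at even places, ones at odd places. The target itself is not yet known to
exist in the model. -/
theorem approx_eq_one_iff (hV : Witnesses A Y n V) {p : M.D .nat} (hp : p < 2 * n + 1) :
    approx A Y V n p = 1 ↔ ∀ i, p = 2 * i → ∃ f, Fiber A Y f i := by
  simp only [approx, lam_app]
  rw [if_pos hp]
  split_ifs with h
  · obtain ⟨i, -, rfl, hi⟩ := h
    simp only [zero_ne_one, false_iff, not_forall]
    exact ⟨i, rfl, fun hf => hi (hV i (le_of_mul_le_mul_left (Order.lt_add_one_iff.1 hp) two_pos)
      hf)⟩
  · simp only [true_iff]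
    rintro i rfl
    refine ⟨V i, by_contra fun hi => h ⟨i, ?_, rfl, hi⟩⟩
    exact Order.lt_add_one_iff.2 (le_mul_of_one_le_left zero_le one_le_two)

/-- Every approximation lies lexicographically below the target: at the first difference `g` cannot
be 1, since each 1 it claims at an even place is backed by a witness and the target is 1 at odd
places. -/
theorem IsApprox.exists_zero (hI : M.Ind) (hY : InjOnBin Y A) {g : M.D .one} (hg : IsBin g)
    (h : IsApprox A Y g) :
    ∃ p, (∀ m, m < p → (g m = 1 ↔ ∀ i, m = 2 * i → ∃ f, Fiber A Y f i)) ∧ g p = 0 ∧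
      ∀ i, p = 2 * i → ∃ f, Fiber A Y f i := by
  -- The bound exceeds the mark of `g` by one, so that the complete approximation still has a 1 at
  -- the odd place where `g` has its mark; this forces a difference there or earlier.
  obtain ⟨V, hV⟩ := hI.exists_witnesses hY (mark g + 1)
  have hn : g (2 * mark g + 1) = 0 := least_spec (fun n => g (2 * n + 1) = 0) h.1
  have hlt : 2 * mark g + 1 < 2 * (mark g + 1) + 1 := by
    rw [mul_add]
    exact add_lt_add_of_lt_of_le (lt_add_of_pos_right _ (by simp)) le_rfl
  obtain ⟨p, hp, hne⟩ := exists_first_ne (f := g) (g := approx A Y V (mark g + 1)) fun e => by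
    have := approx_two_mul_add_one (A := A) (Y := Y) (V := V)
      (Order.lt_add_one_iff.2 (le_refl (mark g)))
    rw [← e, hn] at this
    exact zero_ne_one this
  have hpn : p ≤ 2 * mark g + 1 := not_lt.1 fun hlt => by
    have := hp _ hlt
    rw [hn, approx_two_mul_add_one (Order.lt_add_one_iff.2 le_rfl)] at this
    exact zero_ne_one this
  refine ⟨p, fun m hm => ?_, ?_⟩
  · rw [hp m hm, approx_eq_one_iff hV ((hm.trans_le hpn).trans hlt)]
  · rcases hg.eq_zero_or_one p with h0 | h1
    · rw [h0] at hne
      exact ⟨h0, (approx_eq_one_iff hV (hpn.trans_lt hlt)).1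
        (((isBin_approx A Y V _).eq_zero_or_one p).resolve_left hne.symm)⟩
    · rw [h1] at hne
      refine absurd ((approx_eq_one_iff hV (hpn.trans_lt hlt)).2 ?_) hne.symm
      rintro i rfl
      refine ⟨_, h.2.1 i ?_ h1⟩
      refine lt_of_mul_lt_mul_left (hpn.trans_lt ?_) (zero_le (a := (2 : M.D .nat)))
      rw [mul_add, ← one_add_one_eq_two, mul_one, ← add_assoc]
      exact Order.lt_add_one_iff.2 le_rfl

end HasE2

/-- The supremum `s` of all approximations is the target. It is not smaller, since complete
approximations with arbitrarily late marks belong to the set; it is not larger, since every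
approximation lies below the target. The range is then read off at the even places of `s`. -/
theorem BWC.range (h : M.BWC) (hI : M.Ind) : M.Range := by
  classical
  intro A Y _ hY
  by_cases hne : ∃ f n, Fiber A Y f n
  · obtain ⟨f, n, hf⟩ := hne
    have := hY.hasE2 hf
    obtain ⟨s, hs, hub, hleast⟩ := h (charReal (IsApprox A Y))
      -- The injection sends `g` to its mark together with its first `2 * mark g + 2` bits, those up
      -- to and including the mark.
      (Model.lam fun g => pairN (mark g) (bits g (2 * mark g + 2)))
      (fun f _ => isReal_charReal _ _) (by
        intro f hf g hg hfA hgA e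
        rw [mem_charReal] at hfA hgA
        rw [lam_app, lam_app] at e
        obtain ⟨e₁, e₂⟩ := pairN_inj e
        rw [← e₁, hf.bits_eq_iff hg] at e₂
        exact hfA.eq_of hY hgA e₁ e₂)
    simp only [mem_charReal] at hub hleast
    have key : ∀ p, s p = 1 ↔ ∀ i, p = 2 * i → ∃ f, Fiber A Y f i := by
      intro p
      obtain ⟨V, hV⟩ := hI.exists_witnesses hY p
      have hp : p < 2 * p + 1 :=
        Order.lt_add_one_iff.2 (le_mul_of_one_le_left zero_le one_le_two)
      rw [← approx_eq_one_iff hV hp]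
      suffices ∀ m, m < 2 * p + 1 → s m = approx A Y V p m by rw [this p hp]
      by_contra! hex
      -- The first place where `s` leaves the target. A 0 of `s` there contradicts the upper bound
      -- property, a 1 contradicts leastness.
      obtain ⟨d, ⟨hd, hne⟩, hmin⟩ := exists_least _ hex
      have heq : ∀ m, m < d → s m = approx A Y V p m := fun m hm =>
        by_contra fun h' => hmin m hm ⟨hm.trans hd, h'⟩
      rcases hs.eq_zero_or_one d with h0 | h1
      · refine not_leLex (fun m hm => (heq m hm).symm) ?_
          (hub (approx A Y V p) (isBin_approx _ _ _ _) isApprox_approx)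
        rw [h0] at hne ⊢
        exact pos_iff_ne_zero.2 hne.symm
      · have hu0 : approx A Y V p d ≠ 1 := by rw [← h1]; exact hne.symm
        rw [Ne, approx_eq_one_iff hV hd] at hu0
        -- The prefix of `s` below `d`, followed by 0 and then ones only, is smaller than `s` and
        -- still an upper bound: an approximation that agrees with the target through `d` has a 0 at
        -- `d`, and one that leaves it earlier does so with a 0 against a 1.
        refine not_leLex (f := s) (k := d)
          (g := Model.lam fun m => if m < d then s m else if m = d then 0 else 1)
          (fun m hm => ?_) ?_ (hleast _ (fun m => ?_) fun g hg hgA => ?_)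
        · rw [lam_app, if_pos hm]
        · rw [lam_app, if_neg (lt_irrefl _), if_pos rfl, h1]
          exact one_pos
        · rw [lam_app]
          split_ifs
          · exact hs m
          · exact zero_le
          · exact le_rfl
        · obtain ⟨q, hq, hq0, hq1⟩ := hgA.exists_zero hI hY hg
          have hgs : ∀ m, m < d → m < q → g m = s m := fun m hm hm' => by
            rcases hg.eq_zero_or_one m with h' | h' <;>
              rcases hs.eq_zero_or_one m with h'' | h''
            · rw [h', h'']
            · rw [heq m hm, approx_eq_one_iff hV (hm.trans hd), ← hq m hm', h'] at h''
              exact absurd h'' zero_ne_one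
            · rw [hq m hm', ← approx_eq_one_iff hV (hm.trans hd), ← heq m hm, h''] at h'
              exact absurd h' zero_ne_one
            · rw [h', h'']
          have hsq : q < d → s q = 1 := fun h => by
            rwa [heq q h, approx_eq_one_iff hV (h.trans hd)]
          refine leLex_of_forall fun m hm hne => ?_
          rw [lam_app] at hne ⊢
          rcases lt_trichotomy m d with hmd | rfl | hmd
          · rw [if_pos hmd] at hne ⊢
            rcases hs.eq_zero_or_one m with h' | h'
            · rcases lt_trichotomy m q with hmq | rfl | hmq
              · exact absurd (hgs m hmd hmq) hne
              · rw [hq0, h'] at hne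
                exact absurd rfl hne
              · have := hm q hmq
                rw [lam_app, if_pos (hmq.trans hmd), hq0, hsq (hmq.trans hmd)] at this
                exact absurd this zero_ne_one
            · rw [h'] at hne ⊢
              exact (hg m).lt_of_ne hne
          · rw [if_neg (lt_irrefl _), if_pos rfl] at hne ⊢
            have h' := (hg.eq_zero_or_one m).resolve_left hne
            rcases lt_trichotomy m q with hmq | rfl | hmq
            · exact absurd ((hq m hmq).1 h') hu0
            · exact absurd hq1 hu0
            · have := hm q hmq
              rw [lam_app, if_pos hmq, hq0, hsq hmq] at this
              exact absurd this zero_ne_one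
          · rw [if_neg hmd.not_gt, if_neg hmd.ne'] at hne ⊢
            exact (hg m).lt_of_ne hne
    refine ⟨Model.lam fun n => s (2 * n), fun n => by rw [lam_app]; exact hs _, fun n => ?_⟩
    rw [lam_app, key]
    constructor
    · intro hn i hi
      rw [← two_mul_inj hi]
      exact hn
    · exact fun hn => hn n rfl
  · refine ⟨zeroFn, isBin_zeroFn, fun n => ?_⟩
    rw [zeroFn_app]
    exact ⟨fun ⟨f, hf⟩ => absurd ⟨f, n, hf⟩ hne, fun h' => absurd h' zero_ne_one⟩

end Model

end HigherOrderRM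

/-! ### Real numbers, rational cuts and canonical base-four expansions. -/

namespace HigherOrderRM

namespace Model

variable {M : Model} {α : Type} [Ctx M α]

/-! ### Reals and their cuts -/

/-- The rational number `q` is at most the real number `x`. -/
def Cut (x : M.D .one) (q : M.Rat) : Prop := ∀ m, q ≤ val (x m) + eps m

theorem le_of_forall_eps {q r t : M.Rat} (h : ∀ m, q ≤ r + t * eps m) : q ≤ r := by
  by_contra! hlt
  obtain ⟨n, -, hn⟩ := exists_eps_mul_lt (r := t) (sub_pos.2 hlt) 0
  linarith [h n]

theorem IsReal.sub_lt {x : M.D .one} (h : IsReal x) (m n : M.D .nat) :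
    val (x m) - val (x n) < eps m + eps n := by
  have hm := eps_pos m
  have hn := eps_pos n
  rcases le_total m n with hmn | hmn <;> obtain ⟨d, rfl⟩ := le_iff_exists_add'.1 hmn
  · linarith [(abs_lt.1 (h.2 m d)).2]
  · linarith [(abs_lt.1 (h.2 n d)).1]

theorem IsReal.cut_sub {x : M.D .one} (h : IsReal x) (n : M.D .nat) :
    Cut x (val (x n) - eps n) := fun m => by linarith [h.sub_lt n m]

theorem Cut.mono {x : M.D .one} {q r : M.Rat} (h : Cut x q) (hr : r ≤ q) : Cut x r :=
  fun m => hr.trans (h m)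

/-- Passing to lower cuts turns equality of reals into genuine equality, so anything defined from
`Cut x` respects equality of reals. -/
theorem IsReal.leR_iff {x y : M.D .one} (hx : IsReal x) (hy : IsReal y) :
    LeR x y ↔ ∀ q, Cut x q → Cut y q := by
  constructor
  · intro h q hq k
    -- One `eps m` comes from the cut, two from the comparison of `x` with `y`, and one from the
    -- modulus of `y`.
    refine le_of_forall_eps (t := 4) fun m => ?_
    linarith [hq m, h m (hx.1 m) (hy.1 m), hy.sub_lt m k]
  · intro h n _ _
    linarith [h _ (hx.cut_sub n) n]

theorem IsReal.eqR_iff {x y : M.D .one} (hx : IsReal x) (hy : IsReal y) :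
    EqR x y ↔ ∀ q, Cut x q ↔ Cut y q := by
  rw [EqR, hx.leR_iff hy, hy.leR_iff hx]
  exact ⟨fun h q => ⟨h.1 q, h.2 q⟩, fun h => ⟨fun q => (h q).1, fun q => (h q).2⟩⟩

theorem EqR.cut_eq {x y : M.D .one} (h : EqR x y) (hx : IsReal x) (hy : IsReal y) :
    Cut x = Cut y := funext fun q => propext ((hx.eqR_iff hy).1 h q)

theorem IsReal.eqR_refl {x : M.D .one} (hx : IsReal x) : EqR x x :=
  (hx.eqR_iff hx).2 fun _ => Iff.rfl

theorem mem_iff_cut {x : M.D .one} {A : M.D (.arr .one .one)} (h : IsReal (A x)) :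
    Mem x A ↔ ∃ q, 0 < q ∧ Cut (A x) q := by
  constructor
  · rintro ⟨n, -, hn⟩
    exact ⟨_, by linarith [eps_pos n], h.cut_sub n⟩
  · rintro ⟨q, hq, hc⟩
    obtain ⟨n, -, hn⟩ := exists_eps_mul_lt (r := 3) hq 0
    exact ⟨n, h.1 n, by linarith [hc n]⟩

theorem IsRealToReal.mem_iff {A : M.D (.arr .one .one)} (hA : IsRealToReal A) {x y : M.D .one}
    (hx : IsReal x) (hy : IsReal y) (h : EqR x y) : Mem x A ↔ Mem y A := by
  rw [mem_iff_cut (hA.1 x hx), mem_iff_cut (hA.1 y hy),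
    (hA.2 x hx y hy h).cut_eq (hA.1 x hx) (hA.1 y hy)]

/-! ### Expansions in base four -/

theorem eps_add_two (n : M.D .nat) : 4 * eps (n + 1 + (n + 1)) = eps (n + n) := by
  rw [show n + 1 + (n + 1) = n + n + 1 + 1 by ring, ← eps_succ (n + n), ← eps_succ (n + n + 1)]
  ring

theorem exists_lt_ofNat_mul_eps (q : M.Rat) (n : M.D .nat) :
    ∃ j : M.D .nat, q < (Rat.ofNat j + 1) * eps n := by
  obtain ⟨⟨a, b, c⟩, e⟩ := Rat.exists_mk (q / eps n)
  refine ⟨a, ?_⟩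
  rw [← div_lt_iff₀ (eps_pos n), e, Rat.mk_eq_div, div_lt_iff₀ (Rat.ofNat_succ_pos c)]
  have ha := Rat.ofNat_nonneg a
  have hb := Rat.ofNat_nonneg b
  have hc := Rat.ofNat_nonneg c
  dsimp only
  nlinarith [mul_nonneg ha hc]

instance InternalQ.ofNat_fun : InternalQ (Rat.ofNat (M := M)) :=
  InternalQ.ofNat (M := M) (α := M.D .nat) fun x => x

/-- The integral part of `4 ^ n * x`. -/
noncomputable def floor4 (x : M.D .one) (n : M.D .nat) : M.D .nat :=
  least fun j => ¬ Cut x ((Rat.ofNat j + 1) * eps (n + n))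

/-- The expansion of the real number `x` in base four. -/
noncomputable def expansion (x : M.D .one) : M.D .one := Model.lam fun n => floor4 x n

theorem expansion_congr {x y : M.D .one} (h : Cut x = Cut y) : expansion x = expansion y := by
  simp only [expansion, floor4, h]

/-- The real number with the given expansion in base four. -/
noncomputable def realOf (z : M.D .one) : M.D .one :=
  -- The denominator is `4 ^ n`, stored with one subtracted.
  Model.lam fun n => ratN (z n) 0 (pow2 (n + n) - 1)

theorem isRat_realOf (z : M.D .one) (n : M.D .nat) : IsRat (realOf z n) := by
  rw [realOf, lam_app]
  exact isRat_ratN _ _ _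

theorem val_realOf (z : M.D .one) (n : M.D .nat) :
    val (realOf z n) = Rat.ofNat (z n) * eps (n + n) := by
  rw [realOf, lam_app, val_ratN, Rat.mk_eq_div, eps, mul_one_div]
  dsimp only
  rw [map_zero, sub_zero, ← map_one Rat.ofNat, ← map_add,
    tsub_add_cancel_of_le (Order.one_le_iff_pos.2 (pow2_pos _))]

instance Internal.realOf (z : α → M.D .one) [Internal z] :
    Internal fun x => Model.realOf (z x) := by
  have := Internal.comp_proj (fun p : α × M.D .nat => p.1) z
  simp only [Model.realOf]; infer_instance

/-- The sequence is an expansion in base four. -/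
def IsExpansion (z : M.D .one) : Prop :=
  ∀ n, 4 * z n ≤ z (n + 1) ∧ z (n + 1) ≤ 4 * z n + 3

theorem IsExpansion.mono {z : M.D .one} (h : IsExpansion z) (n i : M.D .nat) :
    val (realOf z n) ≤ val (realOf z (n + i)) := by
  refine nat_induction (fun i => val (realOf z n) ≤ val (realOf z (n + i))) ?_ (fun i ih => ?_) i
  · rw [add_zero]
  · refine ih.trans ?_
    have := Rat.ofNat_le.2 (h (n + i)).1
    rw [map_mul, map_ofNat] at this
    rw [← add_assoc, val_realOf, val_realOf, ← eps_add_two (n + i)]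
    nlinarith [eps_pos (n + i + 1 + (n + i + 1))]

/-- With digits at most 3, the right end points of the base-four intervals decrease. Together with
the increasing left end points this gives the rate of convergence of a real. -/
theorem IsExpansion.anti {z : M.D .one} (h : IsExpansion z) (n i : M.D .nat) :
    val (realOf z (n + i)) + eps (n + i + (n + i)) ≤ val (realOf z n) + eps (n + n) := by
  refine nat_induction (fun i => val (realOf z (n + i)) + eps (n + i + (n + i)) ≤
    val (realOf z n) + eps (n + n)) ?_ (fun i ih => ?_) i
  · rw [add_zero]
  · refine le_trans ?_ ih
    have := Rat.ofNat_le.2 (h (n + i)).2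
    rw [map_add, map_mul, map_ofNat, map_ofNat] at this
    rw [← add_assoc, val_realOf, val_realOf, ← eps_add_two (n + i)]
    nlinarith [eps_pos (n + i + 1 + (n + i + 1))]

theorem eps_add_self_le (n : M.D .nat) : eps (n + n) ≤ eps n := eps_anti le_self_add

theorem IsExpansion.isReal {z : M.D .one} (h : IsExpansion z) : IsReal (realOf z) := by
  refine ⟨isRat_realOf z, fun n i => ?_⟩
  rw [abs_sub_comm, abs_of_nonneg (sub_nonneg.2 (h.mono n i))]
  linarith [h.anti n i, eps_add_self_le n, eps_pos (n + i + (n + i))]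

section HasE2

variable [HasE2 M]

instance Dec.cut (x : α → M.D .one) (q : α → M.Rat) [Internal x] [hq : InternalQ q] :
    Dec (M := M) fun a => Cut (x a) (q a) := by
  have := Internal.comp_proj (fun p : α × M.D .nat => p.1) x
  obtain ⟨a, b, c, ha, hb, hc, h⟩ := hq
  have := Internal.comp_proj (fun p : α × M.D .nat => p.1) a
  have := Internal.comp_proj (fun p : α × M.D .nat => p.1) b
  have := Internal.comp_proj (fun p : α × M.D .nat => p.1) c
  have : InternalQ fun p : α × M.D .nat => q p.1 :=
    ⟨fun p => a p.1, fun p => b p.1, fun p => c p.1, inferInstance, inferInstance, inferInstance,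
      fun p => h p.1⟩
  simp only [Cut]; infer_instance

instance Internal.expansion (x : α → M.D .one) [Internal x] :
    Internal fun a => Model.expansion (x a) := by
  have := Internal.comp_proj (fun p : (α × M.D .nat) × M.D .nat => p.1.1) x
  simp only [Model.expansion, floor4]; infer_instance

instance Internal.expansion_fun : Internal (Model.expansion (M := M)) :=
  Internal.expansion (M := M) (α := M.D .one) fun x => x

theorem expansion_app (x : M.D .one) (n : M.D .nat) : expansion x n = floor4 x n :=
  haveI : Internal fun n => floor4 x n := by simp only [floor4]; infer_instance
  lam_app _ _

theorem cut_expansion {x : M.D .one} (h : Cut x 0) (n : M.D .nat) :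
    Cut x (Rat.ofNat (expansion x n) * eps (n + n)) := by
  rw [expansion_app]
  rcases Arith.zero_or_succ (floor4 x n) with h0 | h1
  · rwa [h0, map_zero, zero_mul]
  · by_contra hc
    rw [← h1, map_add, map_one] at hc
    have := least_le (fun j => ¬ Cut x ((Rat.ofNat j + 1) * eps (n + n))) hc
    rw [← floor4, ← Order.lt_add_one_iff, h1] at this
    exact this.false

theorem not_cut_expansion (x : M.D .one) (n : M.D .nat) :
    ¬ Cut x ((Rat.ofNat (expansion x n) + 1) * eps (n + n)) := by
  rw [expansion_app]
  refine least_spec (fun j => ¬ Cut x ((Rat.ofNat j + 1) * eps (n + n))) ?_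
  obtain ⟨j, hj⟩ := exists_lt_ofNat_mul_eps (val (x 0) + eps 0) (n + n)
  exact ⟨j, fun h => (h 0).not_gt hj⟩

theorem le_expansion {x : M.D .one} {j n : M.D .nat} (h : Cut x (Rat.ofNat j * eps (n + n))) :
    j ≤ expansion x n := by
  by_contra! hlt
  rw [lt_iff_add_one_le', ← Rat.ofNat_le, map_add, map_one] at hlt
  exact not_cut_expansion x n (h.mono (mul_le_mul_of_nonneg_right hlt (eps_pos _).le))

theorem expansion_lt {x : M.D .one} (h0 : Cut x 0) {j n : M.D .nat}
    (h : ¬ Cut x (Rat.ofNat j * eps (n + n))) : expansion x n < j := by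
  by_contra! hle
  exact h ((cut_expansion h0 n).mono
    (mul_le_mul_of_nonneg_right (Rat.ofNat_le.2 hle) (eps_pos _).le))

theorem isExpansion_expansion {x : M.D .one} (h : Cut x 0) : IsExpansion (expansion x) := by
  intro n
  constructor
  · refine le_expansion ((cut_expansion h n).mono ?_)
    rw [map_mul, map_ofNat, ← eps_add_two n]
    linarith
  · rw [← Order.lt_add_one_iff]
    refine expansion_lt h fun hc => not_cut_expansion x n (hc.mono ?_)
    rw [map_add, map_add, map_mul, map_ofNat, map_ofNat, map_one, ← eps_add_two n]
    linarith

theorem eqR_realOf_expansion {x : M.D .one} (hx : IsReal x) (h : Cut x 0) :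
    EqR (realOf (expansion x)) x := by
  rw [(isExpansion_expansion h).isReal.eqR_iff hx]
  intro q
  constructor
  · intro hq k
    refine le_of_forall_eps (t := 1) fun m => ?_
    have := hq m
    rw [val_realOf] at this
    linarith [cut_expansion h m k]
  · intro hq m
    rw [val_realOf]
    by_contra! hlt
    refine not_cut_expansion x m (hq.mono ?_)
    linarith [eps_add_self_le m]

end HasE2

end Model

end HigherOrderRM

/-! ### Cantor space inside the unit interval; `range₀` versus `cocode₀`. -/

namespace HigherOrderRM

namespace Model

variable {M : Model} {α : Type} [Ctx M α]

/-! ### Binary sequences as reals -/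

/-- The expansion in base four with the digits `f`. -/
noncomputable def expand (f : M.D .one) : M.D .one :=
  Model.lam fun n => natRec 0 (fun i r => 4 * r + f i) n

theorem expand_zero (f : M.D .one) : expand f 0 = 0 := by
  rw [expand, lam_app, natRec_zero]

theorem expand_succ (f : M.D .one) (n : M.D .nat) :
    expand f (n + 1) = 4 * expand f n + f n := by
  rw [expand, lam_app, natRec_succ, lam_app]

instance Internal.expand (f : α → M.D .one) [Internal f] :
    Internal fun x => Model.expand (f x) := by
  have := Internal.comp_proj (fun p : α × M.D .nat => p.1) f
  have := Internal.comp_proj (fun p : ((α × M.D .nat) × M.D .nat) × M.D .nat => p.1.1.1) f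
  simp only [Model.expand]; infer_instance

/-- The digits of an expansion in base four. -/
noncomputable def digits (z : M.D .one) : M.D .one := Model.lam fun n => z (n + 1) - 4 * z n

instance Internal.digits (z : α → M.D .one) [Internal z] :
    Internal fun x => Model.digits (z x) := by
  have := Internal.comp_proj (fun p : α × M.D .nat => p.1) z
  simp only [Model.digits]; infer_instance

theorem digits_expand (f : M.D .one) : digits (expand f) = f :=
  M.ext fun n => by rw [digits, lam_app, expand_succ, add_tsub_cancel_left]

theorem IsBin.isExpansion {f : M.D .one} (hf : IsBin f) : IsExpansion (expand f) := fun n => by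
  rw [expand_succ]
  refine ⟨le_self_add, add_le_add_right ((hf n).trans ?_) _⟩
  rw [← two_add_one_eq_three]
  exact le_add_self

/-- Digits at most 1 contribute at most a third of the base-four interval, which keeps the real away
from the right end point. -/
theorem IsBin.anti {f : M.D .one} (hf : IsBin f) (n i : M.D .nat) :
    3 * val (realOf (expand f) (n + i)) + eps (n + i + (n + i)) ≤
      3 * val (realOf (expand f) n) + eps (n + n) := by
  refine nat_induction (fun i => 3 * val (realOf (expand f) (n + i)) + eps (n + i + (n + i)) ≤
      3 * val (realOf (expand f) n) + eps (n + n)) ?_ (fun i ih => ?_) i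
  · rw [add_zero]
  · refine le_trans ?_ ih
    have := Rat.ofNat_le.2 (hf (n + i))
    rw [map_one] at this
    rw [← add_assoc, val_realOf, val_realOf, ← eps_add_two (n + i), expand_succ, map_add, map_mul,
      map_ofNat]
    nlinarith [eps_pos (n + i + 1 + (n + i + 1))]

/-- Base four is used because the digits 0 and 1 alone never produce two expansions of one real, so
`f` is recovered from the real it codes. -/
theorem expansion_realOf_expand [HasE2 M] {f : M.D .one} (hf : IsBin f) :
    expansion (realOf (expand f)) = expand f := by
  have hE := hf.isExpansion
  have hcut : ∀ n, Cut (realOf (expand f)) (val (realOf (expand f) n)) := fun n m => by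
    rcases le_total n m with h | h <;> obtain ⟨d, rfl⟩ := le_iff_exists_add'.1 h
    · linarith [hE.mono n d, eps_pos (n + d)]
    · linarith [hE.anti m d, eps_pos (m + d + (m + d)), eps_add_self_le m]
  refine M.ext fun n => le_antisymm ?_ ?_
  · rw [← Order.lt_add_one_iff]
    refine expansion_lt ((hcut n).mono ?_) fun hc => ?_
    · rw [val_realOf]
      exact mul_nonneg (Rat.ofNat_nonneg _) (eps_pos _).le
    -- At this index the error is half of `eps (n + n)` and the later digits add at most a third of
    -- it, which cannot fill the whole interval.
    · have h₁ := hc (n + (n + 1))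
      have h₂ := hf.anti n (n + 1)
      have h₃ := eps_pos (n + (n + 1) + (n + (n + 1)))
      have h₄ := eps_succ (n + n)
      rw [val_realOf (expand f) n] at h₂
      rw [map_add, map_one] at h₁
      rw [add_assoc] at h₄
      linarith [eps_pos (n + n)]
  · refine le_expansion ?_
    rw [← val_realOf]
    exact hcut n

theorem cut_realOf_zero (z : M.D .one) : Cut (realOf z) 0 := fun m => by
  rw [val_realOf]
  exact add_nonneg (mul_nonneg (Rat.ofNat_nonneg _) (eps_pos _).le) (eps_pos m).le

theorem cut_zero_of_leR {x : M.D .one} (hx : IsReal x) (h : LeR zeroReal x) : Cut x 0 :=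
  (isReal_zeroReal.leR_iff hx).1 h 0 fun m => by
    rw [zeroReal_app, val_zero, zero_add]
    exact (eps_pos m).le

/-! ### Discontinuity from a countable set of reals -/

/-- Representations of reals different from `x₀` converge to a representation of `x₀`. By
injectivity they cannot satisfy a decidable condition that implies membership in `A` and has the
same value of `Y`, so Grilliot's trick applies. -/
theorem InjOnReal.hasE2 {A : M.D (.arr .one .one)} {Y : M.D .two} (h : InjOnReal Y A)
    (hA : IsRealToReal A) {x₀ : M.D .one} (hx₀ : IsReal x₀) (hm : Mem x₀ A) : HasE2 M := by
  classical
  obtain ⟨r, hr, hr'⟩ := InternalQ.exists_code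
    fun p : M.D .nat × M.D .nat => val (x₀ (p.2 + 1)) + eps (p.1 + 1)
  -- From place `m` on, the sequence is shifted by `eps (m + 1)`. Using `x₀ (n + 1)` in place of `x₀
  -- n` halves the permitted error and leaves room for this jump.
  obtain ⟨x', hx'⟩ : ∃ x' : M.D (.arr .nat .one), ∀ m n,
      x' m n = if n < m then x₀ (n + 1) else r (m, n) :=
    ⟨Model.lam fun m => Model.lam fun n => if n < m then x₀ (n + 1) else r (m, n), fun m n => by
      have : Internal fun n => r (m, n) := by
        obtain ⟨e, he⟩ := Internal.curry (fun m n => r (m, n)) m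
        have : Internal fun n => e n := inferInstance
        simpa only [he] using this
      rw [lam_app, lam_app]⟩
  have hv : ∀ m n, IsRat (x' m n) ∧
      val (x' m n) = val (x₀ (n + 1)) + if n < m then 0 else eps (m + 1) := fun m n => by
    rw [hx']
    split_ifs
    · exact ⟨hx₀.1 _, (add_zero _).symm⟩
    · exact hr' _
  have ht : ∀ n i, |val (x₀ (n + 1)) - val (x₀ (n + i + 1))| < eps (n + 1) := fun n i => by
    rw [add_right_comm]
    exact hx₀.2 _ _
  have hx : IsReal (tail x₀) := ⟨fun n => by rw [tail_app]; exact hx₀.1 _, fun n i => by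
    rw [tail_app, tail_app]
    exact (ht n i).trans_le (eps_anti le_self_add)⟩
  have hxR : ∀ m, IsReal (x' m) := fun m => ⟨fun n => (hv m n).1, fun n i => by
    have h₁ := abs_lt.1 (ht n i)
    have h₂ := eps_succ n
    have h₃ := eps_pos (n + 1)
    have h₄ := eps_pos (m + 1)
    rw [(hv m n).2, (hv m (n + i)).2, abs_lt]
    split_ifs with h h' h'
    · constructor <;> linarith
    · have : eps (m + 1) ≤ eps (n + 1) := eps_anti (add_le_add_left h.le 1)
      constructor <;> linarith
    · exact absurd (le_self_add.trans_lt h') h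
    · constructor <;> linarith⟩
  have hne : ∀ m, ¬ LeR (x' m) (tail x₀) := fun m hle => by
    -- At index `m + 3` the tolerance is `eps (m + 2)`, smaller than the shift `eps (m + 1)`.
    have := hle (m + 1 + 1 + 1) (hv m _).1 (hx.1 _)
    rw [(hv m _).2, tail_app, if_neg (by simp [add_assoc])] at this
    linarith [eps_succ (m + 1), eps_succ (m + 1 + 1), eps_pos (m + 1)]
  have hxx₀ : EqR (tail x₀) x₀ := by
    constructor <;> intro n _ _ <;> rw [tail_app] <;>
      linarith [hx₀.sub_lt n (n + 1), hx₀.sub_lt (n + 1) n, eps_succ n, eps_pos n]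
  have hmx : Mem (tail x₀) A := (hA.mem_iff hx hx₀ hxx₀).2 hm
  obtain ⟨k, hk⟩ := hmx
  refine hasE2_of_discontinuous
    (fun y => (IsRat (A y k) ∧ 2 * eps k < val (A y k)) ∧ Y y = Y (tail x₀)) (tail x₀) x'
    ⟨hk, rfl⟩ (fun m hP => hne m ?_) fun n m hmn => by rw [hx', if_pos hmn, tail_app]
  exact (h _ (hxR m) _ hx ⟨k, hP.1⟩ ⟨k, hk⟩ hP.2).1

/-! ### `range₀` and `cocode₀` -/

/-- Unique choice needs unique objects, but a real has many representations. Each element of `A` is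
therefore replaced by its canonical base-four expansion, which its value under `Y` determines. -/
theorem Range.cocode (h : M.Range) : M.Cocode := by
  classical
  intro A Y hA hYR hY hI ⟨x₀, hx₀, hm⟩
  have := hY.hasE2 hA hx₀ hm
  let P (z : M.D .one) (n : M.D .nat) : Prop :=
    (IsExpansion z ∧ Mem (realOf z) A) ∧ expansion (realOf z) = z ∧ Y (realOf z) = n
  have hP : Dec (M := M) fun p : M.D .one × M.D .nat => P p.1 p.2 := by
    simp only [P, IsExpansion]; infer_instance
  obtain ⟨W, hW⟩ := h.uniqueChoice.exists_seq P fun n z z' hz hz' => by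
    have e := hY _ hz.1.1.isReal _ hz'.1.1.isReal hz.1.2 hz'.1.2 (hz.2.2.trans hz'.2.2.symm)
    rw [← hz.2.1, ← hz'.2.1, expansion_congr (e.cut_eq hz.1.1.isReal hz'.1.1.isReal)]
  obtain ⟨X, hX⟩ : ∃ X : M.D (.arr .nat .one), ∀ n,
      -- Indices outside the range receive the given element `x₀`, as the sequence must stay in `A`.
      X n = if P (W n) n then realOf (W n) else x₀ := by
    have : Dec (M := M) fun n => P (W n) n := by
      simp only [P, IsExpansion]; infer_instance
    exact ⟨Model.lam fun n => if P (W n) n then realOf (W n) else x₀, fun n => lam_app _ _⟩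
  have hXA : ∀ n, IsReal (X n) ∧ Mem (X n) A := fun n => by
    rw [hX]
    split_ifs with hn
    · exact ⟨hn.1.1.isReal, hn.1.2⟩
    · exact ⟨hx₀, hm⟩
  refine ⟨X, hXA, fun x hx => ⟨fun hxA => ?_, fun ⟨n, hn⟩ =>
    (hA.mem_iff (hXA n).1 hx hn).1 (hXA n).2⟩⟩
  have h0 := cut_zero_of_leR hx (hI x hx hxA).1
  have hE := isExpansion_expansion h0
  have e := eqR_realOf_expansion hx h0
  have hz : P (expansion x) (Y (realOf (expansion x))) :=
    ⟨⟨hE, (hA.mem_iff hE.isReal hx e).2 hxA⟩, expansion_congr (e.cut_eq hE.isReal hx), rfl⟩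
  refine ⟨Y (realOf (expansion x)), ?_⟩
  rw [hX, hW _ _ hz, if_pos hz]
  exact e

/-- The base-four images of the elements of `A` form a countable set of reals, and `∃²` finds the
range of `Y` along an enumeration of it. The set is defined through canonical expansions, so it
respects equality of reals. -/
theorem Cocode.range (h : M.Cocode) : M.Range := by
  classical
  intro A Y _ hY
  by_cases hne : ∃ f n, Fiber A Y f n
  · obtain ⟨f₀, n₀, hf₀⟩ := hne
    have := hY.hasE2 hf₀
    let P (x : M.D .one) : Prop := (Cut x 0 ∧ IsBin (digits (expansion x)) ∧
      Mem (digits (expansion x)) A) ∧ expansion x = expand (digits (expansion x))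
    have hP : Dec (M := M) P := by
      have : Dec (M := M) fun x => P x := by simp only [P]; infer_instance
      exact this
    have hcongr : ∀ x y, Cut x = Cut y → (P x ↔ P y) := fun x y e => by
      simp only [P, e, expansion_congr e]
    have hPf : ∀ f, IsBin f → Mem f A → P (realOf (expand f)) := fun f hf hfA => by
      simp only [P]
      rw [expansion_realOf_expand hf, digits_expand]
      exact ⟨⟨cut_realOf_zero _, hf, hfA⟩, rfl⟩
    obtain ⟨X, hXA, hX⟩ := h (charReal P) (Model.lam fun x => Y (digits (expansion x)))
      ⟨fun x _ => isReal_charReal P x, fun x hx y hy e => by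
        rw [charReal_congr P (hcongr x y (e.cut_eq hx hy))]
        exact (isReal_charReal P y).eqR_refl⟩
      (fun x hx y hy e => by rw [lam_app, lam_app, expansion_congr (e.cut_eq hx hy)])
      (fun x hx y hy hxP hyP e => by
        rw [mem_charReal] at hxP hyP
        rw [lam_app, lam_app] at e
        have e' := hY _ hxP.1.2.1 _ hyP.1.2.1 hxP.1.2.2 hyP.1.2.2 e
        have e₁ := eqR_realOf_expansion hx hxP.1.1
        have e₂ := eqR_realOf_expansion hy hyP.1.1
        rw [hxP.2, e', ← hyP.2] at e₁
        have hR := (isExpansion_expansion hyP.1.1).isReal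
        rw [hx.eqR_iff hy, ← e₁.cut_eq hR hx, e₂.cut_eq hR hy]
        exact fun _ => Iff.rfl)
      (fun x hx hxP => by
        rw [mem_charReal] at hxP
        rw [isReal_zeroReal.leR_iff hx, hx.leR_iff isReal_oneReal]
        refine ⟨fun q hq => hxP.1.1.mono ?_, fun q hq m => ?_⟩
        · refine le_of_forall_eps (t := 1) fun m => ?_
          have := hq m
          rw [zeroReal_app, val_zero] at this
          linarith
        -- The integral part of `x` is `expand _ 0 = 0`, so `x` stays below 1.
        · have := not_cut_expansion x 0
          rw [hxP.2, expand_zero, map_zero, add_zero, eps_zero] at this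
          rw [oneReal_app, val_one]
          by_contra! hlt
          exact this (hq.mono (by linarith [eps_pos m])))
      ⟨realOf (expand f₀), hf₀.1.isExpansion.isReal,
        (mem_charReal P _).2 (hPf f₀ hf₀.1 hf₀.2.1)⟩
    refine ⟨Model.lam fun n => if ∃ m, Y (digits (expansion (X m))) = n then 1 else 0,
      fun n => ?_, fun n => ?_⟩
    · rw [lam_app]
      split_ifs
      · exact le_rfl
      · exact zero_le
    · rw [lam_app]
      simp only [ite_eq_left_iff, zero_ne_one, imp_false, not_not]
      constructor
      · rintro ⟨f, hf, hfA, rfl⟩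
        have hR := hf.isExpansion.isReal
        obtain ⟨m, hm⟩ := (hX _ hR).1 ((mem_charReal P _).2 (hPf f hf hfA))
        refine ⟨m, ?_⟩
        rw [expansion_congr (hm.cut_eq (hXA m).1 hR), expansion_realOf_expand hf, digits_expand]
      · rintro ⟨m, rfl⟩
        have := (mem_charReal P _).1 (hXA m).2
        exact ⟨_, this.1.2.1, this.1.2.2, rfl⟩
  · refine ⟨zeroFn, isBin_zeroFn, fun n => ?_⟩
    rw [zeroFn_app]
    exact ⟨fun ⟨f, hf⟩ => absurd ⟨f, n, hf⟩ hne, fun h' => absurd h' zero_ne_one⟩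

end Model

end HigherOrderRM

/-! ### The equivalences, by completeness. -/

theorem theorem2p8 :
    HigherOrderRM.Proves HigherOrderRM.RCA0ω
        (HigherOrderRM.cocode0.iff (HigherOrderRM.BWC0.conj HigherOrderRM.IND0)) ∧
      HigherOrderRM.Proves HigherOrderRM.RCA0ω
        ((HigherOrderRM.BWC0.conj HigherOrderRM.IND0).iff
          (HigherOrderRM.range0.conj HigherOrderRM.IND0)) ∧
      HigherOrderRM.Proves HigherOrderRM.RCA0ω
        ((HigherOrderRM.range0.conj HigherOrderRM.IND0).iff HigherOrderRM.BWC0pwo) := by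
  refine ⟨HigherOrderRM.proves_of_forall_model fun M v => ?_,
    HigherOrderRM.proves_of_forall_model fun M v => ?_,
    HigherOrderRM.proves_of_forall_model fun M v => ?_⟩ <;>
  simp only [HigherOrderRM.Model.sat_iff, HigherOrderRM.Model.sat_conj,
    HigherOrderRM.Model.sat_cocode0, HigherOrderRM.Model.sat_BWC0,
    HigherOrderRM.Model.sat_BWC0pwo, HigherOrderRM.Model.sat_range0,
    HigherOrderRM.Model.sat_IND0]
  · exact ⟨fun h => ⟨h.range.bwc, h.range.ind⟩, fun h => (h.1.range h.2).cocode⟩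
  · exact ⟨fun h => ⟨h.1.range h.2, h.2⟩, fun h => ⟨h.1.bwc, h.2⟩⟩
  · exact ⟨fun h => h.1.bwcPw, fun h => ⟨h.range, h.range.ind⟩⟩
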